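/- **Setting.** Let $\mathcal M$ be an episodic Markov decision process with state space $\mathcal X$, action space $\mathcal A$, horizon $H$, transition kernels $P^h(\cdot\mid x,a)$, rewards $r^h(x,a,x')\in[0,1]$ and an initial distribution. Rewards are sparse: from every state and level, under any policy, the rewards collected until the end of the episode sum to at most $1$ almost surely. Write $z=(x,a)$, $f(x)=\max_a f(x,a)$, and, for $V:\mathcal X\to\mathbb R$, $$\mathcal T V(z^h)=\mathbb E[r^h+V(x^{h+1})\mid z^h],\qquad \mathcal T_2V(z^h)=\mathbb E[(r^h+V(x^{h+1}))^2\mid z^h].$$ Let $\mathcal F^h$ ($h\in[H]$) be finite classes of functions $\mathcal X\times\mathcal A\to[0,L]$, $L\ge1$, that are $\epsilon$-complete, $\epsilon\in[0,1]$: for every $V:\mathcal X\to[0,2]$ some $f\in\mathcal F^h$ satisfies $\|f-\mathcal TV\|_\infty\le\epsilon$, and for every $V:\mathcal X\to[0,1]$ some $f\in\mathcal F^h$ satisfies $\|f-\mathcal T_2V\|_\infty\le\epsilon$. Let $\mathcal W$ be a finite class of bonus functions, $\mathcal N=\max_h|\mathcal F^h|$, $\mathcal N_b=|\mathcal W|$,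 and let $T\in\mathbb N$, $0<\alpha\le1$, $\lambda>0$, $\delta>0$, $\epsilon_b\ge0$ and thresholds $u_t\in\mathbb R$ be given. Put $$D_{\mathcal F}(z;z_{[n]},\sigma_{[n]})^2=\sup_{f_1,f_2\in\mathcal F}\frac{(f_1(z)-f_2(z))^2}{\sum_{s\le n}\sigma_s^{-2}(f_1(z_s)-f_2(z_s))^2+\lambda}.$$ **Parameters.** Let $\delta'=\frac{\delta}{(T+1)(H+1)}$, $\Lambda=\bigl(2\log\frac{4LT}{\alpha}+2\bigr)\bigl(\log\frac{8L}{\alpha^2}+2\bigr)$, $\upsilon=\sqrt{\log(\mathcal N^2\Lambda/\delta')}$, $\iota=3\sqrt{\log(\mathcal N\mathcal N_b\Lambda/\delta')}$, $\dot\iota^2=2\log\frac{\mathcal N\mathcal N_b(2\log(18LT)+2)(\log(18L)+2)}{\delta'}$, $\iota'^2=2\log\frac{\mathcal N\mathcal N_b(2\log(32LT)+2)(\log(32L)+2)}{\delta'}$, and $$\beta_{t,1}=\sqrt{6\sqrt\lambda+156}\;\upsilon+\sqrt{8tL\epsilon/\alpha^2},\quad \beta_{t,2}^2=2(24L+21)\dot\iota^2+20tL\epsilon,\quad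 \bar\beta_t^2=8(11L+9)\iota'^2+32tL\epsilon .$$ **Bonus oracle.** $\mathcal B$ is a consistent bonus oracle for the radii $\beta_{t,1}$ and for the radii $\beta_{t,2}$. That is, for $\beta_t=\beta_{t,1}$ and for $\beta_t=\beta_{t,2}$, each $h\in[H]$, $t\in[T]$, weights $\sigma_{[t-1]}\ge\alpha$, data $\{(z_s,r_s,x'_s)\}_{s\in[t-1]}$ and $\hat f\in\mathcal F^h$, the output $b=\mathcal B(\sigma_{[t-1]},\text{data},\mathcal F^h,\hat f,\beta_t)$ lies in $\mathcal W$, is nonnegative, satisfies $b\ge|f-\hat f|$ pointwise for each $f\in\mathcal F^h$ with $\sum_{s<t}\sigma_s^{-2}(f(z_s)-\hat f(z_s))^2\le\beta_t^2$, and satisfies $b(z)\le C\bigl(D_{\mathcal F^h}(z;z_{[t-1]},\sigma_{[t-1]})\sqrt{\beta_t^2+\lambda}+\epsilon_b\beta_t\bigr)$ with a constant $0<C<\infty$. Consistent: for $t\le t'\le T$, if the weights and data at $t'$ extend those at $t$ and $\hat f_t,\hat f_{t'}\in\mathcal F^h$ are least-squares solutions for the respective weights and data, i.e. minimize $\sum_s\sigma_s^{-2}(f(z_s)-r_s-V(x'_s))^2$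 over $f\in\mathcal F^h$ for some (possibly different) target functions $V$, then the bonus at $t$ is pointwise at least the bonus at $t'$. **Algorithm (VO$Q$L).** In episodes $t=1,\dots,T$, put $f_{t,j}^{H+1}=0$ for $j=1,\pm2$ and, for $h=H,\dots,1$, let $\hat f_{t,1}^h$ minimize $\sum_{s<t}(\bar\sigma_s^h)^{-2}(f(z_s^h)-r_s^h-f_{t,1}^{h+1}(x_s^{h+1}))^2$ over $f\in\mathcal F^h$, let $\hat f_{t,\pm2}^h$ minimize $\sum_{s<t}(f(z_s^h)-r_s^h-f_{t,\pm2}^{h+1}(x_s^{h+1}))^2$, let $\hat g_t^h$ minimize $\sum_{s<t}\bigl(g(z_s^h)-(r_s^h+f_{t,1}^{h+1}(x_s^{h+1}))^2\bigr)^2$, let $b_{t,1}^h$ be the oracle's bonus for the weights $\bar\sigma^h_{[t-1]}$, centre $\hat f_{t,1}^h$ and radius $\beta_{t,1}$, let $b_{t,2}^h$ be the one for unit weights, centre $\hat f_{t,2}^h$ and radius $\beta_{t,2}$, and set $$f_{t,1}^h=\min(\hat f_{t,1}^h+b_{t,1}^h+\epsilon,1),\quad f_{t,2}^h=\min(\hat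 f_{t,2}^h+2b_{t,1}^h+b_{t,2}^h+3\epsilon,2),\quad f_{t,-2}^h=\max(\hat f_{t,-2}^h-b_{t,2}^h-\epsilon,0).$$ Then draw $x_t^1$ from the initial distribution and, for $h=1,\dots,H$, choose $a_t^h\in\arg\max_a f_{t,1}^h(x_t^h,a)$ if $f_{t,1}^{h'}(x_t^{h'})\ge f_{t,2}^{h'}(x_t^{h'})-u_t$ for all $h'\le h$, and $a_t^h\in\arg\max_af_{t,2}^h(x_t^h,a)$ otherwise; draw $x_t^{h+1}\sim P^h(\cdot\mid z_t^h)$ and receive $r_t^h=r^h(x_t^h,a_t^h,x_t^{h+1})$. The weights are $$\bar\sigma_t^h=\max\Bigl\{\sigma_t^h,\ \alpha,\ \sqrt2\,\iota\sqrt{f_{t,2}^h(z_t^h)-f_{t,-2}^h(z_t^h)},\ 2(\sqrt\upsilon+\iota)\sqrt{D_{\mathcal F^h}(z_t^h;z_{[t-1]}^h,\bar\sigma_{[t-1]}^h)}\Bigr\},$$ where $(\sigma_1^h)^2=4$ and, for $t\ge2$, $$(\sigma_t^h)^2=\min\Bigl(4,\ \hat g_t^h(z_t^h)-\hat f_{t,-2}^h(z_t^h)^2+D_{\mathcal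 F^h}(z_t^h;z_{[t-1]}^h,\mathbf 1)\bigl(\sqrt{\bar\beta_t^2+\lambda}+2L\sqrt{\beta_{t,2}^2+\lambda}\bigr)+2(1+L)\epsilon\Bigr)$$ (square roots of negative numbers are read as $0$). **Confidence sets.** $\mathcal F_{t,1}^h=\{f\in\mathcal F^h:\sum_{s<t}(\bar\sigma_s^h)^{-2}(f(z_s^h)-\hat f_{t,1}^h(z_s^h))^2\le\beta_{t,1}^2\}$, $\mathcal F_{t,\pm2}^h=\{f\in\mathcal F^h:\sum_{s<t}(f(z_s^h)-\hat f_{t,\pm2}^h(z_s^h))^2\le\beta_{t,2}^2\}$, $\mathcal G_t^h=\{g\in\mathcal F^h:\sum_{s<t}(g(z_s^h)-\hat g_t^h(z_s^h))^2\le\bar\beta_t^2\}$. **Proposition.** With probability at least $1-5\delta$ the following good event holds: for all $t\in[T]$ and $h\in[H]$ there are functions $\bar f_{t,1}^h,\bar f_{t,2}^h,\bar f_{t,-2}^h,\psi_t^h\in\mathcal F^h$ with $$\|\bar f_{t,j}^h-\mathcal Tf_{t,j}^{h+1}\|_\infty\le\epsilon\ (j=1,\pm2),\qquad \|\psi_t^h-\mathcal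 T_2f_{t,1}^{h+1}\|_\infty\le\epsilon,$$ and all such functions satisfy $\bar f_{t,1}^h\in\mathcal F_{t,1}^h$, $\bar f_{t,2}^h\in\mathcal F_{t,2}^h$, $\bar f_{t,-2}^h\in\mathcal F_{t,-2}^h$ and $\psi_t^h\in\mathcal G_t^h$. -/

import Mathlib

namespace VOQL

open MeasureTheory ProbabilityTheory

/-! Indexing: levels `h` and episodes `t` start at `0`.  Level `h < H` is the `(h+1)`-st step of an
episode, level `H` is the terminal level; episode `t < T` is the `(t+1)`-st episode, so that exactly
`t` episodes precede it. -/

/-- A time-inhomogeneous episodic Markov decision process with horizon `H`: transition kernels,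
rewards `r^h(x, a, x') ∈ [0,1]` and an initial distribution. -/
structure EpisodicMDP (X A : Type*) [MeasurableSpace X] [MeasurableSpace A] where
  H : ℕ
  P : ℕ → Kernel (X × A) X
  r : ℕ → X × A → X → ℝ
  init : Measure X
  markov : ∀ h, IsMarkovKernel (P h)
  init_prob : IsProbabilityMeasure init
  measurable_r : ∀ h, Measurable (fun p : (X × A) × X => r h p.1 p.2)
  r_mem : ∀ h < H, ∀ z x', r h z x' ∈ Set.Icc (0 : ℝ) 1

/-- One transition `(x, a, r, x')` of a data set, with `z = (x, a)`. -/
structure Sample (X A : Type*) where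
  z : X × A
  r : ℝ
  x' : X

/-- `f(x) = max_a f(x, a)`. -/
noncomputable def maxA {X A : Type*} (f : X × A → ℝ) (x : X) : ℝ := ⨆ a, f (x, a)

namespace EpisodicMDP

variable {X A : Type*} [MeasurableSpace X] [MeasurableSpace A] (M : EpisodicMDP X A)

/-- The Bellman operator `𝒯 V (z) = E[r^h + V(x^{h+1}) | z^h = z]`. -/
noncomputable def bellman (h : ℕ) (V : X → ℝ) (z : X × A) : ℝ :=
  ∫ x', (M.r h z x' + V x') ∂(M.P h z)

/-- The second-moment operator `𝒯₂ V (z) = E[(r^h + V(x^{h+1}))² | z^h = z]`. -/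
noncomputable def bellman₂ (h : ℕ) (V : X → ℝ) (z : X × A) : ℝ :=
  ∫ x', (M.r h z x' + V x') ^ 2 ∂(M.P h z)

/-- Starting from state `x` at level `h`, whatever actions are taken (they may depend on everything
seen so far), the total reward of the next `k` steps is almost surely at most `c`. -/
def RewardLE : ℕ → ℕ → ℝ → X → Prop
  | 0, _, c, _ => 0 ≤ c
  | k + 1, h, c, x =>
      ∀ a, ∀ᵐ x' ∂(M.P h (x, a)), RewardLE k (h + 1) (c - M.r h (x, a) x') x'

/-- Sparse rewards: under any policy the rewards collected until the end of the episode add up to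
at most `1`. -/
def SparseReward : Prop := ∀ h < M.H, ∀ x, M.RewardLE (M.H - h) h 1 x

/-- Optimal action values with `k` steps to go from level `h` on. -/
noncomputable def optQAux : ℕ → ℕ → X × A → ℝ
  | 0, _ => fun _ => 0
  | k + 1, h => M.bellman h (maxA (optQAux k (h + 1)))

/-- The optimal action value function `Q_⋆^h`. -/
noncomputable def optQ (h : ℕ) : X × A → ℝ := M.optQAux (M.H - h) h

end EpisodicMDP

/-- A bonus oracle: it is given the level `h`, the number `n` of past episodes, the weights and the
level-`h` samples of these episodes, a centre `f̂` and a radius `β`, and returns a bonus function. -/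
abbrev Oracle (X A : Type*) : Type _ :=
  ℕ → (n : ℕ) → (Fin n → ℝ) → (Fin n → Sample X A) → (X × A → ℝ) → ℝ → X × A → ℝ

/-- `g` minimises `∑ᵢ (f(zᵢ) - yᵢ)² / σᵢ²` over `f ∈ F`. -/
def IsLeastSquares {Z : Type*} (F : Finset (Z → ℝ)) {n : ℕ} (σ : Fin n → ℝ) (z : Fin n → Z)
    (y : Fin n → ℝ) (g : Z → ℝ) : Prop :=
  g ∈ F ∧ ∀ f ∈ F, ∑ i, (g (z i) - y i) ^ 2 / σ i ^ 2 ≤ ∑ i, (f (z i) - y i) ^ 2 / σ i ^ 2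

/-- The confidence set `{f ∈ F : ∑ᵢ (f(zᵢ) - f̂(zᵢ))² / σᵢ² ≤ β²}`. -/
def confSet {Z : Type*} (F : Finset (Z → ℝ)) {n : ℕ} (σ : Fin n → ℝ) (z : Fin n → Z)
    (fhat : Z → ℝ) (β : ℝ) : Set (Z → ℝ) :=
  {f | f ∈ F ∧ ∑ i, (f (z i) - fhat (z i)) ^ 2 / σ i ^ 2 ≤ β ^ 2}

/-- The quantity `D_F(z; z_{[n]}, σ_{[n]})` of the generalized Eluder dimension. -/
noncomputable def eluderD {Z : Type*} (F : Finset (Z → ℝ)) (lam : ℝ) {n : ℕ} (σ : Fin n → ℝ)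
    (zs : Fin n → Z) (z : Z) : ℝ :=
  √(⨆ p : F × F, (p.1.1 z - p.2.1 z) ^ 2 /
    (∑ i, (p.1.1 (zs i) - p.2.1 (zs i)) ^ 2 / σ i ^ 2 + lam))

/-- All inputs of the algorithm: the MDP, the number of episodes `T`, the function classes `F^h`
with range `[0, L]`, the bonus class `W`, the oracle, and the numerical parameters. -/
structure Setup (X A : Type*) [MeasurableSpace X] [MeasurableSpace A] where
  M : EpisodicMDP X A
  T : ℕ
  F : ℕ → Finset (X × A → ℝ)
  W : Finset (X × A → ℝ)
  oracle : Oracle X A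
  L : ℝ
  eps : ℝ
  epsb : ℝ
  α : ℝ
  lam : ℝ
  δ : ℝ
  u : ℕ → ℝ

/-- One realization of everything that a run of the algorithm produces: states, actions, the four
regression solutions and the weights `σ̄`, indexed by episode and level. -/
structure RunData (X A : Type*) where
  x : ℕ → ℕ → X
  a : ℕ → ℕ → A
  fhat1 : ℕ → ℕ → X × A → ℝ
  fhat2 : ℕ → ℕ → X × A → ℝ
  fhatm2 : ℕ → ℕ → X × A → ℝ
  ghat : ℕ → ℕ → X × A → ℝ
  sigBar : ℕ → ℕ → ℝ

namespace Setup

variable {X A : Type*} [MeasurableSpace X] [MeasurableSpace A] (S : Setup X A)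

/-- `𝒩 = max_h |F^h|`. -/
def N : ℕ := (Finset.range S.M.H).sup fun h => (S.F h).card

/-- `𝒩_b = |W|`. -/
def Nb : ℕ := S.W.card

/-- `δ_{t,h} = δ / ((T+1)(H+1))`. -/
noncomputable def δth : ℝ := S.δ / ((S.T + 1) * (S.M.H + 1))

/-- `(2 log(4LT/α) + 2)(log(8L/α²) + 2)`. -/
noncomputable def logFactor : ℝ :=
  (2 * Real.log (4 * S.L * S.T / S.α) + 2) * (Real.log (8 * S.L / S.α ^ 2) + 2)

/-- `υ(δ_{t,h})`. -/
noncomputable def ups : ℝ := √(Real.log ((S.N : ℝ) ^ 2 * S.logFactor / S.δth))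

/-- `ι(δ_{t,h})`. -/
noncomputable def iota : ℝ := 3 * √(Real.log ((S.N : ℝ) * S.Nb * S.logFactor / S.δth))

/-- `ι̇(δ_{t,h})`. -/
noncomputable def iotaDot : ℝ :=
  √(2 * Real.log ((S.N : ℝ) * S.Nb * (2 * Real.log (18 * S.L * S.T) + 2) *
    (Real.log (18 * S.L) + 2) / S.δth))

/-- `ι'(δ_{t,h})`. -/
noncomputable def iotaPrime : ℝ :=
  √(2 * Real.log ((S.N : ℝ) * S.Nb * (2 * Real.log (32 * S.L * S.T) + 2) *
    (Real.log (32 * S.L) + 2) / S.δth))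

/-- The radius `β_{t,1}` of the optimistic confidence sets, in the `(t+1)`-st episode. -/
noncomputable def beta1 (t : ℕ) : ℝ :=
  √(6 * √S.lam + 156) *
      √(Real.log ((S.N : ℝ) ^ 2 * (S.T + 1) * (S.M.H + 1) * S.logFactor / S.δ)) +
    √(8 * (t + 1) * S.L / S.α ^ 2 * S.eps)

/-- The radius `β_{t,2}` of the overly optimistic and overly pessimistic confidence sets. -/
noncomputable def beta2 (t : ℕ) : ℝ :=
  √(2 * (24 * S.L + 21) * S.iotaDot ^ 2 + 20 * (t + 1) * S.L * S.eps)

/-- The radius `β̄_t` of the second-moment confidence sets. -/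
noncomputable def betaBar (t : ℕ) : ℝ :=
  √(8 * (11 * S.L + 9) * S.iotaPrime ^ 2 + 32 * (t + 1) * S.L * S.eps)

/-- `ε`-completeness: the functions of `F^h` have range `[0, L]`, and `F^h` contains an
`ε`-approximation of `𝒯 V` for each `V : X → [0,2]` and one of `𝒯₂ V` for each `V : X → [0,1]`. -/
structure EpsComplete : Prop where
  range : ∀ h < S.M.H, ∀ f ∈ S.F h, ∀ z, f z ∈ Set.Icc 0 S.L
  first : ∀ h < S.M.H, ∀ V : X → ℝ, Measurable V → (∀ x, V x ∈ Set.Icc (0 : ℝ) 2) →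
    ∃ f ∈ S.F h, ∀ z, |f z - S.M.bellman h V z| ≤ S.eps
  second : ∀ h < S.M.H, ∀ V : X → ℝ, Measurable V → (∀ x, V x ∈ Set.Icc (0 : ℝ) 1) →
    ∃ f ∈ S.F h, ∀ z, |f z - S.M.bellman₂ h V z| ≤ S.eps

/-- The three defining properties of a bonus oracle, for the radii `β n` (`n` the number of past
episodes) and weights that are at least `α`. -/
def IsBonusOracle (β : ℕ → ℝ) : Prop :=
  ∃ C : ℝ, 0 < C ∧ ∀ h < S.M.H, ∀ n < S.T, ∀ σ : Fin n → ℝ, (∀ i, S.α ≤ σ i) →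
    ∀ D : Fin n → Sample X A, ∀ fhat ∈ S.F h,
      S.oracle h n σ D fhat (β n) ∈ S.W ∧
      (∀ z, 0 ≤ S.oracle h n σ D fhat (β n) z) ∧
      (∀ f ∈ confSet (S.F h) σ (fun i => (D i).z) fhat (β n), ∀ z,
        |f z - fhat z| ≤ S.oracle h n σ D fhat (β n) z) ∧
      ∀ z, S.oracle h n σ D fhat (β n) z ≤
        C * (eluderD (S.F h) S.lam σ (fun i => (D i).z) z * √(β n ^ 2 + S.lam) + S.epsb * β n)

/-- Consistency of the oracle for the radii `β n`: the bonus does not increase when weights and data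
are extended, for centres that solve the regression on the respective data with some targets `V`,
`V'`. -/
def IsConsistent (β : ℕ → ℝ) : Prop :=
  ∀ h < S.M.H, ∀ (n n' : ℕ) (hn : n ≤ n'), n' < S.T →
    ∀ σ : Fin n' → ℝ, (∀ i, S.α ≤ σ i) → ∀ D : Fin n' → Sample X A,
    ∀ (V V' : X → ℝ) (fhat fhat' : X × A → ℝ),
      IsLeastSquares (S.F h) (fun i => σ (Fin.castLE hn i)) (fun i => (D (Fin.castLE hn i)).z)
        (fun i => (D (Fin.castLE hn i)).r + V (D (Fin.castLE hn i)).x') fhat →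
      IsLeastSquares (S.F h) σ (fun i => (D i).z) (fun i => (D i).r + V' (D i).x') fhat' →
      ∀ z, S.oracle h n' σ D fhat' (β n') z ≤
        S.oracle h n (fun i => σ (Fin.castLE hn i)) (fun i => D (Fin.castLE hn i)) fhat (β n) z

/-- `min(f̂ + b₁ + ε, 1)`. -/
noncomputable def optimistic (f b₁ : X × A → ℝ) (z : X × A) : ℝ := min (f z + b₁ z + S.eps) 1

/-- `min(f̂ + 2 b₁ + b₂ + 3ε, 2)`. -/
noncomputable def overlyOptimistic (f b₁ b₂ : X × A → ℝ) (z : X × A) : ℝ :=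
  min (f z + 2 * b₁ z + b₂ z + 3 * S.eps) 2

/-- `max(f̂ - b₂ - ε, 0)`. -/
noncomputable def overlyPessimistic (f b₂ : X × A → ℝ) (z : X × A) : ℝ := max (f z - b₂ z - S.eps) 0

/-- Measurability conventions: the function classes consist of measurable functions, and maximizing
over the actions gives measurable functions of the state. -/
structure MeasurabilityConventions : Prop where
  F_meas : ∀ h < S.M.H, ∀ f ∈ S.F h, Measurable f
  W_meas : ∀ w ∈ S.W, Measurable w
  max_opt : ∀ h < S.M.H, ∀ f ∈ S.F h, ∀ b ∈ S.W, Measurable (maxA (S.optimistic f b))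
  max_over : ∀ h < S.M.H, ∀ f ∈ S.F h, ∀ b ∈ S.W, ∀ b' ∈ S.W,
    Measurable (maxA (S.overlyOptimistic f b b'))
  max_pess : ∀ h < S.M.H, ∀ f ∈ S.F h, ∀ b ∈ S.W, Measurable (maxA (S.overlyPessimistic f b))
  max_star : ∀ h < S.M.H, Measurable (maxA (S.M.optQ h))

/-! Quantities computed from one realization `R` of a run. -/

variable (R : RunData X A)

/-- The state-action pair `z_t^h`. -/
def z (t h : ℕ) : X × A := (R.x t h, R.a t h)

/-- The level-`h` data of the `t` episodes that precede episode `t`; rewards are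
`r^h(x_s^h, a_s^h, x_s^{h+1})`. -/
def data (t h : ℕ) (s : Fin t) : Sample X A :=
  ⟨z R s h, S.M.r h (z R s h) (R.x s (h + 1)), R.x s (h + 1)⟩

/-- The past state-action pairs `z_s^h`, `s < t`. -/
def zs (t h : ℕ) (s : Fin t) : X × A := z R s h

/-- The past weights `σ̄_s^h`, `s < t`. -/
def sigs (t h : ℕ) (s : Fin t) : ℝ := R.sigBar s h

/-- The bonus `b_{t,1}^h`. -/
noncomputable def b1 (t h : ℕ) : X × A → ℝ :=
  S.oracle h t (sigs R t h) (S.data R t h) (R.fhat1 t h) (S.beta1 t)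

/-- The bonus `b_{t,2}^h`. -/
noncomputable def b2 (t h : ℕ) : X × A → ℝ :=
  S.oracle h t (fun _ => 1) (S.data R t h) (R.fhat2 t h) (S.beta2 t)

/-- The optimistic function `f_{t,1}^h`; it is `0` at the terminal level. -/
noncomputable def f1 (t h : ℕ) : X × A → ℝ :=
  if h < S.M.H then S.optimistic (R.fhat1 t h) (S.b1 R t h) else fun _ => 0

/-- The overly optimistic function `f_{t,2}^h`. -/
noncomputable def f2 (t h : ℕ) : X × A → ℝ :=
  if h < S.M.H then S.overlyOptimistic (R.fhat2 t h) (S.b1 R t h) (S.b2 R t h) else fun _ => 0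

/-- The overly pessimistic function `f_{t,-2}^h`. -/
noncomputable def fm2 (t h : ℕ) : X × A → ℝ :=
  if h < S.M.H then S.overlyPessimistic (R.fhatm2 t h) (S.b2 R t h) else fun _ => 0

/-- The variance estimate `(σ_t^h)²`. -/
noncomputable def sigmaSq (t h : ℕ) : ℝ :=
  if t = 0 then 4 else
    min 4 (R.ghat t h (z R t h) - R.fhatm2 t h (z R t h) ^ 2 +
      eluderD (S.F h) S.lam (fun _ => 1) (zs R t h) (z R t h) *
        (√(S.betaBar t ^ 2 + S.lam) + 2 * S.L * √(S.beta2 t ^ 2 + S.lam)) +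
      2 * (1 + S.L) * S.eps)

/-- The value prescribed for the weight `σ̄_t^h`; it uses the weights of earlier episodes only. -/
noncomputable def sigBarRule (t h : ℕ) : ℝ :=
  max (max (√(S.sigmaSq R t h)) S.α)
    (max (√2 * S.iota * √(S.f2 R t h (z R t h) - S.fm2 R t h (z R t h)))
      (2 * (√S.ups + S.iota) *
        √(eluderD (S.F h) S.lam (sigs R t h) (zs R t h) (z R t h))))

/-- The realization `R` follows the algorithm in all episodes `t < T` and levels `h < H`. -/
structure FollowsAlgorithm : Prop where
  fhat1_ls : ∀ t < S.T, ∀ h < S.M.H,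
    IsLeastSquares (S.F h) (sigs R t h) (zs R t h)
      (fun s => (S.data R t h s).r + maxA (S.f1 R t (h + 1)) (S.data R t h s).x') (R.fhat1 t h)
  fhat2_ls : ∀ t < S.T, ∀ h < S.M.H,
    IsLeastSquares (S.F h) (fun _ => 1) (zs R t h)
      (fun s => (S.data R t h s).r + maxA (S.f2 R t (h + 1)) (S.data R t h s).x') (R.fhat2 t h)
  fhatm2_ls : ∀ t < S.T, ∀ h < S.M.H,
    IsLeastSquares (S.F h) (fun _ => 1) (zs R t h)
      (fun s => (S.data R t h s).r + maxA (S.fm2 R t (h + 1)) (S.data R t h s).x') (R.fhatm2 t h)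
  ghat_ls : ∀ t < S.T, ∀ h < S.M.H,
    IsLeastSquares (S.F h) (fun _ => 1) (zs R t h)
      (fun s => ((S.data R t h s).r + maxA (S.f1 R t (h + 1)) (S.data R t h s).x') ^ 2)
      (R.ghat t h)
  sigBar_eq : ∀ t < S.T, ∀ h < S.M.H, R.sigBar t h = S.sigBarRule R t h
  /-- As long as the optimistic values are within `u_t` of the overly optimistic ones, act greedily
  for `f_{t,1}`, afterwards act greedily for `f_{t,2}`. -/
  greedy1 : ∀ t < S.T, ∀ h < S.M.H,
    (∀ h' ≤ h, maxA (S.f2 R t h') (R.x t h') - S.u t ≤ maxA (S.f1 R t h') (R.x t h')) →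
    ∀ a, S.f1 R t h (R.x t h, a) ≤ S.f1 R t h (R.x t h, R.a t h)
  greedy2 : ∀ t < S.T, ∀ h < S.M.H,
    ¬ (∀ h' ≤ h, maxA (S.f2 R t h') (R.x t h') - S.u t ≤ maxA (S.f1 R t h') (R.x t h')) →
    ∀ a, S.f2 R t h (R.x t h, a) ≤ S.f2 R t h (R.x t h, R.a t h)

/-- The confidence set `F_{t,1}^h`. -/
def conf1 (t h : ℕ) : Set (X × A → ℝ) :=
  confSet (S.F h) (sigs R t h) (zs R t h) (R.fhat1 t h) (S.beta1 t)

/-- The confidence set `F_{t,2}^h`. -/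
def conf2 (t h : ℕ) : Set (X × A → ℝ) :=
  confSet (S.F h) (fun _ => 1) (zs R t h) (R.fhat2 t h) (S.beta2 t)

/-- The confidence set `F_{t,-2}^h`. -/
def confm2 (t h : ℕ) : Set (X × A → ℝ) :=
  confSet (S.F h) (fun _ => 1) (zs R t h) (R.fhatm2 t h) (S.beta2 t)

/-- The confidence set `G_t^h`. -/
def confG (t h : ℕ) : Set (X × A → ℝ) :=
  confSet (S.F h) (fun _ => 1) (zs R t h) (R.ghat t h) (S.betaBar t)

/-- The functions of `F^h` that approximate `g` uniformly up to `ε`. -/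
def approximants (h : ℕ) (g : X × A → ℝ) : Set (X × A → ℝ) :=
  {f | f ∈ S.F h ∧ ∀ z, |f z - g z| ≤ S.eps}

/-- The good event: for all episodes and levels, `ε`-approximants in `F^h` of `𝒯 f_{t,j}^{h+1}`,
`j = 1, 2, -2`, and of `𝒯₂ f_{t,1}^{h+1}` exist, and every choice of them lies in the corresponding
confidence set. -/
def GoodEvent : Prop :=
  ∀ t < S.T, ∀ h < S.M.H,
    ((S.approximants h (S.M.bellman h (maxA (S.f1 R t (h + 1))))).Nonempty ∧
      S.approximants h (S.M.bellman h (maxA (S.f1 R t (h + 1)))) ⊆ S.conf1 R t h) ∧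
    ((S.approximants h (S.M.bellman h (maxA (S.f2 R t (h + 1))))).Nonempty ∧
      S.approximants h (S.M.bellman h (maxA (S.f2 R t (h + 1)))) ⊆ S.conf2 R t h) ∧
    ((S.approximants h (S.M.bellman h (maxA (S.fm2 R t (h + 1))))).Nonempty ∧
      S.approximants h (S.M.bellman h (maxA (S.fm2 R t (h + 1)))) ⊆ S.confm2 R t h) ∧
    ((S.approximants h (S.M.bellman₂ h (maxA (S.f1 R t (h + 1))))).Nonempty ∧
      S.approximants h (S.M.bellman₂ h (maxA (S.f1 R t (h + 1)))) ⊆ S.confG R t h)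

/-- A random run of the algorithm in the MDP.  `𝓗 t h` is the information available immediately
before the state `x_t^h` is drawn: it contains the previous episodes, the steps of episode `t`
before level `h`, the functions computed before episode `t`, and possibly further randomization. -/
structure IsRandomRun {Ω : Type*} [mΩ : MeasurableSpace Ω] (μ : Measure Ω)
    (𝓗 : ℕ → ℕ → MeasurableSpace Ω) (R : Ω → RunData X A) : Prop where
  follows : ∀ ω, S.FollowsAlgorithm (R ω)
  le : ∀ t h, 𝓗 t h ≤ mΩ
  mono_level : ∀ t h, h < S.M.H → 𝓗 t h ≤ 𝓗 t (h + 1)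
  mono_episode : ∀ t, 𝓗 t S.M.H ≤ 𝓗 (t + 1) 0
  x_meas : ∀ t < S.T, ∀ h < S.M.H, Measurable[𝓗 t (h + 1)] fun ω => (R ω).x t h
  x_last_meas : ∀ t < S.T, Measurable[𝓗 (t + 1) 0] fun ω => (R ω).x t S.M.H
  a_meas : ∀ t < S.T, ∀ h < S.M.H, Measurable[𝓗 t (h + 1)] fun ω => (R ω).a t h
  fhat1_meas : ∀ t < S.T, ∀ h < S.M.H, ∀ f, MeasurableSet[𝓗 t 0] {ω | (R ω).fhat1 t h = f}
  fhat2_meas : ∀ t < S.T, ∀ h < S.M.H, ∀ f, MeasurableSet[𝓗 t 0] {ω | (R ω).fhat2 t h = f}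
  fhatm2_meas : ∀ t < S.T, ∀ h < S.M.H, ∀ f, MeasurableSet[𝓗 t 0] {ω | (R ω).fhatm2 t h = f}
  ghat_meas : ∀ t < S.T, ∀ h < S.M.H, ∀ f, MeasurableSet[𝓗 t 0] {ω | (R ω).ghat t h = f}
  b1_meas : ∀ t < S.T, ∀ h < S.M.H, ∀ b, MeasurableSet[𝓗 t 0] {ω | S.b1 (R ω) t h = b}
  b2_meas : ∀ t < S.T, ∀ h < S.M.H, ∀ b, MeasurableSet[𝓗 t 0] {ω | S.b2 (R ω) t h = b}
  /-- Given the past, the first state of an episode has the initial distribution. -/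
  law_init : ∀ t < S.T, ∀ E, MeasurableSet[𝓗 t 0] E → ∀ B : Set X, MeasurableSet B →
    μ (E ∩ {ω | (R ω).x t 0 ∈ B}) = μ E * S.M.init B
  /-- Given the past, the state after `z_t^h` has distribution `P^h(z_t^h)`. -/
  law_step : ∀ t < S.T, ∀ h < S.M.H, ∀ E, MeasurableSet[𝓗 t (h + 1)] E →
    ∀ B : Set X, MeasurableSet B →
    μ (E ∩ {ω | (R ω).x t (h + 1) ∈ B}) = ∫⁻ ω in E, S.M.P h (z (R ω) t h) B ∂μ

end Setup

end VOQL

/-!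
The good event follows from concentration inequalities for sums `∑ₛ dₛ noiseₛ`, in which the factor
`dₛ` is determined by the past and `noiseₛ` is the deviation of a regression target from its
conditional mean.

For the three unweighted regressions Hoeffding's lemma and a union bound over the finitely many
value functions the algorithm can produce are enough. The weighted regression uses Bernstein's bound
instead. Its noise is split into the noise of the optimal value `V_⋆`, for which no union bound over
value functions is needed, and the noise of `f_{t,1} - V_⋆`, whose variance is small. Both require
that the weights `σ̄ₛ²` dominate the conditional variances. This is where the unweighted regressions
enter: `ĝ - f̂₋₂²` estimates the variance of `V_⋆` from above, and `f₂ - f₋₂` bounds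
`f_{t,1} - V_⋆` as soon as `f_{s,-2} ≤ Q_⋆ ≤ f_{t,1} ≤ f_{s,2}` for `s ≤ t`. These inequalities are
proved by induction over episodes and, backwards, over levels, together with the statement on the
confidence sets; consistency of the oracle is what compares the different episodes. Bernstein's
bound is applied on a dyadic grid of scales, because its optimal scale depends on the unknown
weighted distance between the least squares solution and the regression function.
-/

namespace VOQL

open MeasureTheory ProbabilityTheory

/-! ### Exponential tail bounds for adapted transitions -/

lemma lintegral_prodMk_eq_of_conditional_law {Ω Ω' X : Type*} [MeasurableSpace Ω]
    [MeasurableSpace Ω'] [MeasurableSpace X] {μ : Measure Ω} [IsFiniteMeasure μ] {W : Ω → Ω'}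
    (hW : Measurable W) {x' : Ω → X} (hx' : Measurable x') (κ : Kernel Ω' X) [IsMarkovKernel κ]
    (hlaw : ∀ E, MeasurableSet E → ∀ B, MeasurableSet B →
      μ (W ⁻¹' E ∩ x' ⁻¹' B) = ∫⁻ ω in W ⁻¹' E, κ (W ω) B ∂μ)
    {k : Ω' × X → ENNReal} (hk : Measurable k) :
    ∫⁻ ω, k (W ω, x' ω) ∂μ = ∫⁻ ω, ∫⁻ y, k (W ω, y) ∂(κ (W ω)) ∂μ := by
  have map_prodMk : μ.map (fun ω => (W ω, x' ω)) = (μ.map W) ⊗ₘ κ := by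
    refine Measure.ext_prod fun {E B} hE hB => ?_
    rw [Measure.map_apply (hW.prodMk hx') (hE.prod hB), Measure.compProd_apply_prod hE hB,
      setLIntegral_map hE (κ.measurable_coe hB) hW]
    exact hlaw E hE B hB
  calc ∫⁻ ω, k (W ω, x' ω) ∂μ = ∫⁻ p, k p ∂(μ.map (fun ω => (W ω, x' ω))) :=
        (lintegral_map hk (hW.prodMk hx')).symm
    _ = ∫⁻ w, ∫⁻ y, k (w, y) ∂(κ w) ∂(μ.map W) := by
        rw [map_prodMk, Measure.lintegral_compProd hk]
    _ = ∫⁻ ω, ∫⁻ y, k (W ω, y) ∂(κ (W ω)) ∂μ := lintegral_map hk.lintegral_kernel_prod_right' hW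

/-- `n` transitions `z s ↦ x' s` whose next states have, given the past `𝒢 s`, the law `κ (z s)`.
This describes the data that the regressions at one level use, for arbitrary choices of the
actions. -/
structure AdaptedTransitions {Ω Z X : Type*} [mΩ : MeasurableSpace Ω] [MeasurableSpace Z]
    [MeasurableSpace X] (μ : Measure Ω) (κ : Kernel Z X) (n : ℕ) (𝒢 : ℕ → MeasurableSpace Ω)
    (z : ℕ → Ω → Z) (x' : ℕ → Ω → X) : Prop where
  le : ∀ s, 𝒢 s ≤ mΩ
  mono : ∀ s, 𝒢 s ≤ 𝒢 (s + 1)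
  z_meas : ∀ s < n, Measurable[𝒢 s] (z s)
  x'_meas : ∀ s < n, Measurable[𝒢 (s + 1)] (x' s)
  law : ∀ s < n, ∀ E, MeasurableSet[𝒢 s] E → ∀ B, MeasurableSet B →
    μ (E ∩ x' s ⁻¹' B) = ∫⁻ ω in E, κ (z s ω) B ∂μ

namespace AdaptedTransitions

variable {Ω Z X : Type*} [mΩ : MeasurableSpace Ω] [MeasurableSpace Z] [MeasurableSpace X]
  {μ : Measure Ω} {κ : Kernel Z X} {n : ℕ} {𝒢 : ℕ → MeasurableSpace Ω} {z : ℕ → Ω → Z}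
  {x' : ℕ → Ω → X}

lemma lintegral_next_eq [IsFiniteMeasure μ] [IsMarkovKernel κ]
    (h : AdaptedTransitions μ κ n 𝒢 z x') {s : ℕ} (hs : s < n) {k : Ω × X → ENNReal}
    (hk : Measurable[(𝒢 s).prod inferInstance] k) :
    ∫⁻ ω, k (ω, x' s ω) ∂μ = ∫⁻ ω, ∫⁻ y, k (ω, y) ∂(κ (z s ω)) ∂μ := by
  have hz := h.z_meas s hs
  have hid : @Measurable Ω Ω mΩ (𝒢 s) id := fun E hE => h.le s E hE
  let κ' : @Kernel Ω X (𝒢 s) _ := Kernel.comap κ (z s) hz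
  have : @IsMarkovKernel Ω X (𝒢 s) _ κ' := Kernel.IsMarkovKernel.comap κ hz
  exact @lintegral_prodMk_eq_of_conditional_law Ω Ω X mΩ (𝒢 s) _ μ _ id hid (x' s)
    ((h.x'_meas s hs).mono (h.le _) le_rfl) κ' this (fun E hE B hB => h.law s hs E hE B hB) k hk

lemma measurable_sum_next (h : AdaptedTransitions μ κ n 𝒢 z x') {D : ℕ → Ω × X → ℝ}
    (hD : ∀ s < n, Measurable[(𝒢 s).prod inferInstance] (D s)) {m : ℕ} (hm : m ≤ n) :
    Measurable[𝒢 m] fun ω => ∑ s ∈ Finset.range m, D s (ω, x' s ω) := by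
  have hmono : Monotone 𝒢 := monotone_nat_of_le_succ h.mono
  refine Finset.measurable_fun_sum _ fun s hs => ?_
  have hsm : s < m := Finset.mem_range.1 hs
  have hid : @Measurable Ω Ω (𝒢 m) (𝒢 s) id := fun E hE => hmono hsm.le E hE
  have hx' : Measurable[𝒢 m] (x' s) :=
    (h.x'_meas s (hsm.trans_le hm)).mono (hmono hsm) le_rfl
  exact (hD s (hsm.trans_le hm)).comp (hid.prodMk hx')

lemma lintegral_exp_sum_le_one [IsProbabilityMeasure μ] [IsMarkovKernel κ]
    (h : AdaptedTransitions μ κ n 𝒢 z x') {D : ℕ → Ω × X → ℝ}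
    (hD : ∀ s < n, Measurable[(𝒢 s).prod inferInstance] (D s))
    (hmgf : ∀ s < n, ∀ ω, ∫⁻ y, ENNReal.ofReal (Real.exp (D s (ω, y))) ∂(κ (z s ω)) ≤ 1)
    {m : ℕ} (hm : m ≤ n) :
    ∫⁻ ω, ENNReal.ofReal (Real.exp (∑ s ∈ Finset.range m, D s (ω, x' s ω))) ∂μ ≤ 1 := by
  induction m with
  | zero => simp
  | succ m ih =>
    have hmn : m < n := hm
    set past : Ω → ℝ := fun ω => ∑ s ∈ Finset.range m, D s (ω, x' s ω)
    let k : Ω × X → ENNReal := fun p =>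
      ENNReal.ofReal (Real.exp (past p.1)) * ENNReal.ofReal (Real.exp (D m p))
    have hk : Measurable[(𝒢 m).prod inferInstance] k := by
      have hpast : Measurable[(𝒢 m).prod inferInstance] fun p : Ω × X => past p.1 :=
        (h.measurable_sum_next hD hmn.le).comp (@measurable_fst Ω X (𝒢 m) _)
      exact (Real.measurable_exp.comp hpast).ennreal_ofReal.mul
        (Real.measurable_exp.comp (hD m hmn)).ennreal_ofReal
    calc ∫⁻ ω, ENNReal.ofReal (Real.exp (∑ s ∈ Finset.range (m + 1), D s (ω, x' s ω))) ∂μ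
        = ∫⁻ ω, k (ω, x' m ω) ∂μ := by
          refine lintegral_congr fun ω => ?_
          rw [Finset.sum_range_succ, Real.exp_add, ENNReal.ofReal_mul (Real.exp_pos _).le]
      _ = ∫⁻ ω, ∫⁻ y, k (ω, y) ∂(κ (z m ω)) ∂μ := h.lintegral_next_eq hmn hk
      _ ≤ ∫⁻ ω, ENNReal.ofReal (Real.exp (past ω)) ∂μ := by
          refine lintegral_mono fun ω => ?_
          simp only [k]
          rw [lintegral_const_mul' _ _ ENNReal.ofReal_ne_top]
          exact (mul_le_mul_right (hmgf m hmn ω) _).trans (by rw [mul_one])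
      _ ≤ 1 := ih hmn.le

lemma measure_le_sum_le_exp_neg [IsProbabilityMeasure μ] [IsMarkovKernel κ]
    (h : AdaptedTransitions μ κ n 𝒢 z x') {D : ℕ → Ω × X → ℝ}
    (hD : ∀ s < n, Measurable[(𝒢 s).prod inferInstance] (D s))
    (hmgf : ∀ s < n, ∀ ω, ∫⁻ y, ENNReal.ofReal (Real.exp (D s (ω, y))) ∂(κ (z s ω)) ≤ 1) (Y : ℝ) :
    μ {ω | Y ≤ ∑ s ∈ Finset.range n, D s (ω, x' s ω)} ≤ ENNReal.ofReal (Real.exp (-Y)) := by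
  set G : Ω → ℝ := fun ω => ∑ s ∈ Finset.range n, D s (ω, x' s ω)
  have hG : Measurable G := (h.measurable_sum_next hD le_rfl).mono (h.le n) le_rfl
  calc μ {ω | Y ≤ G ω}
      ≤ μ {ω | ENNReal.ofReal (Real.exp Y) ≤ ENNReal.ofReal (Real.exp (G ω))} :=
        measure_mono fun ω hω => ENNReal.ofReal_le_ofReal (Real.exp_le_exp.2 hω)
    _ ≤ (∫⁻ ω, ENNReal.ofReal (Real.exp (G ω)) ∂μ) / ENNReal.ofReal (Real.exp Y) :=
        meas_ge_le_lintegral_div (Real.measurable_exp.comp hG).ennreal_ofReal.aemeasurable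
          (by simp [Real.exp_pos]) ENNReal.ofReal_ne_top
    _ ≤ 1 / ENNReal.ofReal (Real.exp Y) := by
        gcongr
        exact h.lintegral_exp_sum_le_one hD hmgf le_rfl
    _ = ENNReal.ofReal (Real.exp (-Y)) := by
        rw [Real.exp_neg, ENNReal.ofReal_inv_of_pos (Real.exp_pos _), one_div]

lemma measurable_affine_increment (h : AdaptedTransitions μ κ n 𝒢 z x') {s : ℕ} (hs : s < n)
    {e : Z → X → ℝ} (he : Measurable fun p : Z × X => e p.1 p.2) {c v : Ω → ℝ}
    (hc : Measurable[𝒢 s] c) (hv : Measurable[𝒢 s] v) :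
    Measurable[(𝒢 s).prod inferInstance]
      fun p : Ω × X => c p.1 * e (z s p.1) p.2 - v p.1 := by
  have hfst : @Measurable (Ω × X) Ω ((𝒢 s).prod inferInstance) (𝒢 s) Prod.fst :=
    @measurable_fst Ω X (𝒢 s) _
  have hsnd : @Measurable (Ω × X) X ((𝒢 s).prod inferInstance) _ Prod.snd :=
    @measurable_snd Ω X (𝒢 s) _
  exact ((hc.comp hfst).mul (he.comp (((h.z_meas s hs).comp hfst).prodMk hsnd))).sub (hv.comp hfst)

end AdaptedTransitions

section ExponentialMoments

variable {X : Type*} [MeasurableSpace X] {ν : Measure X} [IsProbabilityMeasure ν]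

lemma lintegral_exp_hoeffding_le_one {g : X → ℝ} (hg : Measurable g) {a b : ℝ}
    (hab : ∀ y, g y ∈ Set.Icc a b) (c : ℝ) :
    ∫⁻ y, ENNReal.ofReal (Real.exp (c * (g y - ∫ y, g y ∂ν) - c ^ 2 * (b - a) ^ 2 / 8)) ∂ν ≤ 1 := by
  have subgaussian := hasSubgaussianMGF_of_mem_Icc (μ := ν) hg.aemeasurable
    (Filter.Eventually.of_forall hab)
  have variance_proxy : (((‖b - a‖₊ / 2) ^ 2 : NNReal) : ℝ) = (b - a) ^ 2 / 4 := by
    push_cast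
    rw [Real.norm_eq_abs, div_pow, sq_abs]
    norm_num
  have mgf_le := subgaussian.mgf_le c
  rw [variance_proxy] at mgf_le
  simp only [Real.exp_sub _ (c ^ 2 * (b - a) ^ 2 / 8)]
  rw [← ofReal_integral_eq_lintegral_ofReal ((subgaussian.integrable_exp_mul c).div_const _)
    (Filter.Eventually.of_forall fun y => by positivity), ENNReal.ofReal_le_one, integral_div,
    div_le_one (Real.exp_pos _)]
  exact mgf_le.trans_eq (by ring_nf)

lemma integral_exp_mul_le_of_abs_le {e : X → ℝ} (he : Measurable e) {b : ℝ} (hb : ∀ y, |e y| ≤ b)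
    (h0 : ∫ y, e y ∂ν = 0) {c : ℝ} (hcb : |c| * b ≤ 1) :
    ∫ y, Real.exp (c * e y) ∂ν ≤ Real.exp (c ^ 2 * ∫ y, e y ^ 2 ∂ν) := by
  have integrable_e : Integrable e ν :=
    .of_bound he.aestronglyMeasurable b (.of_forall hb)
  have integrable_sq : Integrable (fun y => e y ^ 2) ν := by
    refine .of_bound (he.pow_const 2).aestronglyMeasurable (b ^ 2) (.of_forall fun y => ?_)
    rw [Real.norm_eq_abs, abs_pow]
    exact pow_le_pow_left₀ (abs_nonneg _) (hb y) 2
  have exp_le : ∀ y, Real.exp (c * e y) ≤ 1 + c * e y + c ^ 2 * e y ^ 2 := fun y => by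
    have h1 : |c * e y| ≤ 1 := by
      rw [abs_mul]
      exact (mul_le_mul_of_nonneg_left (hb y) (abs_nonneg c)).trans hcb
    have := (abs_le.1 (Real.abs_exp_sub_one_sub_id_le h1)).2
    nlinarith
  have integrable_linear : Integrable (fun y => 1 + c * e y) ν :=
    (integrable_const 1).add (integrable_e.const_mul c)
  calc ∫ y, Real.exp (c * e y) ∂ν
      ≤ ∫ y, (1 + c * e y + c ^ 2 * e y ^ 2) ∂ν :=
        integral_mono_of_nonneg (.of_forall fun y => (Real.exp_pos _).le)
          (integrable_linear.add (integrable_sq.const_mul _)) (.of_forall exp_le)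
    _ = c ^ 2 * ∫ y, e y ^ 2 ∂ν + 1 := by
        rw [integral_add integrable_linear (integrable_sq.const_mul _),
          integral_add (integrable_const 1) (integrable_e.const_mul c), integral_const_mul,
          integral_const_mul, h0]
        simp [add_comm]
    _ ≤ Real.exp (c ^ 2 * ∫ y, e y ^ 2 ∂ν) := Real.add_one_le_exp _

lemma lintegral_exp_bernstein_le_one {e : X → ℝ} (he : Measurable e) {b : ℝ} (hb : ∀ y, |e y| ≤ b)
    (h0 : ∫ y, e y ∂ν = 0) {c v : ℝ} (hcb : |c| * b ≤ 1) (hv : c ^ 2 * ∫ y, e y ^ 2 ∂ν ≤ v) :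
    ∫⁻ y, ENNReal.ofReal (Real.exp (c * e y - v)) ∂ν ≤ 1 := by
  have integrable_exp : Integrable (fun y => Real.exp (c * e y)) ν := by
    refine .of_bound (he.const_mul c).exp.aestronglyMeasurable (Real.exp 1) (.of_forall fun y => ?_)
    rw [Real.norm_eq_abs, Real.abs_exp, Real.exp_le_exp]
    calc c * e y ≤ |c| * |e y| := (le_abs_self _).trans_eq (abs_mul c (e y))
      _ ≤ |c| * b := mul_le_mul_of_nonneg_left (hb y) (abs_nonneg c)
      _ ≤ 1 := hcb
  simp only [Real.exp_sub]
  rw [← ofReal_integral_eq_lintegral_ofReal (integrable_exp.div_const _)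
    (.of_forall fun y => by positivity), ENNReal.ofReal_le_one, integral_div,
    div_le_one (Real.exp_pos _)]
  exact (integral_exp_mul_le_of_abs_le he hb h0 hcb).trans (Real.exp_le_exp.2 hv)

end ExponentialMoments

/-- The deviation of the regression target `q z` from its mean under `κ z`. -/
noncomputable def noise {Z X : Type*} [MeasurableSpace Z] [MeasurableSpace X] (κ : Kernel Z X)
    (q : Z → X → ℝ) (z : Z) (y : X) : ℝ := q z y - ∫ y', q z y' ∂(κ z)

section Noise

variable {Z X : Type*} [MeasurableSpace Z] [MeasurableSpace X] {κ : Kernel Z X} {q : Z → X → ℝ}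

lemma integral_noise_sq (hq : Measurable fun p : Z × X => q p.1 p.2) (z : Z) :
    ∫ y, noise κ q z y ^ 2 ∂(κ z) = Var[q z; κ z] :=
  (variance_eq_integral (hq.comp measurable_prodMk_left).aemeasurable).symm

lemma noise_add {q' : Z → X → ℝ} {z : Z} (hq : Integrable (q z) (κ z))
    (hq' : Integrable (q' z) (κ z)) (y : X) :
    noise κ (fun z y => q z y + q' z y) z y = noise κ q z y + noise κ q' z y := by
  simp only [noise]
  rw [integral_add hq hq']
  ring

variable [IsMarkovKernel κ]

lemma measurable_noise (hq : Measurable fun p : Z × X => q p.1 p.2) :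
    Measurable fun p : Z × X => noise κ q p.1 p.2 :=
  hq.sub ((hq.stronglyMeasurable.integral_kernel_prod_right' (κ := κ)).measurable.comp
    measurable_fst)

lemma integrable_of_forall_mem_Icc (hq : Measurable fun p : Z × X => q p.1 p.2) {a b : ℝ}
    (hab : ∀ z y, q z y ∈ Set.Icc a b) (z : Z) : Integrable (q z) (κ z) :=
  .of_mem_Icc a b (hq.comp measurable_prodMk_left).aemeasurable (.of_forall (hab z))

lemma integral_noise (hq : Measurable fun p : Z × X => q p.1 p.2) {a b : ℝ}
    (hab : ∀ z y, q z y ∈ Set.Icc a b) (z : Z) : ∫ y, noise κ q z y ∂(κ z) = 0 := by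
  simp only [noise]
  rw [integral_sub (integrable_of_forall_mem_Icc hq hab z) (integrable_const _)]
  simp

lemma measurable_variance (hq : Measurable fun p : Z × X => q p.1 p.2) :
    Measurable fun z => Var[q z; κ z] := by
  simp only [← integral_noise_sq (κ := κ) hq]
  exact (((measurable_noise (κ := κ) hq).pow_const
    2).stronglyMeasurable.integral_kernel_prod_right').measurable

lemma integral_mem_Icc {ν : Measure X} [IsProbabilityMeasure ν] {g : X → ℝ} (hg : Measurable g)
    {a b : ℝ} (hab : ∀ y, g y ∈ Set.Icc a b) : ∫ y, g y ∂ν ∈ Set.Icc a b := by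
  have integrable_g : Integrable g ν := .of_mem_Icc a b hg.aemeasurable (.of_forall hab)
  constructor
  · simpa using integral_mono (integrable_const (μ := ν) a) integrable_g fun y => (hab y).1
  · simpa using integral_mono integrable_g (integrable_const (μ := ν) b) fun y => (hab y).2

lemma abs_noise_le (hq : Measurable fun p : Z × X => q p.1 p.2) {a b : ℝ}
    (hab : ∀ z y, q z y ∈ Set.Icc a b) (z : Z) (y : X) : |noise κ q z y| ≤ b - a := by
  have mean_mem := integral_mem_Icc (ν := κ z) (hq.comp measurable_prodMk_left) (hab z)
  exact Real.dist_le_of_mem_Icc (hab z y) mean_mem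

end Noise

end VOQL

namespace VOQL

open MeasureTheory ProbabilityTheory

/-! ### Noise bounds along differences of functions of a finite class -/

lemma measure_not_forall_mem_le {Ω ι : Type*} [MeasurableSpace Ω] {μ : Measure Ω} {I : Finset ι}
    {p : ι → Ω → Prop} {c : ℝ} (hp : ∀ i ∈ I, μ {ω | ¬ p i ω} ≤ ENNReal.ofReal c) :
    μ {ω | ¬ ∀ i ∈ I, p i ω} ≤ ENNReal.ofReal (I.card * c) := by
  have biUnion : {ω | ¬ ∀ i ∈ I, p i ω} = ⋃ i ∈ I, {ω | ¬ p i ω} := by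
    ext ω
    simp
  rw [biUnion]
  refine (measure_biUnion_finset_le I _).trans ((Finset.sum_le_sum hp).trans_eq ?_)
  rw [Finset.sum_const, nsmul_eq_mul, ENNReal.ofReal_mul (Nat.cast_nonneg _),
    ENNReal.ofReal_natCast]

/-- The bound on the noise of the target `q` that Hoeffding's lemma gives, with exponent `Y`, for
targets whose range has width `w`; it holds along all differences of functions of `F`. -/
def NoiseBound {Z X : Type*} [MeasurableSpace Z] [MeasurableSpace X] (κ : Kernel Z X)
    (F : Finset (Z → ℝ)) (q : Z → X → ℝ) (w Y : ℝ) {n : ℕ} (z : Fin n → Z) (x' : Fin n → X) :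
    Prop :=
  ∀ f ∈ F, ∀ g ∈ F, ∑ i, (f (z i) - g (z i)) * noise κ q (z i) (x' i) ≤
    (∑ i, (f (z i) - g (z i)) ^ 2) / 4 + w ^ 2 / 2 * Y

/-- The bound on the weighted noise of the target `q` that Bernstein's inequality gives at the scale
`θ`, with exponent `Y`, for targets whose range has width `w`. It concerns those differences of
functions of `F` for which the squared weights control the increments and, up to the factor `τ`, the
conditional variances. -/
def WeightedNoiseBound {Z X : Type*} [MeasurableSpace Z] [MeasurableSpace X] (κ : Kernel Z X)
    (F : Finset (Z → ℝ)) (q : Z → X → ℝ) (w θ τ Y : ℝ) {n : ℕ} (σ : Fin n → ℝ) (z : Fin n → Z)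
    (x' : Fin n → X) : Prop :=
  ∀ f ∈ F, ∀ g ∈ F,
    (∀ i, w * θ * |f (z i) - g (z i)| ≤ σ i ^ 2 ∧ Var[q (z i); κ (z i)] ≤ τ * σ i ^ 2) →
    ∑ i, (f (z i) - g (z i)) / σ i ^ 2 * noise κ q (z i) (x' i) ≤
      θ * τ * ∑ i, (f (z i) - g (z i)) ^ 2 / σ i ^ 2 + Y / θ

lemma lintegral_exp_indicator_le_one {Ω X : Type*} [MeasurableSpace X] {ν : Measure X}
    [IsProbabilityMeasure ν] {e : X → ℝ} (he : Measurable e) {w : ℝ} (hw : ∀ y, |e y| ≤ w)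
    (h0 : ∫ y, e y ∂ν = 0) {d σ : Ω → ℝ} {ω : Ω} {s : Set Ω} {θ τ : ℝ} (hσ : 0 < σ ω) (hθ : 0 < θ)
    (hτ : 0 ≤ τ)
    (hs : ω ∈ s → w * θ * |d ω| ≤ σ ω ^ 2 ∧ ∫ y, e y ^ 2 ∂ν ≤ τ * σ ω ^ 2) :
    ∫⁻ y, ENNReal.ofReal (Real.exp (s.indicator (fun ω => θ * (d ω / σ ω ^ 2)) ω * e y -
      θ ^ 2 * τ * (d ω ^ 2 / σ ω ^ 2))) ∂ν ≤ 1 := by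
  by_cases hω : ω ∈ s
  · obtain ⟨hd, hvar⟩ := hs hω
    rw [Set.indicator_of_mem hω]
    refine lintegral_exp_bernstein_le_one he hw h0 ?_ ?_
    · rw [abs_mul, abs_div, abs_of_pos hθ, abs_of_pos (pow_pos hσ 2), ← mul_div_assoc,
        div_mul_eq_mul_div, div_le_one (pow_pos hσ 2)]
      linarith
    · calc (θ * (d ω / σ ω ^ 2)) ^ 2 * ∫ y, e y ^ 2 ∂ν
          ≤ (θ * (d ω / σ ω ^ 2)) ^ 2 * (τ * σ ω ^ 2) := by gcongr
        _ = θ ^ 2 * τ * (d ω ^ 2 / σ ω ^ 2) := by field_simp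
  · rw [Set.indicator_of_notMem hω]
    exact lintegral_exp_bernstein_le_one he hw h0 (by simp)
      (by rw [zero_pow two_ne_zero, zero_mul]; positivity)

namespace AdaptedTransitions

variable {Ω Z X : Type*} [mΩ : MeasurableSpace Ω] [MeasurableSpace Z] [MeasurableSpace X]
  {μ : Measure Ω} {κ : Kernel Z X} [IsMarkovKernel κ] {n : ℕ} {𝒢 : ℕ → MeasurableSpace Ω}
  {z : ℕ → Ω → Z} {x' : ℕ → Ω → X}

lemma measurableSet_controlled (h : AdaptedTransitions μ κ n 𝒢 z x') {s : ℕ} (hs : s < n)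
    {d : Z → ℝ} (hd : Measurable d) {σ : Ω → ℝ} (hσ : Measurable[𝒢 s] σ) {q : Z → X → ℝ}
    (hq : Measurable fun p : Z × X => q p.1 p.2) (c τ : ℝ) :
    MeasurableSet[𝒢 s]
      {ω | c * |d (z s ω)| ≤ σ ω ^ 2 ∧ Var[q (z s ω); κ (z s ω)] ≤ τ * σ ω ^ 2} := by
  have habs : Measurable[𝒢 s] fun ω => |d (z s ω)| :=
    measurable_abs.comp (hd.comp (h.z_meas s hs))
  have hvar : Measurable[𝒢 s] fun ω => Var[q (z s ω); κ (z s ω)] :=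
    (measurable_variance (κ := κ) hq).comp (h.z_meas s hs)
  exact (measurableSet_le (habs.const_mul c) (hσ.pow_const 2)).inter
    (measurableSet_le hvar ((hσ.pow_const 2).const_mul τ))

variable [IsProbabilityMeasure μ]

lemma measure_noise_sum_gt_le (h : AdaptedTransitions μ κ n 𝒢 z x') {d : Z → ℝ}
    (hd : Measurable d) {q : Z → X → ℝ} (hq : Measurable fun p : Z × X => q p.1 p.2) {a w : ℝ}
    (hw : 0 < w) (hab : ∀ z y, q z y ∈ Set.Icc a (a + w)) (Y : ℝ) :
    μ {ω | (∑ s ∈ Finset.range n, d (z s ω) ^ 2) / 4 + w ^ 2 / 2 * Y <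
      ∑ s ∈ Finset.range n, d (z s ω) * noise κ q (z s ω) (x' s ω)} ≤
      ENNReal.ofReal (Real.exp (-Y)) := by
  have chernoff := h.measure_le_sum_le_exp_neg
    (D := fun s p => 2 / w ^ 2 * d (z s p.1) * noise κ q (z s p.1) p.2 -
      (2 / w ^ 2 * d (z s p.1)) ^ 2 * (a + w - a) ^ 2 / 8)
    (fun s hs => by
      have hdz : Measurable[𝒢 s] fun ω => d (z s ω) := hd.comp (h.z_meas s hs)
      exact h.measurable_affine_increment hs (measurable_noise hq) (hdz.const_mul _)
        ((((hdz.const_mul _).pow_const 2).mul_const _).div_const _))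
    (fun s _ ω => lintegral_exp_hoeffding_le_one (ν := κ (z s ω)) (g := q (z s ω))
      (hq.comp measurable_prodMk_left) (hab (z s ω)) (2 / w ^ 2 * d (z s ω))) Y
  refine (measure_mono fun ω hω => ?_).trans chernoff
  simp only [Set.mem_ofPred_eq] at hω ⊢
  have rescale : ∑ s ∈ Finset.range n, (2 / w ^ 2 * d (z s ω) * noise κ q (z s ω) (x' s ω) -
      (2 / w ^ 2 * d (z s ω)) ^ 2 * (a + w - a) ^ 2 / 8) =
      2 / w ^ 2 * (∑ s ∈ Finset.range n, d (z s ω) * noise κ q (z s ω) (x' s ω) -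
        (∑ s ∈ Finset.range n, d (z s ω) ^ 2) / 4) := by
    rw [Finset.sum_div, ← Finset.sum_sub_distrib, Finset.mul_sum]
    refine Finset.sum_congr rfl fun s _ => ?_
    field_simp
    ring
  calc Y = 2 / w ^ 2 * (w ^ 2 / 2 * Y) := by field_simp
    _ ≤ 2 / w ^ 2 * (∑ s ∈ Finset.range n, d (z s ω) * noise κ q (z s ω) (x' s ω) -
        (∑ s ∈ Finset.range n, d (z s ω) ^ 2) / 4) := by
      gcongr
      linarith
    _ = _ := rescale.symm

lemma measure_not_noiseBound_le (h : AdaptedTransitions μ κ n 𝒢 z x') {F : Finset (Z → ℝ)}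
    (hF : ∀ f ∈ F, Measurable f) {q : Z → X → ℝ} (hq : Measurable fun p : Z × X => q p.1 p.2)
    {a w : ℝ} (hw : 0 < w) (hab : ∀ z y, q z y ∈ Set.Icc a (a + w)) (Y : ℝ) :
    μ {ω | ¬ NoiseBound κ F q w Y (fun i : Fin n => z i ω) (fun i => x' i ω)} ≤
      ENNReal.ofReal (F.card ^ 2 * Real.exp (-Y)) := by
  rw [pow_two, mul_assoc]
  refine measure_not_forall_mem_le fun f hf => measure_not_forall_mem_le fun g hg => ?_
  have tail := h.measure_noise_sum_gt_le ((hF f hf).sub (hF g hg)) hq hw hab Y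
  simpa only [Finset.sum_range, Pi.sub_apply, not_le] using tail

lemma measure_weighted_noise_sum_gt_le (h : AdaptedTransitions μ κ n 𝒢 z x') {d : Z → ℝ}
    (hd : Measurable d) {σ : ℕ → Ω → ℝ} (hσ : ∀ s < n, Measurable[𝒢 s] (σ s))
    (hσ0 : ∀ s < n, ∀ ω, 0 < σ s ω) {q : Z → X → ℝ}
    (hq : Measurable fun p : Z × X => q p.1 p.2) {a w : ℝ}
    (hab : ∀ z y, q z y ∈ Set.Icc a (a + w)) {θ τ : ℝ} (hθ : 0 < θ) (hτ : 0 ≤ τ) (Y : ℝ) :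
    μ {ω | (∀ s < n, w * θ * |d (z s ω)| ≤ σ s ω ^ 2 ∧
        Var[q (z s ω); κ (z s ω)] ≤ τ * σ s ω ^ 2) ∧
      θ * τ * (∑ s ∈ Finset.range n, d (z s ω) ^ 2 / σ s ω ^ 2) + Y / θ <
      ∑ s ∈ Finset.range n, d (z s ω) / σ s ω ^ 2 * noise κ q (z s ω) (x' s ω)} ≤
      ENNReal.ofReal (Real.exp (-Y)) := by
  -- Increments for which the weight does not control the noise are dropped: whether this happens
  -- is known before the next state is drawn.
  let ok : ℕ → Set Ω := fun s =>
    {ω | w * θ * |d (z s ω)| ≤ σ s ω ^ 2 ∧ Var[q (z s ω); κ (z s ω)] ≤ τ * σ s ω ^ 2}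
  have chernoff := h.measure_le_sum_le_exp_neg
    (D := fun s p => (ok s).indicator (fun ω => θ * (d (z s ω) / σ s ω ^ 2)) p.1 *
      noise κ q (z s p.1) p.2 - θ ^ 2 * τ * (d (z s p.1) ^ 2 / σ s p.1 ^ 2))
    (fun s hs => by
      have hdz : Measurable[𝒢 s] fun ω => d (z s ω) := hd.comp (h.z_meas s hs)
      have hσ2 := (hσ s hs).pow_const 2
      exact h.measurable_affine_increment hs (measurable_noise hq)
        (((hdz.div hσ2).const_mul θ).indicator (h.measurableSet_controlled hs hd (hσ s hs) hq _ _))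
        (((hdz.pow_const 2).div hσ2).const_mul _))
    (fun s hs ω => lintegral_exp_indicator_le_one (d := fun ω => d (z s ω)) (σ := σ s)
      ((measurable_noise hq).comp measurable_prodMk_left)
      (fun y => (abs_noise_le hq hab (z s ω) y).trans_eq (by ring)) (integral_noise hq hab _)
      (hσ0 s hs ω) hθ hτ fun hω => ⟨hω.1, (integral_noise_sq hq _).trans_le hω.2⟩) Y
  refine (measure_mono fun ω hω => ?_).trans chernoff
  obtain ⟨hok, hlt⟩ := hω
  simp only [Set.mem_ofPred_eq]
  have rescale : ∑ s ∈ Finset.range n, ((ok s).indicator (fun ω => θ * (d (z s ω) / σ s ω ^ 2)) ω *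
      noise κ q (z s ω) (x' s ω) - θ ^ 2 * τ * (d (z s ω) ^ 2 / σ s ω ^ 2)) =
      θ * (∑ s ∈ Finset.range n, d (z s ω) / σ s ω ^ 2 * noise κ q (z s ω) (x' s ω) -
        θ * τ * ∑ s ∈ Finset.range n, d (z s ω) ^ 2 / σ s ω ^ 2) := by
    rw [Finset.mul_sum, ← Finset.sum_sub_distrib, Finset.mul_sum]
    refine Finset.sum_congr rfl fun s hs => ?_
    rw [Set.indicator_of_mem (show ω ∈ ok s from hok s (Finset.mem_range.1 hs))]
    ring
  rw [rescale, ← div_le_iff₀' hθ]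
  linarith

lemma measure_not_weightedNoiseBound_le (h : AdaptedTransitions μ κ n 𝒢 z x')
    {F : Finset (Z → ℝ)} (hF : ∀ f ∈ F, Measurable f) {σ : ℕ → Ω → ℝ}
    (hσ : ∀ s < n, Measurable[𝒢 s] (σ s)) (hσ0 : ∀ s < n, ∀ ω, 0 < σ s ω) {q : Z → X → ℝ}
    (hq : Measurable fun p : Z × X => q p.1 p.2) {a w : ℝ}
    (hab : ∀ z y, q z y ∈ Set.Icc a (a + w)) {θ τ : ℝ} (hθ : 0 < θ) (hτ : 0 ≤ τ) (Y : ℝ) :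
    μ {ω | ¬ WeightedNoiseBound κ F q w θ τ Y (fun i : Fin n => σ i ω) (fun i => z i ω)
      (fun i => x' i ω)} ≤ ENNReal.ofReal (F.card ^ 2 * Real.exp (-Y)) := by
  rw [pow_two, mul_assoc]
  refine measure_not_forall_mem_le fun f hf => measure_not_forall_mem_le fun g hg => ?_
  have tail := h.measure_weighted_noise_sum_gt_le ((hF f hf).sub (hF g hg)) hσ hσ0 hq hab hθ hτ Y
  simpa only [Finset.sum_range, Pi.sub_apply, Classical.not_imp, not_le, Fin.forall_iff] using tail

end AdaptedTransitions

namespace IsLeastSquares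

variable {Z X : Type*} {F : Finset (Z → ℝ)} {n : ℕ} {z : Fin n → Z} {g f : Z → ℝ}

lemma sum_sq_sub_le {σ y : Fin n → ℝ} (hg : IsLeastSquares F σ z y g) (hf : f ∈ F) :
    ∑ i, (g (z i) - f (z i)) ^ 2 / σ i ^ 2 ≤
      2 * ∑ i, (g (z i) - f (z i)) / σ i ^ 2 * (y i - f (z i)) := by
  have expand : ∑ i, (g (z i) - y i) ^ 2 / σ i ^ 2 = ∑ i, (g (z i) - f (z i)) ^ 2 / σ i ^ 2 -
      2 * ∑ i, (g (z i) - f (z i)) / σ i ^ 2 * (y i - f (z i)) +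
      ∑ i, (f (z i) - y i) ^ 2 / σ i ^ 2 := by
    rw [Finset.mul_sum, ← Finset.sum_sub_distrib, ← Finset.sum_add_distrib]
    exact Finset.sum_congr rfl fun i _ => by ring
  linarith [hg.2 f hf]

variable [MeasurableSpace Z] [MeasurableSpace X] {κ : Kernel Z X} {x' : Fin n → X} {q : Z → X → ℝ}
  {L ε : ℝ}

lemma sum_sq_sub_le_noise {σ : Fin n → ℝ} {a : ℝ} (ha : 0 < a) (hσ : ∀ i, a ≤ σ i)
    (hF : ∀ f ∈ F, ∀ z, f z ∈ Set.Icc 0 L)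
    (hg : IsLeastSquares F σ z (fun i => q (z i) (x' i)) g) (hf : f ∈ F)
    (hfq : ∀ z, |f z - ∫ y, q z y ∂(κ z)| ≤ ε) :
    ∑ i, (g (z i) - f (z i)) ^ 2 / σ i ^ 2 ≤
      2 * ∑ i, (g (z i) - f (z i)) / σ i ^ 2 * noise κ q (z i) (x' i) +
        2 * (n * L * ε / a ^ 2) := by
  have bias_le : ∀ i, (g (z i) - f (z i)) / σ i ^ 2 * (q (z i) (x' i) - f (z i)) ≤
      (g (z i) - f (z i)) / σ i ^ 2 * noise κ q (z i) (x' i) + L * ε / a ^ 2 := fun i => by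
    have hd : |g (z i) - f (z i)| ≤ L :=
      (Real.dist_le_of_mem_Icc (hF g hg.1 (z i)) (hF f hf (z i))).trans_eq (sub_zero L)
    have hL : 0 ≤ L := (abs_nonneg _).trans hd
    have hε : 0 ≤ ε := (abs_nonneg _).trans (hfq (z i))
    have hprod : (g (z i) - f (z i)) * -(f (z i) - ∫ y, q (z i) y ∂(κ (z i))) ≤ L * ε := by
      refine (le_abs_self _).trans ?_
      rw [abs_mul, abs_neg]
      exact mul_le_mul hd (hfq (z i)) (abs_nonneg _) hL
    calc (g (z i) - f (z i)) / σ i ^ 2 * (q (z i) (x' i) - f (z i))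
        = (g (z i) - f (z i)) / σ i ^ 2 * noise κ q (z i) (x' i) +
          (g (z i) - f (z i)) * -(f (z i) - ∫ y, q (z i) y ∂(κ (z i))) / σ i ^ 2 := by
          rw [noise]
          ring
      _ ≤ (g (z i) - f (z i)) / σ i ^ 2 * noise κ q (z i) (x' i) + L * ε / a ^ 2 := by
          have hσi := hσ i
          gcongr
  refine (hg.sum_sq_sub_le hf).trans ?_
  rw [← mul_add]
  refine mul_le_mul_of_nonneg_left ((Finset.sum_le_sum fun i _ => bias_le i).trans_eq ?_)
    zero_le_two
  rw [Finset.sum_add_distrib, Finset.sum_const, Finset.card_fin, nsmul_eq_mul]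
  ring

lemma sum_sq_sub_le_of_noiseBound (hF : ∀ f ∈ F, ∀ z, f z ∈ Set.Icc 0 L)
    (hg : IsLeastSquares F (fun _ => 1) z (fun i => q (z i) (x' i)) g) (hf : f ∈ F)
    (hfq : ∀ z, |f z - ∫ y, q z y ∂(κ z)| ≤ ε) {w Y : ℝ} (hnoise : NoiseBound κ F q w Y z x') :
    ∑ i, (f (z i) - g (z i)) ^ 2 / 1 ^ 2 ≤ 2 * w ^ 2 * Y + 4 * (n * L * ε) := by
  have basic := hg.sum_sq_sub_le_noise one_pos (fun _ => le_rfl) hF hf hfq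
  have noise_le := hnoise g hg.1 f hf
  simp only [one_pow, div_one] at basic ⊢
  simp only [sub_sq_comm (f _) (g _)]
  linarith

end IsLeastSquares

end VOQL

namespace VOQL

open MeasureTheory ProbabilityTheory

/-! ### Bellman operators and optimal values -/

section MaxA

variable {X A : Type*}

lemma maxA_mem_Icc [Nonempty A] {f : X × A → ℝ} {lo hi : ℝ} (hf : ∀ z, f z ∈ Set.Icc lo hi)
    (x : X) : maxA f x ∈ Set.Icc lo hi := by
  refine ⟨?_, ciSup_le fun a => (hf _).2⟩
  obtain ⟨a⟩ := ‹Nonempty A›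
  exact (hf (x, a)).1.trans
    (le_ciSup (f := fun a => f (x, a)) ⟨hi, by rintro _ ⟨b, rfl⟩; exact (hf _).2⟩ a)

lemma maxA_mono {f g : X × A → ℝ} {hi : ℝ} (hfg : ∀ z, f z ≤ g z) (hg : ∀ z, g z ≤ hi) (x : X) :
    maxA f x ≤ maxA g x :=
  ciSup_mono ⟨hi, by rintro _ ⟨b, rfl⟩; exact hg _⟩ fun a => hfg (x, a)

lemma maxA_zero : maxA (fun _ : X × A => (0 : ℝ)) = fun _ => 0 := by
  funext x
  simp [maxA]

end MaxA

namespace EpisodicMDP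

variable {X A : Type*} [MeasurableSpace X] [MeasurableSpace A] {M : EpisodicMDP X A}

instance (h : ℕ) : IsMarkovKernel (M.P h) := M.markov h

lemma measurable_return (h : ℕ) {V : X → ℝ} (hV : Measurable V) :
    Measurable fun p : (X × A) × X => M.r h p.1 p.2 + V p.2 :=
  (M.measurable_r h).add (hV.comp measurable_snd)

section Bellman

variable {h : ℕ} {V V' : X → ℝ} {c c' : ℝ}

lemma return_mem_Icc (hh : h < M.H) (hV : ∀ x, V x ∈ Set.Icc 0 c) (z : X × A) (y : X) :
    M.r h z y + V y ∈ Set.Icc 0 (1 + c) :=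
  ⟨add_nonneg (M.r_mem h hh z y).1 (hV y).1, add_le_add (M.r_mem h hh z y).2 (hV y).2⟩

lemma return_sq_mem_Icc (hh : h < M.H) (hV : ∀ x, V x ∈ Set.Icc 0 c) (z : X × A) (y : X) :
    (M.r h z y + V y) ^ 2 ∈ Set.Icc 0 ((1 + c) ^ 2) :=
  ⟨sq_nonneg _, pow_le_pow_left₀ (return_mem_Icc hh hV z y).1 (return_mem_Icc hh hV z y).2 2⟩

lemma integrable_return (hh : h < M.H) (hVm : Measurable V) (hV : ∀ x, V x ∈ Set.Icc 0 c)
    (z : X × A) : Integrable (fun y => M.r h z y + V y) (M.P h z) :=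
  integrable_of_forall_mem_Icc (measurable_return h hVm) (return_mem_Icc hh hV) z

lemma bellman_mono (hh : h < M.H) (hVm : Measurable V) (hVm' : Measurable V')
    (hV : ∀ x, V x ∈ Set.Icc 0 c) (hV' : ∀ x, V' x ∈ Set.Icc 0 c') (hle : ∀ x, V x ≤ V' x)
    (z : X × A) : M.bellman h V z ≤ M.bellman h V' z :=
  integral_mono (integrable_return hh hVm hV z) (integrable_return hh hVm' hV' z)
    fun y => add_le_add le_rfl (hle y)

lemma bellman₂_mono (hh : h < M.H) (hVm : Measurable V) (hVm' : Measurable V')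
    (hV : ∀ x, V x ∈ Set.Icc 0 c) (hV' : ∀ x, V' x ∈ Set.Icc 0 c') (hle : ∀ x, V x ≤ V' x)
    (z : X × A) : M.bellman₂ h V z ≤ M.bellman₂ h V' z :=
  integral_mono
    (integrable_of_forall_mem_Icc ((measurable_return h hVm).pow_const 2)
      (return_sq_mem_Icc hh hV) z)
    (integrable_of_forall_mem_Icc ((measurable_return h hVm').pow_const 2)
      (return_sq_mem_Icc hh hV') z)
    fun y => pow_le_pow_left₀ (return_mem_Icc hh hV z y).1 (add_le_add le_rfl (hle y)) 2

lemma bellman_mem_Icc (hh : h < M.H) (hVm : Measurable V) (hV : ∀ x, V x ∈ Set.Icc 0 c)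
    (z : X × A) : M.bellman h V z ∈ Set.Icc 0 (1 + c) :=
  integral_mem_Icc ((measurable_return h hVm).comp measurable_prodMk_left) (return_mem_Icc hh hV z)

lemma bellman₂_mem_Icc (hh : h < M.H) (hVm : Measurable V) (hV : ∀ x, V x ∈ Set.Icc 0 c)
    (z : X × A) : M.bellman₂ h V z ∈ Set.Icc 0 ((1 + c) ^ 2) :=
  integral_mem_Icc (((measurable_return h hVm).comp measurable_prodMk_left).pow_const 2)
    (return_sq_mem_Icc hh hV z)

lemma variance_return (hh : h < M.H) (hVm : Measurable V) (hV : ∀ x, V x ∈ Set.Icc 0 c)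
    (z : X × A) :
    Var[fun y => M.r h z y + V y; M.P h z] = M.bellman₂ h V z - M.bellman h V z ^ 2 := by
  have hmeas : Measurable fun y => M.r h z y + V y :=
    (measurable_return h hVm).comp measurable_prodMk_left
  exact variance_eq_sub
    (memLp_of_bounded (.of_forall (return_mem_Icc hh hV z)) hmeas.aestronglyMeasurable 2)

end Bellman

variable (M) in
/-- The optimal state value function `V_⋆^h`. -/
noncomputable def optV (h : ℕ) : X → ℝ := maxA (M.optQ h)

lemma optQ_eq_bellman {h : ℕ} (hh : h < M.H) : M.optQ h = M.bellman h (M.optV (h + 1)) := by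
  have steps_to_go : M.H - h = (M.H - (h + 1)) + 1 := by omega
  rw [optQ, steps_to_go]
  rfl

lemma optQ_terminal : M.optQ M.H = fun _ => 0 := by
  rw [optQ, Nat.sub_self]
  rfl

lemma optQAux_nonneg (k h : ℕ) (hk : h + k = M.H) (z : X × A) : 0 ≤ M.optQAux k h z := by
  induction k generalizing h z with
  | zero => exact le_rfl
  | succ k ih =>
    exact integral_nonneg fun y => add_nonneg (M.r_mem h (by omega) z y).1
      (Real.iSup_nonneg fun a => ih (h + 1) (by omega) _)

lemma optQAux_le_of_rewardLE [Nonempty A] (k h : ℕ) (hk : h + k = M.H) (c : ℝ) (x : X)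
    (hr : M.RewardLE k h c x) (a : A) : M.optQAux k h (x, a) ≤ c := by
  induction k generalizing h c x a with
  | zero => exact hr
  | succ k ih =>
    have return_le : ∀ᵐ y ∂(M.P h (x, a)),
        M.r h (x, a) y + maxA (M.optQAux k (h + 1)) y ≤ c := by
      filter_upwards [hr a] with y hy
      have value_le : maxA (M.optQAux k (h + 1)) y ≤ c - M.r h (x, a) y :=
        ciSup_le fun b => ih (h + 1) (by omega) _ y hy b
      linarith
    have return_nonneg : ∀ y, 0 ≤ M.r h (x, a) y + maxA (M.optQAux k (h + 1)) y := fun y =>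
      add_nonneg (M.r_mem h (by omega) (x, a) y).1
        (Real.iSup_nonneg fun b => optQAux_nonneg k (h + 1) (by omega) _)
    refine (integral_mono_of_nonneg (.of_forall return_nonneg) (integrable_const c)
      return_le).trans_eq ?_
    simp

lemma optQ_mem_Icc [Nonempty A] (hs : M.SparseReward) {h : ℕ} (hh : h ≤ M.H) (z : X × A) :
    M.optQ h z ∈ Set.Icc (0 : ℝ) 1 := by
  refine ⟨optQAux_nonneg _ h (by omega) z, ?_⟩
  rcases hh.lt_or_eq with hlt | rfl
  · exact optQAux_le_of_rewardLE _ h (by omega) 1 z.1 (hs h hlt z.1) z.2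
  · rw [optQ_terminal]
    exact zero_le_one

lemma optV_mem_Icc [Nonempty A] (hs : M.SparseReward) {h : ℕ} (hh : h ≤ M.H) (x : X) :
    M.optV h x ∈ Set.Icc (0 : ℝ) 1 :=
  maxA_mem_Icc (optQ_mem_Icc hs hh) x

lemma measurable_optV (hm : ∀ h < M.H, Measurable (maxA (M.optQ h))) {h : ℕ} (hh : h ≤ M.H) :
    Measurable (M.optV h) := by
  rcases hh.lt_or_eq with hlt | rfl
  · exact hm h hlt
  · rw [optV, optQ_terminal, maxA_zero]
    exact measurable_const

end EpisodicMDP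

end VOQL

namespace VOQL

open MeasureTheory ProbabilityTheory

namespace Setup

/-! ### Elementary properties of a run -/

variable {X A : Type*} [MeasurableSpace X] [MeasurableSpace A]

/-- An oracle whose bonuses belong to the bonus class, are nonnegative and cover the confidence sets
with the radii `β n`, where `n` is the number of past episodes. -/
structure IsCoveringOracle (S : Setup X A) (β : ℕ → ℝ) : Prop where
  mem : ∀ h < S.M.H, ∀ n < S.T, ∀ σ : Fin n → ℝ, (∀ i, S.α ≤ σ i) →
    ∀ D : Fin n → Sample X A, ∀ fhat ∈ S.F h, S.oracle h n σ D fhat (β n) ∈ S.W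
  nonneg : ∀ h < S.M.H, ∀ n < S.T, ∀ σ : Fin n → ℝ, (∀ i, S.α ≤ σ i) →
    ∀ D : Fin n → Sample X A, ∀ fhat ∈ S.F h, ∀ z, 0 ≤ S.oracle h n σ D fhat (β n) z
  covers : ∀ h < S.M.H, ∀ n < S.T, ∀ σ : Fin n → ℝ, (∀ i, S.α ≤ σ i) →
    ∀ D : Fin n → Sample X A, ∀ fhat ∈ S.F h,
    ∀ f ∈ confSet (S.F h) σ (fun i => (D i).z) fhat (β n), ∀ z,
      |f z - fhat z| ≤ S.oracle h n σ D fhat (β n) z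

lemma IsBonusOracle.isCoveringOracle {S : Setup X A} {β : ℕ → ℝ} (hβ : S.IsBonusOracle β) :
    S.IsCoveringOracle β := by
  obtain ⟨C, -, hC⟩ := hβ
  exact
    { mem := fun h hh n hn σ hσ D fhat hf => (hC h hh n hn σ hσ D fhat hf).1
      nonneg := fun h hh n hn σ hσ D fhat hf => (hC h hh n hn σ hσ D fhat hf).2.1
      covers := fun h hh n hn σ hσ D fhat hf => (hC h hh n hn σ hσ D fhat hf).2.2.1 }

/-- The standing assumptions on the MDP, the function classes, the parameters and the oracle. -/
structure Admissible (S : Setup X A) : Prop where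
  sparse : S.M.SparseReward
  complete : S.EpsComplete
  meas : S.MeasurabilityConventions
  one_le_L : 1 ≤ S.L
  eps_nonneg : 0 ≤ S.eps
  α_pos : 0 < S.α
  α_le_one : S.α ≤ 1
  lam_pos : 0 < S.lam
  δ_pos : 0 < S.δ
  covering1 : S.IsCoveringOracle S.beta1
  covering2 : S.IsCoveringOracle S.beta2
  consistent1 : S.IsConsistent S.beta1
  consistent2 : S.IsConsistent S.beta2

/-- The regression solutions and the weights of `R` are those of the algorithm; the actions are
arbitrary. -/
structure FollowsRegressions (S : Setup X A) (R : RunData X A) : Prop where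
  fhat1_ls : ∀ t < S.T, ∀ h < S.M.H,
    IsLeastSquares (S.F h) (sigs R t h) (zs R t h)
      (fun s => (S.data R t h s).r + maxA (S.f1 R t (h + 1)) (S.data R t h s).x') (R.fhat1 t h)
  fhat2_ls : ∀ t < S.T, ∀ h < S.M.H,
    IsLeastSquares (S.F h) (fun _ => 1) (zs R t h)
      (fun s => (S.data R t h s).r + maxA (S.f2 R t (h + 1)) (S.data R t h s).x') (R.fhat2 t h)
  fhatm2_ls : ∀ t < S.T, ∀ h < S.M.H,
    IsLeastSquares (S.F h) (fun _ => 1) (zs R t h)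
      (fun s => (S.data R t h s).r + maxA (S.fm2 R t (h + 1)) (S.data R t h s).x') (R.fhatm2 t h)
  ghat_ls : ∀ t < S.T, ∀ h < S.M.H,
    IsLeastSquares (S.F h) (fun _ => 1) (zs R t h)
      (fun s => ((S.data R t h s).r + maxA (S.f1 R t (h + 1)) (S.data R t h s).x') ^ 2)
      (R.ghat t h)
  sigBar_eq : ∀ t < S.T, ∀ h < S.M.H, R.sigBar t h = S.sigBarRule R t h

lemma FollowsAlgorithm.followsRegressions {S : Setup X A} {R : RunData X A}
    (hR : S.FollowsAlgorithm R) : S.FollowsRegressions R :=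
  { hR with }

section Run

variable {S : Setup X A} {R : RunData X A} {t h : ℕ}

lemma α_le_sigBar (hR : S.FollowsRegressions R) (ht : t < S.T) (hh : h < S.M.H) :
    S.α ≤ R.sigBar t h := by
  rw [hR.sigBar_eq t ht h hh]
  exact (le_max_right _ _).trans (le_max_left _ _)

lemma α_le_sigs (hR : S.FollowsRegressions R) (ht : t < S.T) (hh : h < S.M.H) (i : Fin t) :
    S.α ≤ sigs R t h i :=
  α_le_sigBar hR (i.2.trans ht) hh

lemma b1_mem (hS : S.Admissible) (hR : S.FollowsRegressions R) (ht : t < S.T) (hh : h < S.M.H) :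
    S.b1 R t h ∈ S.W :=
  hS.covering1.mem h hh t ht _ (α_le_sigs hR ht hh) _ _ (hR.fhat1_ls t ht h hh).1

lemma b1_nonneg (hS : S.Admissible) (hR : S.FollowsRegressions R) (ht : t < S.T) (hh : h < S.M.H)
    (z : X × A) : 0 ≤ S.b1 R t h z :=
  hS.covering1.nonneg h hh t ht _ (α_le_sigs hR ht hh) _ _ (hR.fhat1_ls t ht h hh).1 z

lemma abs_sub_le_b1 (hS : S.Admissible) (hR : S.FollowsRegressions R) (ht : t < S.T)
    (hh : h < S.M.H) {f : X × A → ℝ} (hf : f ∈ S.conf1 R t h) (z : X × A) :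
    |f z - R.fhat1 t h z| ≤ S.b1 R t h z :=
  hS.covering1.covers h hh t ht _ (α_le_sigs hR ht hh) (S.data R t h) _
    (hR.fhat1_ls t ht h hh).1 f hf z

lemma b2_mem (hS : S.Admissible) (hR : S.FollowsRegressions R) (ht : t < S.T) (hh : h < S.M.H) :
    S.b2 R t h ∈ S.W :=
  hS.covering2.mem h hh t ht _ (fun _ => hS.α_le_one) _ _ (hR.fhat2_ls t ht h hh).1

lemma b2_nonneg (hS : S.Admissible) (hR : S.FollowsRegressions R) (ht : t < S.T) (hh : h < S.M.H)
    (z : X × A) : 0 ≤ S.b2 R t h z :=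
  hS.covering2.nonneg h hh t ht _ (fun _ => hS.α_le_one) _ _ (hR.fhat2_ls t ht h hh).1 z

lemma abs_sub_le_b2 (hS : S.Admissible) (hR : S.FollowsRegressions R) (ht : t < S.T)
    (hh : h < S.M.H) {f : X × A → ℝ} (hf : f ∈ S.conf2 R t h) (z : X × A) :
    |f z - R.fhat2 t h z| ≤ S.b2 R t h z :=
  hS.covering2.covers h hh t ht _ (fun _ => hS.α_le_one) (S.data R t h) _
    (hR.fhat2_ls t ht h hh).1 f hf z

lemma abs_sub_le_b2_of_mem_confm2 (hS : S.Admissible) (hR : S.FollowsRegressions R) (ht : t < S.T)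
    (hh : h < S.M.H) {f : X × A → ℝ} (hf : f ∈ S.confm2 R t h) (z : X × A) :
    |f z - R.fhatm2 t h z| ≤ S.b2 R t h z :=
  -- Consistency without additional data compares the centres `f̂₋₂` and `f̂₂`.
  (hS.covering2.covers h hh t ht _ (fun _ => hS.α_le_one) (S.data R t h) _
    (hR.fhatm2_ls t ht h hh).1 f hf z).trans
    (hS.consistent2 h hh t t le_rfl ht _ (fun _ => hS.α_le_one) (S.data R t h) _ _ _ _
      (hR.fhat2_ls t ht h hh) (hR.fhatm2_ls t ht h hh) z)

lemma b1_antitone (hS : S.Admissible) (hR : S.FollowsRegressions R) {s : ℕ} (hst : s ≤ t)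
    (ht : t < S.T) (hh : h < S.M.H) (z : X × A) : S.b1 R t h z ≤ S.b1 R s h z :=
  hS.consistent1 h hh s t hst ht (sigs R t h) (α_le_sigs hR ht hh) (S.data R t h) _ _ _ _
    (hR.fhat1_ls s (hst.trans_lt ht) h hh) (hR.fhat1_ls t ht h hh) z

lemma f1_mem_Icc (hS : S.Admissible) (hR : S.FollowsRegressions R) (ht : t < S.T) (h : ℕ)
    (z : X × A) : S.f1 R t h z ∈ Set.Icc (0 : ℝ) 1 := by
  rw [f1]
  split_ifs with hh
  · refine ⟨le_min ?_ zero_le_one, min_le_right _ _⟩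
    have fhat1_nonneg := (hS.complete.range h hh _ (hR.fhat1_ls t ht h hh).1 z).1
    linarith [hS.eps_nonneg, b1_nonneg hS hR ht hh z]
  · simp

lemma f2_mem_Icc (hS : S.Admissible) (hR : S.FollowsRegressions R) (ht : t < S.T) (h : ℕ)
    (z : X × A) : S.f2 R t h z ∈ Set.Icc (0 : ℝ) 2 := by
  rw [f2]
  split_ifs with hh
  · refine ⟨le_min ?_ zero_le_two, min_le_right _ _⟩
    have fhat2_nonneg := (hS.complete.range h hh _ (hR.fhat2_ls t ht h hh).1 z).1
    linarith [hS.eps_nonneg, b1_nonneg hS hR ht hh z, b2_nonneg hS hR ht hh z]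
  · simp

lemma fm2_nonneg (t h : ℕ) (z : X × A) : 0 ≤ S.fm2 R t h z := by
  rw [fm2]
  split_ifs with hh
  · exact le_max_right _ _
  · exact le_rfl

lemma maxA_f1_mem_Icc [Nonempty A] (hS : S.Admissible) (hR : S.FollowsRegressions R) (ht : t < S.T)
    (h : ℕ) (x : X) : maxA (S.f1 R t h) x ∈ Set.Icc (0 : ℝ) 1 :=
  maxA_mem_Icc (f1_mem_Icc hS hR ht h) x

lemma maxA_f2_mem_Icc [Nonempty A] (hS : S.Admissible) (hR : S.FollowsRegressions R) (ht : t < S.T)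
    (h : ℕ) (x : X) : maxA (S.f2 R t h) x ∈ Set.Icc (0 : ℝ) 2 :=
  maxA_mem_Icc (f2_mem_Icc hS hR ht h) x

end Run

/-! ### Finite classes of value functions -/

section ValueClasses

variable {S : Setup X A} {R : RunData X A} {t h : ℕ}

/-- The functions of `𝒱` below the horizon, and the zero function at the terminal level. -/
noncomputable def atLevel (S : Setup X A) (h : ℕ) (𝒱 : Finset (X → ℝ)) : Finset (X → ℝ) :=
  if h < S.M.H then 𝒱 else {fun _ => 0}

lemma maxA_ite_mem_atLevel {f : X × A → ℝ} {𝒱 : Finset (X → ℝ)}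
    (hf : h < S.M.H → maxA f ∈ 𝒱) :
    maxA (if h < S.M.H then f else fun _ => 0) ∈ S.atLevel h 𝒱 := by
  rw [atLevel]
  split_ifs with hh
  · exact hf hh
  · exact Finset.mem_singleton.2 maxA_zero

lemma measurable_of_mem_atLevel {𝒱 : Finset (X → ℝ)}
    (h𝒱 : h < S.M.H → ∀ V ∈ 𝒱, Measurable V) {V : X → ℝ} (hV : V ∈ S.atLevel h 𝒱) :
    Measurable V := by
  rw [atLevel] at hV
  split_ifs at hV with hh
  · exact h𝒱 hh V hV
  · rw [Finset.mem_singleton.1 hV]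
    exact measurable_const

lemma card_atLevel_le {𝒱 : Finset (X → ℝ)} {m : ℕ} (hm : 1 ≤ m) (h𝒱 : h < S.M.H → 𝒱.card ≤ m) :
    (S.atLevel h 𝒱).card ≤ m := by
  rw [atLevel]
  split_ifs with hh
  · exact h𝒱 hh
  · exact hm

open Classical in
/-- The possible values of `max_a f_{t,1}^h`. -/
noncomputable def class1 (S : Setup X A) (h : ℕ) : Finset (X → ℝ) :=
  S.atLevel h ((S.F h ×ˢ S.W).image fun p => maxA (S.optimistic p.1 p.2))

open Classical in
/-- The possible values of `max_a f_{t,2}^h`. -/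
noncomputable def class2 (S : Setup X A) (h : ℕ) : Finset (X → ℝ) :=
  S.atLevel h ((S.F h ×ˢ S.W ×ˢ S.W).image fun p => maxA (S.overlyOptimistic p.1 p.2.1 p.2.2))

open Classical in
/-- The possible values of `max_a f_{t,-2}^h`. -/
noncomputable def classm2 (S : Setup X A) (h : ℕ) : Finset (X → ℝ) :=
  S.atLevel h ((S.F h ×ˢ S.W).image fun p => maxA (S.overlyPessimistic p.1 p.2))

lemma maxA_f1_mem_class1 (hS : S.Admissible) (hR : S.FollowsRegressions R) (ht : t < S.T) (h : ℕ) :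
    maxA (S.f1 R t h) ∈ S.class1 h := by
  classical
  exact maxA_ite_mem_atLevel fun hh => Finset.mem_image.2 ⟨(_, _),
    Finset.mk_mem_product (hR.fhat1_ls t ht h hh).1 (b1_mem hS hR ht hh), rfl⟩

lemma maxA_f2_mem_class2 (hS : S.Admissible) (hR : S.FollowsRegressions R) (ht : t < S.T) (h : ℕ) :
    maxA (S.f2 R t h) ∈ S.class2 h := by
  classical
  exact maxA_ite_mem_atLevel fun hh => Finset.mem_image.2 ⟨(_, _, _),
    Finset.mk_mem_product (hR.fhat2_ls t ht h hh).1
      (Finset.mk_mem_product (b1_mem hS hR ht hh) (b2_mem hS hR ht hh)), rfl⟩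

lemma maxA_fm2_mem_classm2 (hS : S.Admissible) (hR : S.FollowsRegressions R) (ht : t < S.T)
    (h : ℕ) : maxA (S.fm2 R t h) ∈ S.classm2 h := by
  classical
  exact maxA_ite_mem_atLevel fun hh => Finset.mem_image.2 ⟨(_, _),
    Finset.mk_mem_product (hR.fhatm2_ls t ht h hh).1 (b2_mem hS hR ht hh), rfl⟩

lemma measurable_of_mem_class1 (hS : S.Admissible) {V : X → ℝ} (hV : V ∈ S.class1 h) :
    Measurable V := by
  classical
  exact measurable_of_mem_atLevel (fun hh => Finset.forall_mem_image.2 fun _ hp =>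
    hS.meas.max_opt h hh _ (Finset.mem_product.1 hp).1 _ (Finset.mem_product.1 hp).2) hV

lemma measurable_of_mem_class2 (hS : S.Admissible) {V : X → ℝ} (hV : V ∈ S.class2 h) :
    Measurable V := by
  classical
  refine measurable_of_mem_atLevel (fun hh => Finset.forall_mem_image.2 fun p hp => ?_) hV
  obtain ⟨hf, hb⟩ := Finset.mem_product.1 hp
  obtain ⟨hb1, hb2⟩ := Finset.mem_product.1 hb
  exact hS.meas.max_over h hh _ hf _ hb1 _ hb2

lemma measurable_of_mem_classm2 (hS : S.Admissible) {V : X → ℝ} (hV : V ∈ S.classm2 h) :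
    Measurable V := by
  classical
  exact measurable_of_mem_atLevel (fun hh => Finset.forall_mem_image.2 fun _ hp =>
    hS.meas.max_pess h hh _ (Finset.mem_product.1 hp).1 _ (Finset.mem_product.1 hp).2) hV

lemma measurable_maxA_f1 (hS : S.Admissible) (hR : S.FollowsRegressions R) (ht : t < S.T) (h : ℕ) :
    Measurable (maxA (S.f1 R t h)) :=
  measurable_of_mem_class1 hS (maxA_f1_mem_class1 hS hR ht h)

lemma measurable_maxA_f2 (hS : S.Admissible) (hR : S.FollowsRegressions R) (ht : t < S.T) (h : ℕ) :
    Measurable (maxA (S.f2 R t h)) :=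
  measurable_of_mem_class2 hS (maxA_f2_mem_class2 hS hR ht h)

lemma measurable_maxA_fm2 (hS : S.Admissible) (hR : S.FollowsRegressions R) (ht : t < S.T)
    (h : ℕ) : Measurable (maxA (S.fm2 R t h)) :=
  measurable_of_mem_classm2 hS (maxA_fm2_mem_classm2 hS hR ht h)

lemma measurable_optV (hS : S.Admissible) (hh : h ≤ S.M.H) : Measurable (S.M.optV h) :=
  EpisodicMDP.measurable_optV hS.meas.max_star hh

lemma card_F_le (hh : h < S.M.H) : (S.F h).card ≤ S.N :=
  Finset.le_sup (f := fun h => (S.F h).card) (Finset.mem_range.2 hh)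

lemma one_le_N (hS : S.Admissible) (hh : h < S.M.H) : 1 ≤ S.N := by
  obtain ⟨f, hf, -⟩ := hS.complete.first h hh (fun _ => 0) measurable_const
    fun _ => ⟨le_rfl, zero_le_two⟩
  exact (Finset.card_pos.2 ⟨f, hf⟩).trans_le (card_F_le hh)

lemma one_le_Nb (hS : S.Admissible) (hR : S.FollowsRegressions R) (ht : t < S.T)
    (hh : h < S.M.H) : 1 ≤ S.Nb :=
  Finset.card_pos.2 ⟨_, b1_mem hS hR ht hh⟩

lemma card_class1_le (hN : 1 ≤ S.N) (hNb : 1 ≤ S.Nb) (h : ℕ) :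
    (S.class1 h).card ≤ S.N * S.Nb := by
  classical
  refine card_atLevel_le (Nat.mul_pos hN hNb) fun hh => Finset.card_image_le.trans ?_
  rw [Finset.card_product]
  exact Nat.mul_le_mul (card_F_le hh) le_rfl

lemma card_class2_le (hN : 1 ≤ S.N) (hNb : 1 ≤ S.Nb) (h : ℕ) :
    (S.class2 h).card ≤ S.N * S.Nb ^ 2 := by
  classical
  refine card_atLevel_le (Nat.mul_pos hN (pow_pos hNb 2)) fun hh => Finset.card_image_le.trans ?_
  rw [Finset.card_product, Finset.card_product, pow_two]
  exact Nat.mul_le_mul (card_F_le hh) le_rfl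

lemma card_classm2_le (hN : 1 ≤ S.N) (hNb : 1 ≤ S.Nb) (h : ℕ) :
    (S.classm2 h).card ≤ S.N * S.Nb := by
  classical
  refine card_atLevel_le (Nat.mul_pos hN hNb) fun hh => Finset.card_image_le.trans ?_
  rw [Finset.card_product]
  exact Nat.mul_le_mul (card_F_le hh) le_rfl

end ValueClasses

end Setup

end VOQL

namespace VOQL

open MeasureTheory ProbabilityTheory

/-! ### Adaptedness of the run -/

lemma measurable_eval_of_finset {Ω Z : Type*} [MeasurableSpace Ω] [MeasurableSpace Z]
    {𝓕 : Finset (Z → ℝ)} (h𝓕 : ∀ f ∈ 𝓕, Measurable f) {φ : Ω → Z → ℝ} (hφ : ∀ ω, φ ω ∈ 𝓕)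
    (hset : ∀ f, MeasurableSet {ω | φ ω = f}) {z : Ω → Z} (hz : Measurable z) :
    Measurable fun ω => φ ω (z ω) := by
  have eval_eq_sum : (fun ω => φ ω (z ω)) =
      fun ω => ∑ f ∈ 𝓕, {ω | φ ω = f}.indicator (fun ω => f (z ω)) ω := by
    funext ω
    rw [Finset.sum_eq_single_of_mem (φ ω) (hφ ω)
      fun f _ hf => Set.indicator_of_notMem (fun h => hf h.symm) _]
    simp [Set.indicator]
  rw [eval_eq_sum]
  exact Finset.measurable_sum _ fun f hf => ((h𝓕 f hf).comp hz).indicator (hset f)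

lemma measurable_eluderD {Ω Z : Type*} [MeasurableSpace Ω] [MeasurableSpace Z]
    {F : Finset (Z → ℝ)} (hF : ∀ f ∈ F, Measurable f) (lam : ℝ) {n : ℕ} {σ : Ω → Fin n → ℝ}
    (hσ : ∀ i, Measurable fun ω => σ ω i) {zs : Ω → Fin n → Z}
    (hzs : ∀ i, Measurable fun ω => zs ω i) {z : Ω → Z} (hz : Measurable z) :
    Measurable fun ω => eluderD F lam (σ ω) (zs ω) (z ω) := by
  refine Measurable.sqrt (Measurable.iSup fun p => ?_)
  have h1 := hF _ p.1.2
  have h2 := hF _ p.2.2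
  refine (((h1.comp hz).sub (h2.comp hz)).pow_const 2).div (Measurable.add_const ?_ _)
  exact Finset.measurable_sum _ fun i _ =>
    (((h1.comp (hzs i)).sub (h2.comp (hzs i))).pow_const 2).div ((hσ i).pow_const 2)

namespace Setup

variable {X A Ω : Type*} [MeasurableSpace X] [MeasurableSpace A] [mΩ : MeasurableSpace Ω]

/-- A random run as in `IsRandomRun`, except that the actions may be chosen by an arbitrary adapted
policy and that nothing is required of the initial states: the confidence sets do not depend on
either. -/
structure IsRegressionRun (S : Setup X A) (μ : Measure Ω) (𝓗 : ℕ → ℕ → MeasurableSpace Ω)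
    (R : Ω → RunData X A) : Prop where
  follows : ∀ ω, S.FollowsRegressions (R ω)
  le : ∀ t h, 𝓗 t h ≤ mΩ
  mono_level : ∀ t h, h < S.M.H → 𝓗 t h ≤ 𝓗 t (h + 1)
  mono_episode : ∀ t, 𝓗 t S.M.H ≤ 𝓗 (t + 1) 0
  x_meas : ∀ t < S.T, ∀ h < S.M.H, Measurable[𝓗 t (h + 1)] fun ω => (R ω).x t h
  x_last_meas : ∀ t < S.T, Measurable[𝓗 (t + 1) 0] fun ω => (R ω).x t S.M.H
  a_meas : ∀ t < S.T, ∀ h < S.M.H, Measurable[𝓗 t (h + 1)] fun ω => (R ω).a t h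
  fhat2_meas : ∀ t < S.T, ∀ h < S.M.H, ∀ f, MeasurableSet[𝓗 t 0] {ω | (R ω).fhat2 t h = f}
  fhatm2_meas : ∀ t < S.T, ∀ h < S.M.H, ∀ f, MeasurableSet[𝓗 t 0] {ω | (R ω).fhatm2 t h = f}
  ghat_meas : ∀ t < S.T, ∀ h < S.M.H, ∀ f, MeasurableSet[𝓗 t 0] {ω | (R ω).ghat t h = f}
  b1_meas : ∀ t < S.T, ∀ h < S.M.H, ∀ b, MeasurableSet[𝓗 t 0] {ω | S.b1 (R ω) t h = b}
  b2_meas : ∀ t < S.T, ∀ h < S.M.H, ∀ b, MeasurableSet[𝓗 t 0] {ω | S.b2 (R ω) t h = b}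
  law_step : ∀ t < S.T, ∀ h < S.M.H, ∀ E, MeasurableSet[𝓗 t (h + 1)] E →
    ∀ B : Set X, MeasurableSet B →
    μ (E ∩ {ω | (R ω).x t (h + 1) ∈ B}) = ∫⁻ ω in E, S.M.P h (z (R ω) t h) B ∂μ

variable {S : Setup X A} {μ : Measure Ω} {𝓗 : ℕ → ℕ → MeasurableSpace Ω} {R : Ω → RunData X A}

lemma IsRandomRun.isRegressionRun (hrun : S.IsRandomRun μ 𝓗 R) : S.IsRegressionRun μ 𝓗 R :=
  { hrun with follows := fun ω => (hrun.follows ω).followsRegressions }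

namespace IsRegressionRun

variable {t h : ℕ}

lemma mono_of_le (hrun : S.IsRegressionRun μ 𝓗 R) (t : ℕ) {h h' : ℕ} (hle : h ≤ h')
    (hh' : h' ≤ S.M.H) : 𝓗 t h ≤ 𝓗 t h' := by
  induction h', hle using Nat.le_induction with
  | base => exact le_rfl
  | succ k _ ih => exact (ih (by omega)).trans (hrun.mono_level t k (by omega))

lemma mono_succ (hrun : S.IsRegressionRun μ 𝓗 R) (t : ℕ) {h h' : ℕ} (hh : h ≤ S.M.H)
    (hh' : h' ≤ S.M.H) : 𝓗 t h ≤ 𝓗 (t + 1) h' :=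
  (hrun.mono_of_le t hh le_rfl).trans
    ((hrun.mono_episode t).trans (hrun.mono_of_le (t + 1) (Nat.zero_le _) hh'))

lemma mono_of_lt (hrun : S.IsRegressionRun μ 𝓗 R) {s : ℕ} (hst : s < t) (hh : h ≤ S.M.H) :
    𝓗 s h ≤ 𝓗 t h := by
  induction t, hst using Nat.le_induction with
  | base => exact hrun.mono_succ s hh hh
  | succ k _ ih => exact ih.trans (hrun.mono_succ k hh hh)

lemma measurable_z (hrun : S.IsRegressionRun μ 𝓗 R) (ht : t < S.T) (hh : h < S.M.H) :
    Measurable[𝓗 t (h + 1)] fun ω => z (R ω) t h :=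
  (hrun.x_meas t ht h hh).prodMk (hrun.a_meas t ht h hh)

lemma measurable_zs (hrun : S.IsRegressionRun μ 𝓗 R) (ht : t < S.T) (hh : h < S.M.H) (i : Fin t) :
    Measurable[𝓗 t (h + 1)] fun ω => zs (R ω) t h i :=
  (hrun.measurable_z (i.2.trans ht) hh).mono (hrun.mono_of_lt i.2 hh) le_rfl

lemma measurable_next_state (hrun : S.IsRegressionRun μ 𝓗 R) (ht : t < S.T) (hh : h < S.M.H) :
    Measurable[𝓗 (t + 1) (h + 1)] fun ω => (R ω).x t (h + 1) := by
  rcases (Nat.succ_le_of_lt hh).lt_or_eq with hlt | hlast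
  · exact (hrun.x_meas t ht (h + 1) hlt).mono (hrun.mono_succ t hlt hh) le_rfl
  · rw [show h + 1 = S.M.H from hlast]
    exact (hrun.x_last_meas t ht).mono (hrun.mono_of_le (t + 1) (Nat.zero_le _) le_rfl) le_rfl

lemma adaptedTransitions (hrun : S.IsRegressionRun μ 𝓗 R) (ht : t ≤ S.T) (hh : h < S.M.H) :
    AdaptedTransitions μ (S.M.P h) t (fun s => 𝓗 s (h + 1))
      (fun s ω => z (R ω) s h) (fun s ω => (R ω).x s (h + 1)) where
  le s := hrun.le s _
  mono s := hrun.mono_succ s hh hh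
  z_meas _ hs := hrun.measurable_z (hs.trans_le ht) hh
  x'_meas _ hs := hrun.measurable_next_state (hs.trans_le ht) hh
  law s hs E hE B hB := hrun.law_step s (hs.trans_le ht) h hh E hE B hB

lemma measurable_eval (hrun : S.IsRegressionRun μ 𝓗 R) (ht : t < S.T) (hh : h < S.M.H)
    {𝓕 : Finset (X × A → ℝ)} (h𝓕 : ∀ f ∈ 𝓕, Measurable f) {φ : Ω → X × A → ℝ}
    (hφ : ∀ ω, φ ω ∈ 𝓕) (hset : ∀ f, MeasurableSet[𝓗 t 0] {ω | φ ω = f}) :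
    Measurable[𝓗 t (h + 1)] fun ω => φ ω (z (R ω) t h) :=
  @measurable_eval_of_finset Ω _ (𝓗 t (h + 1)) _ 𝓕 h𝓕 φ hφ
    (fun f => hrun.mono_of_le t (Nat.zero_le _) hh _ (hset f)) _ (hrun.measurable_z ht hh)

lemma measurable_fhatm2_eval (hrun : S.IsRegressionRun μ 𝓗 R) (hS : S.Admissible) (ht : t < S.T)
    (hh : h < S.M.H) : Measurable[𝓗 t (h + 1)] fun ω => (R ω).fhatm2 t h (z (R ω) t h) :=
  hrun.measurable_eval ht hh (hS.meas.F_meas h hh)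
    (fun ω => ((hrun.follows ω).fhatm2_ls t ht h hh).1) (hrun.fhatm2_meas t ht h hh)

lemma measurable_sigmaSq (hrun : S.IsRegressionRun μ 𝓗 R) (hS : S.Admissible) (ht : t < S.T)
    (hh : h < S.M.H) : Measurable[𝓗 t (h + 1)] fun ω => S.sigmaSq (R ω) t h := by
  have hghat : Measurable[𝓗 t (h + 1)] fun ω => (R ω).ghat t h (z (R ω) t h) :=
    hrun.measurable_eval ht hh (hS.meas.F_meas h hh)
      (fun ω => ((hrun.follows ω).ghat_ls t ht h hh).1) (hrun.ghat_meas t ht h hh)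
  have hD := @measurable_eluderD Ω _ (𝓗 t (h + 1)) _ _ (hS.meas.F_meas h hh) S.lam t
    (fun _ _ => 1) (fun _ => measurable_const) _ (hrun.measurable_zs ht hh) _
    (hrun.measurable_z ht hh)
  simp only [sigmaSq]
  split_ifs with ht0
  · exact measurable_const
  · exact measurable_const.min (((hghat.sub
      ((hrun.measurable_fhatm2_eval hS ht hh).pow_const 2)).add (hD.mul_const _)).add_const _)

lemma measurable_f2_sub_fm2 (hrun : S.IsRegressionRun μ 𝓗 R) (hS : S.Admissible) (ht : t < S.T)
    (hh : h < S.M.H) : Measurable[𝓗 t (h + 1)] fun ω =>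
      S.f2 (R ω) t h (z (R ω) t h) - S.fm2 (R ω) t h (z (R ω) t h) := by
  have hf2 : Measurable[𝓗 t (h + 1)] fun ω => (R ω).fhat2 t h (z (R ω) t h) :=
    hrun.measurable_eval ht hh (hS.meas.F_meas h hh)
      (fun ω => ((hrun.follows ω).fhat2_ls t ht h hh).1) (hrun.fhat2_meas t ht h hh)
  have hb1 : Measurable[𝓗 t (h + 1)] fun ω => S.b1 (R ω) t h (z (R ω) t h) :=
    hrun.measurable_eval ht hh hS.meas.W_meas
      (fun ω => b1_mem hS (hrun.follows ω) ht hh) (hrun.b1_meas t ht h hh)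
  have hb2 : Measurable[𝓗 t (h + 1)] fun ω => S.b2 (R ω) t h (z (R ω) t h) :=
    hrun.measurable_eval ht hh hS.meas.W_meas
      (fun ω => b2_mem hS (hrun.follows ω) ht hh) (hrun.b2_meas t ht h hh)
  simp only [f2, fm2, if_pos hh]
  exact ((((hf2.add (hb1.const_mul 2)).add hb2).add_const _).min measurable_const).sub
    ((((hrun.measurable_fhatm2_eval hS ht hh).sub hb2).sub_const _).max measurable_const)

lemma measurable_sigBar (hrun : S.IsRegressionRun μ 𝓗 R) (hS : S.Admissible) (ht : t < S.T)
    (hh : h < S.M.H) : Measurable[𝓗 t (h + 1)] fun ω => (R ω).sigBar t h := by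
  induction t using Nat.strong_induction_on with
  | _ t ih =>
  have hsigs : ∀ i : Fin t, Measurable[𝓗 t (h + 1)] fun ω => sigs (R ω) t h i := fun i =>
    (ih i i.2 (i.2.trans ht)).mono (hrun.mono_of_lt i.2 hh) le_rfl
  have hD := @measurable_eluderD Ω _ (𝓗 t (h + 1)) _ _ (hS.meas.F_meas h hh) S.lam t _ hsigs _
    (hrun.measurable_zs ht hh) _ (hrun.measurable_z ht hh)
  simp only [fun ω => (hrun.follows ω).sigBar_eq t ht h hh, sigBarRule]
  exact (((hrun.measurable_sigmaSq hS ht hh).sqrt).max measurable_const).max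
    (((hrun.measurable_f2_sub_fm2 hS ht hh).sqrt.const_mul _).max (hD.sqrt.const_mul _))

end IsRegressionRun

end Setup

end VOQL

namespace VOQL

open MeasureTheory ProbabilityTheory

/-! ### Logarithmic factors -/

lemma cube_mul_exp_neg_log_le {n C m δ : ℝ} (hn : 0 < n) (hC : 1 ≤ C) (hm : m ≤ C)
    (hδ : 0 < δ) (hδ1 : δ ≤ 1) : n ^ 3 * m * Real.exp (-(3 * Real.log (n * C / δ))) ≤ δ := by
  have : 0 < C := by linarith
  have exp_eq : Real.exp (-(3 * Real.log (n * C / δ))) = ((n * C / δ) ^ 3)⁻¹ := by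
    rw [Real.exp_neg, show (3 : ℝ) = ((3 : ℕ) : ℝ) by norm_num, Real.exp_nat_mul,
      Real.exp_log (by positivity)]
  have m_le_cube : m ≤ C ^ 3 := hm.trans (le_self_pow₀ hC (by norm_num))
  calc n ^ 3 * m * Real.exp (-(3 * Real.log (n * C / δ))) = m / C ^ 3 * δ ^ 3 := by
        rw [exp_eq]
        field_simp
    _ ≤ 1 * δ := by
        gcongr
        · exact (div_le_one (by positivity)).2 m_le_cube
        · exact pow_le_of_le_one hδ.le hδ1 (by norm_num)
    _ = δ := one_mul δ

lemma one_le_log_four : 1 ≤ Real.log 4 := by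
  rw [Real.le_log_iff_exp_le (by norm_num)]
  linarith [Real.exp_one_lt_d9]

lemma two_le_log_eight : 2 ≤ Real.log 8 := by
  rw [Real.le_log_iff_exp_le (by norm_num), show (2 : ℝ) = 1 + 1 by norm_num, Real.exp_add]
  nlinarith [Real.exp_one_lt_d9, Real.exp_pos 1]

lemma one_le_log_mul_log {c L T : ℝ} (hc : 1 ≤ c) (hL : 1 ≤ L) (hT : 1 ≤ T) :
    1 ≤ (2 * Real.log (c * L * T) + 2) * (Real.log (c * L) + 2) := by
  have one_le_mul : 1 ≤ c * L := one_le_mul_of_one_le_of_one_le hc hL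
  have log_nonneg := Real.log_nonneg one_le_mul
  have log_mul_nonneg := Real.log_nonneg (one_le_mul_of_one_le_of_one_le one_le_mul hT)
  nlinarith

namespace Setup

variable {X A : Type*} [MeasurableSpace X] [MeasurableSpace A] {S : Setup X A}

/-- The parameters are in the range where the logarithms defining the radii are bounded below.
For `1/5 ≤ δ` the probability bound `5δ` is trivial. -/
structure NumericRegime (S : Setup X A) : Prop where
  one_le_L : 1 ≤ S.L
  α_pos : 0 < S.α
  α_le_one : S.α ≤ 1
  δ_pos : 0 < S.δ
  δ_lt : S.δ < 1 / 5
  one_le_T : 1 ≤ (S.T : ℝ)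
  one_le_H : 1 ≤ (S.M.H : ℝ)
  one_le_N : 1 ≤ (S.N : ℝ)
  one_le_Nb : 1 ≤ (S.Nb : ℝ)

lemma Admissible.numericRegime (hS : S.Admissible) (hδ : S.δ < 1 / 5) {R : RunData X A}
    (hR : S.FollowsRegressions R) {t h : ℕ} (ht : t < S.T) (hh : h < S.M.H) :
    S.NumericRegime where
  one_le_L := hS.one_le_L
  α_pos := hS.α_pos
  α_le_one := hS.α_le_one
  δ_pos := hS.δ_pos
  δ_lt := hδ
  one_le_T := Nat.one_le_cast.2 (by omega)
  one_le_H := Nat.one_le_cast.2 (by omega)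
  one_le_N := Nat.one_le_cast.2 (Setup.one_le_N hS hh)
  one_le_Nb := Nat.one_le_cast.2 (Setup.one_le_Nb hS hR ht hh)

namespace NumericRegime

lemma δth_pos (hP : S.NumericRegime) : 0 < S.δth := by
  have := hP.δ_pos
  unfold δth
  positivity

lemma δth_le (hP : S.NumericRegime) : S.δth ≤ 1 / 20 := by
  rw [δth, div_le_iff₀ (by positivity)]
  nlinarith [hP.one_le_T, hP.one_le_H, hP.δ_lt]

lemma four_le_ratio (hP : S.NumericRegime) : 4 ≤ 4 * S.L * S.T / S.α := by
  have : 1 ≤ S.L * S.T := one_le_mul_of_one_le_of_one_le hP.one_le_L hP.one_le_T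
  rw [le_div_iff₀ hP.α_pos]
  nlinarith [hP.α_le_one]

lemma log_ratio_le_logFactor (hP : S.NumericRegime) :
    8 * Real.log (4 * S.L * S.T / S.α) + 8 ≤ S.logFactor := by
  have first_log_nonneg : 0 ≤ Real.log (4 * S.L * S.T / S.α) :=
    Real.log_nonneg (by linarith [hP.four_le_ratio])
  have two_le_second_log : 2 ≤ Real.log (8 * S.L / S.α ^ 2) := by
    refine two_le_log_eight.trans (Real.log_le_log (by norm_num) ?_)
    rw [le_div_iff₀ (pow_pos hP.α_pos 2)]
    nlinarith [hP.α_le_one, hP.one_le_L, hP.α_pos]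
  rw [logFactor]
  nlinarith

lemma sixteen_le_logFactor (hP : S.NumericRegime) : 16 ≤ S.logFactor := by
  have : 1 ≤ Real.log (4 * S.L * S.T / S.α) :=
    one_le_log_four.trans (Real.log_le_log (by norm_num) hP.four_le_ratio)
  linarith [hP.log_ratio_le_logFactor]

lemma one_le_N_mul_Nb (hP : S.NumericRegime) : (1 : ℝ) ≤ S.N * S.Nb :=
  one_le_mul_of_one_le_of_one_le hP.one_le_N hP.one_le_Nb

lemma four_le_log (hP : S.NumericRegime) {n : ℝ} (hn : 1 ≤ n) :
    4 ≤ Real.log (n * S.logFactor / S.δth) := by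
  have sq_le : (8 : ℝ) ^ 2 ≤ n * S.logFactor / S.δth := by
    rw [le_div_iff₀ hP.δth_pos]
    nlinarith [hP.sixteen_le_logFactor, hP.δth_le]
  have log_le := Real.log_le_log (by norm_num) sq_le
  rw [Real.log_pow] at log_le
  push_cast at log_le
  linarith [two_le_log_eight]

lemma ups_sq (hP : S.NumericRegime) :
    S.ups ^ 2 = Real.log ((S.N : ℝ) ^ 2 * S.logFactor / S.δth) :=
  Real.sq_sqrt (by linarith [hP.four_le_log (one_le_pow₀ hP.one_le_N (n := 2))])

lemma two_le_ups (hP : S.NumericRegime) : 2 ≤ S.ups :=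
  Real.le_sqrt_of_sq_le (by linarith [hP.four_le_log (one_le_pow₀ hP.one_le_N (n := 2))])

lemma exp_neg_ups_sq (hP : S.NumericRegime) :
    (S.N : ℝ) ^ 2 * S.logFactor * Real.exp (-S.ups ^ 2) = S.δth := by
  have := hP.one_le_N
  have := hP.sixteen_le_logFactor
  have := hP.δth_pos
  rw [hP.ups_sq, Real.exp_neg, Real.exp_log (by positivity)]
  field_simp

lemma iota_sq (hP : S.NumericRegime) :
    S.iota ^ 2 = 9 * Real.log ((S.N : ℝ) * S.Nb * S.logFactor / S.δth) := by
  rw [iota, mul_pow, Real.sq_sqrt (by linarith [hP.four_le_log hP.one_le_N_mul_Nb])]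
  norm_num

lemma iota_pos (hP : S.NumericRegime) : 0 < S.iota :=
  mul_pos three_pos (Real.sqrt_pos.2 (by linarith [hP.four_le_log hP.one_le_N_mul_Nb]))

lemma log_div_δth_nonneg (hP : S.NumericRegime) {n : ℝ} (hn : 1 ≤ n) :
    0 ≤ Real.log (n / S.δth) := by
  refine Real.log_nonneg ?_
  rw [le_div_iff₀ hP.δth_pos]
  linarith [hP.δth_le]

lemma iotaDot_sq (hP : S.NumericRegime) :
    S.iotaDot ^ 2 = 2 * Real.log ((S.N : ℝ) * S.Nb *
      ((2 * Real.log (18 * S.L * S.T) + 2) * (Real.log (18 * S.L) + 2)) / S.δth) := by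
  rw [iotaDot, mul_assoc ((S.N : ℝ) * S.Nb)]
  exact Real.sq_sqrt (mul_nonneg zero_le_two (hP.log_div_δth_nonneg
    (one_le_mul_of_one_le_of_one_le hP.one_le_N_mul_Nb
      (one_le_log_mul_log (by norm_num) hP.one_le_L hP.one_le_T))))

lemma iotaPrime_sq (hP : S.NumericRegime) :
    S.iotaPrime ^ 2 = 2 * Real.log ((S.N : ℝ) * S.Nb *
      ((2 * Real.log (32 * S.L * S.T) + 2) * (Real.log (32 * S.L) + 2)) / S.δth) := by
  rw [iotaPrime, mul_assoc ((S.N : ℝ) * S.Nb)]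
  exact Real.sq_sqrt (mul_nonneg zero_le_two (hP.log_div_δth_nonneg
    (one_le_mul_of_one_le_of_one_le hP.one_le_N_mul_Nb
      (one_le_log_mul_log (by norm_num) hP.one_le_L hP.one_le_T))))

lemma card_mul_exp_neg_le (hP : S.NumericRegime) {K C m : ℝ}
    (hK : K ≤ ((S.N : ℝ) * S.Nb) ^ 3 * m) (hC : 1 ≤ C) (hm : m ≤ C) :
    K * Real.exp (-(3 * Real.log ((S.N : ℝ) * S.Nb * C / S.δth))) ≤ S.δth :=
  (mul_le_mul_of_nonneg_right hK (Real.exp_pos _).le).trans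
    (cube_mul_exp_neg_log_le (by linarith [hP.one_le_N_mul_Nb]) hC hm hP.δth_pos
      (by linarith [hP.δth_le]))

lemma card_mul_exp_neg_iotaDot_sq_le (hP : S.NumericRegime) {K : ℝ}
    (hK : K ≤ ((S.N : ℝ) * S.Nb) ^ 3) : K * Real.exp (-(3 / 2 * S.iotaDot ^ 2)) ≤ S.δth := by
  rw [hP.iotaDot_sq, ← mul_assoc, show (3 / 2 * 2 : ℝ) = 3 by norm_num]
  have one_le_C := one_le_log_mul_log (c := 18) (by norm_num) hP.one_le_L hP.one_le_T
  exact hP.card_mul_exp_neg_le (m := 1) (by rwa [mul_one]) one_le_C one_le_C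

lemma card_mul_exp_neg_iotaPrime_sq_le (hP : S.NumericRegime) {K : ℝ}
    (hK : K ≤ ((S.N : ℝ) * S.Nb) ^ 3) : K * Real.exp (-(3 / 2 * S.iotaPrime ^ 2)) ≤ S.δth := by
  rw [hP.iotaPrime_sq, ← mul_assoc, show (3 / 2 * 2 : ℝ) = 3 by norm_num]
  have one_le_C := one_le_log_mul_log (c := 32) (by norm_num) hP.one_le_L hP.one_le_T
  exact hP.card_mul_exp_neg_le (m := 1) (by rwa [mul_one]) one_le_C one_le_C

end NumericRegime

end Setup

end VOQL

namespace VOQL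

open MeasureTheory ProbabilityTheory

lemma measure_not_le_of_five {Ω : Type*} [MeasurableSpace Ω] {μ : Measure Ω} {δ : ℝ}
    {p₁ p₂ p₃ p₄ p₅ P : Ω → Prop} (h₁ : μ {ω | ¬ p₁ ω} ≤ ENNReal.ofReal δ)
    (h₂ : μ {ω | ¬ p₂ ω} ≤ ENNReal.ofReal δ) (h₃ : μ {ω | ¬ p₃ ω} ≤ ENNReal.ofReal δ)
    (h₄ : μ {ω | ¬ p₄ ω} ≤ ENNReal.ofReal δ) (h₅ : μ {ω | ¬ p₅ ω} ≤ ENNReal.ofReal δ)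
    (hP : ∀ ω, p₁ ω → p₂ ω → p₃ ω → p₄ ω → p₅ ω → P ω) :
    μ {ω | ¬ P ω} ≤ ENNReal.ofReal (5 * δ) := by
  have subset : {ω | ¬ P ω} ⊆
      {ω | ¬ p₁ ω} ∪ {ω | ¬ p₂ ω} ∪ {ω | ¬ p₃ ω} ∪ {ω | ¬ p₄ ω} ∪ {ω | ¬ p₅ ω} := by
    intro ω hω
    simp only [Set.mem_union, Set.mem_ofPred_eq] at hω ⊢
    have := hP ω
    tauto
  calc μ {ω | ¬ P ω}
      ≤ ENNReal.ofReal δ + ENNReal.ofReal δ + ENNReal.ofReal δ + ENNReal.ofReal δ +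
          ENNReal.ofReal δ :=
        (measure_mono subset).trans <| measure_union_le _ _ |>.trans <|
          add_le_add (measure_union_le _ _ |>.trans <|
            add_le_add (measure_union_le _ _ |>.trans <|
              add_le_add (measure_union_le _ _ |>.trans <| add_le_add h₁ h₂) h₃) h₄) h₅
    _ = ENNReal.ofReal (5 * δ) := by
        rw [ENNReal.ofReal_mul (by norm_num), ENNReal.ofReal_ofNat]
        ring

namespace Setup

/-! ### Concentration -/

variable {X A Ω : Type*} [MeasurableSpace X] [MeasurableSpace A] [mΩ : MeasurableSpace Ω]

/-- The number of dyadic levels that cover the possible weighted distances between two functions of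
a class. -/
noncomputable def levels (S : Setup X A) : ℕ := ⌊S.logFactor⌋₊

/-- The scale at which the noise of the optimal value function is controlled when the weighted
distance is about `2 ^ k`. -/
noncomputable def scaleStar (S : Setup X A) (k : ℕ) : ℝ := S.ups / √(2 ^ k + S.lam)

/-- The scale at which the noise of `f_{t,1} - V_⋆` is controlled when the weighted distance is
about `2 ^ k`. -/
noncomputable def scaleDiff (S : Setup X A) (k : ℕ) : ℝ := S.iota ^ 2 / √(2 ^ k + S.lam)

/-- The noise bounds for the four regressions of episode `t` at level `h`. The noise of the
optimistic regression is split into that of the fixed function `V_⋆`, whose union bound does not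
involve the bonus class, and that of `f_{t,1} - V_⋆`, whose variance is small. -/
structure Concentration (S : Setup X A) (R : RunData X A) (t h : ℕ) : Prop where
  overlyOpt : ∀ V ∈ S.class2 (h + 1), (∀ x, V x ∈ Set.Icc (0 : ℝ) 2) →
    NoiseBound (S.M.P h) (S.F h) (fun z y => S.M.r h z y + V y) 3 (3 / 2 * S.iotaDot ^ 2)
      (zs R t h) fun s => R.x s (h + 1)
  overlyPess : ∀ V ∈ S.classm2 (h + 1), (∀ x, V x ∈ Set.Icc (0 : ℝ) 2) →
    NoiseBound (S.M.P h) (S.F h) (fun z y => S.M.r h z y + V y) 3 (3 / 2 * S.iotaDot ^ 2)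
      (zs R t h) fun s => R.x s (h + 1)
  secondMoment : ∀ V ∈ S.class1 (h + 1), (∀ x, V x ∈ Set.Icc (0 : ℝ) 1) →
    NoiseBound (S.M.P h) (S.F h) (fun z y => (S.M.r h z y + V y) ^ 2) 4
      (3 / 2 * S.iotaPrime ^ 2) (zs R t h) fun s => R.x s (h + 1)
  star : ∀ k ∈ Finset.range S.levels,
    WeightedNoiseBound (S.M.P h) (S.F h) (fun z y => S.M.r h z y + S.M.optV (h + 1) y) 2
      (S.scaleStar k) 1 (S.ups ^ 2) (sigs R t h) (zs R t h) fun s => R.x s (h + 1)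
  diff : ∀ V ∈ S.class1 (h + 1), (∀ x, V x ∈ Set.Icc (0 : ℝ) 1) → ∀ k ∈ Finset.range S.levels,
    WeightedNoiseBound (S.M.P h) (S.F h) (fun _ y => V y - S.M.optV (h + 1) y) 2
      (S.scaleDiff k) (1 / (2 * S.iota ^ 2)) (S.iota ^ 2 / 3) (sigs R t h) (zs R t h)
      fun s => R.x s (h + 1)

variable {S : Setup X A} {t h : ℕ}

lemma levels_le_logFactor (hP : S.NumericRegime) : (S.levels : ℝ) ≤ S.logFactor :=
  Nat.floor_le (by linarith [hP.sixteen_le_logFactor])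

lemma scaleStar_pos (hS : S.Admissible) (hP : S.NumericRegime) (k : ℕ) : 0 < S.scaleStar k := by
  have := hS.lam_pos
  have := hP.two_le_ups
  unfold scaleStar
  positivity

lemma scaleDiff_pos (hS : S.Admissible) (hP : S.NumericRegime) (k : ℕ) : 0 < S.scaleDiff k := by
  have := hS.lam_pos
  have := hP.iota_pos
  unfold scaleDiff
  positivity

lemma card_mul_N_sq_le (hP : S.NumericRegime) {c : ℕ} (hc : c ≤ S.N * S.Nb ^ 2) :
    (c * S.N ^ 2 : ℝ) ≤ (S.N * S.Nb) ^ 3 :=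
  calc (c * S.N ^ 2 : ℝ) ≤ (S.N * S.Nb ^ 2) * S.N ^ 2 := by
        gcongr
        exact_mod_cast hc
    _ = S.N ^ 3 * S.Nb ^ 2 := by ring
    _ ≤ S.N ^ 3 * S.Nb ^ 3 := by
        gcongr
        · exact hP.one_le_Nb
        · norm_num
    _ = (S.N * S.Nb) ^ 3 := by ring

namespace IsRegressionRun

variable {μ : Measure Ω} [IsProbabilityMeasure μ] {𝓗 : ℕ → ℕ → MeasurableSpace Ω}
  {R : Ω → RunData X A} {𝒱 : Finset (X → ℝ)} {c a w : ℝ} {q : (X → ℝ) → X × A → X → ℝ}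

lemma measure_not_forall_noiseBound_le (hrun : S.IsRegressionRun μ 𝓗 R) (hS : S.Admissible)
    (ht : t < S.T) (hh : h < S.M.H) (hw : 0 < w)
    (hq : ∀ V ∈ 𝒱, Measurable fun p : (X × A) × X => q V p.1 p.2)
    (hab : ∀ V, (∀ x, V x ∈ Set.Icc 0 c) → ∀ z y, q V z y ∈ Set.Icc a (a + w)) (Y : ℝ) :
    μ {ω | ¬ ∀ V ∈ 𝒱, (∀ x, V x ∈ Set.Icc 0 c) →
      NoiseBound (S.M.P h) (S.F h) (q V) w Y (zs (R ω) t h) fun s => (R ω).x s (h + 1)} ≤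
      ENNReal.ofReal (𝒱.card * S.N ^ 2 * Real.exp (-Y)) := by
  rw [mul_assoc]
  refine measure_not_forall_mem_le fun V hV => ?_
  by_cases hVc : ∀ x, V x ∈ Set.Icc 0 c
  · simp only [hVc, implies_true, forall_const]
    refine ((hrun.adaptedTransitions ht.le hh).measure_not_noiseBound_le (hS.meas.F_meas h hh)
      (hq V hV) hw (hab V hVc) Y).trans (ENNReal.ofReal_le_ofReal ?_)
    gcongr
    exact card_F_le hh
  · simp only [hVc, false_imp_iff, not_true_eq_false]
    exact (measure_empty (μ := μ)).trans_le zero_le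

lemma measure_not_forall_weightedNoiseBound_le (hrun : S.IsRegressionRun μ 𝓗 R)
    (hS : S.Admissible) (ht : t < S.T) (hh : h < S.M.H) {q : X × A → X → ℝ}
    (hq : Measurable fun p : (X × A) × X => q p.1 p.2)
    (hab : ∀ z y, q z y ∈ Set.Icc a (a + w)) {K : ℕ} {θ : ℕ → ℝ} (hθ : ∀ k, 0 < θ k) {τ : ℝ}
    (hτ : 0 ≤ τ) (Y : ℝ) :
    μ {ω | ¬ ∀ k ∈ Finset.range K, WeightedNoiseBound (S.M.P h) (S.F h) q w (θ k) τ Y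
      (sigs (R ω) t h) (zs (R ω) t h) fun s => (R ω).x s (h + 1)} ≤
      ENNReal.ofReal (K * (S.N ^ 2 * Real.exp (-Y))) := by
  have bound := measure_not_forall_mem_le (μ := μ) (I := Finset.range K)
    (c := S.N ^ 2 * Real.exp (-Y)) (p := fun k ω =>
      WeightedNoiseBound (S.M.P h) (S.F h) q w (θ k) τ Y (sigs (R ω) t h) (zs (R ω) t h)
        fun s => (R ω).x s (h + 1)) fun k _ => ?_
  · rwa [Finset.card_range] at bound
  refine ((hrun.adaptedTransitions ht.le hh).measure_not_weightedNoiseBound_le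
    (hS.meas.F_meas h hh) (fun s hs => hrun.measurable_sigBar hS (hs.trans ht) hh)
    (fun s hs ω => hS.α_pos.trans_le (α_le_sigBar (hrun.follows ω) (hs.trans ht) hh))
    hq hab (hθ k) hτ Y).trans (ENNReal.ofReal_le_ofReal ?_)
  gcongr
  exact card_F_le hh

lemma measure_not_overlyOpt_le (hrun : S.IsRegressionRun μ 𝓗 R) (hS : S.Admissible)
    (hP : S.NumericRegime) (ht : t < S.T) (hh : h < S.M.H) (h𝒱 : ∀ V ∈ 𝒱, Measurable V)
    (hcard : 𝒱.card ≤ S.N * S.Nb ^ 2) :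
    μ {ω | ¬ ∀ V ∈ 𝒱, (∀ x, V x ∈ Set.Icc (0 : ℝ) 2) →
      NoiseBound (S.M.P h) (S.F h) (fun z y => S.M.r h z y + V y) 3 (3 / 2 * S.iotaDot ^ 2)
        (zs (R ω) t h) fun s => (R ω).x s (h + 1)} ≤ ENNReal.ofReal S.δth := by
  refine (hrun.measure_not_forall_noiseBound_le hS ht hh (a := 0)
    (q := fun V z y => S.M.r h z y + V y) three_pos
    (fun V hV => EpisodicMDP.measurable_return h (h𝒱 V hV))
    (fun V hV z y => ?_) _).trans
    (ENNReal.ofReal_le_ofReal (hP.card_mul_exp_neg_iotaDot_sq_le (card_mul_N_sq_le hP hcard)))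
  convert EpisodicMDP.return_mem_Icc hh hV z y using 2
  norm_num

lemma measure_not_secondMoment_le (hrun : S.IsRegressionRun μ 𝓗 R) (hS : S.Admissible)
    (hP : S.NumericRegime) (ht : t < S.T) (hh : h < S.M.H) (h𝒱 : ∀ V ∈ 𝒱, Measurable V)
    (hcard : 𝒱.card ≤ S.N * S.Nb ^ 2) :
    μ {ω | ¬ ∀ V ∈ 𝒱, (∀ x, V x ∈ Set.Icc (0 : ℝ) 1) →
      NoiseBound (S.M.P h) (S.F h) (fun z y => (S.M.r h z y + V y) ^ 2) 4
        (3 / 2 * S.iotaPrime ^ 2) (zs (R ω) t h) fun s => (R ω).x s (h + 1)} ≤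
      ENNReal.ofReal S.δth := by
  refine (hrun.measure_not_forall_noiseBound_le hS ht hh (a := 0)
    (q := fun V z y => (S.M.r h z y + V y) ^ 2) four_pos
    (fun V hV => (EpisodicMDP.measurable_return h (h𝒱 V hV)).pow_const 2)
    (fun V hV z y => ?_) _).trans
    (ENNReal.ofReal_le_ofReal (hP.card_mul_exp_neg_iotaPrime_sq_le (card_mul_N_sq_le hP hcard)))
  convert EpisodicMDP.return_sq_mem_Icc hh hV z y using 2
  norm_num

lemma measure_not_star_le [Nonempty A] (hrun : S.IsRegressionRun μ 𝓗 R) (hS : S.Admissible)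
    (hP : S.NumericRegime) (ht : t < S.T) (hh : h < S.M.H) :
    μ {ω | ¬ ∀ k ∈ Finset.range S.levels,
      WeightedNoiseBound (S.M.P h) (S.F h) (fun z y => S.M.r h z y + S.M.optV (h + 1) y) 2
        (S.scaleStar k) 1 (S.ups ^ 2) (sigs (R ω) t h) (zs (R ω) t h)
        fun s => (R ω).x s (h + 1)} ≤ ENNReal.ofReal S.δth := by
  refine (hrun.measure_not_forall_weightedNoiseBound_le hS ht hh (a := 0)
    (EpisodicMDP.measurable_return h (measurable_optV hS hh)) (fun z y => ?_)
    (scaleStar_pos hS hP) zero_le_one _).trans (ENNReal.ofReal_le_ofReal ?_)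
  · convert EpisodicMDP.return_mem_Icc hh (EpisodicMDP.optV_mem_Icc hS.sparse hh) z y using 2
    norm_num
  · rw [← hP.exp_neg_ups_sq, mul_left_comm, ← mul_assoc]
    gcongr
    exact levels_le_logFactor hP

lemma measure_not_diff_le [Nonempty A] (hrun : S.IsRegressionRun μ 𝓗 R) (hS : S.Admissible)
    (hP : S.NumericRegime) (ht : t < S.T) (hh : h < S.M.H) (h𝒱 : ∀ V ∈ 𝒱, Measurable V)
    (hcard : 𝒱.card ≤ S.N * S.Nb ^ 2) :
    μ {ω | ¬ ∀ V ∈ 𝒱, (∀ x, V x ∈ Set.Icc (0 : ℝ) 1) → ∀ k ∈ Finset.range S.levels,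
      WeightedNoiseBound (S.M.P h) (S.F h) (fun _ y => V y - S.M.optV (h + 1) y) 2
        (S.scaleDiff k) (1 / (2 * S.iota ^ 2)) (S.iota ^ 2 / 3) (sigs (R ω) t h) (zs (R ω) t h)
        fun s => (R ω).x s (h + 1)} ≤ ENNReal.ofReal S.δth := by
  refine (measure_not_forall_mem_le
    (c := S.levels * (S.N ^ 2 * Real.exp (-(S.iota ^ 2 / 3)))) fun V hV => ?_).trans
    (ENNReal.ofReal_le_ofReal ?_)
  · by_cases hV1 : ∀ x, V x ∈ Set.Icc (0 : ℝ) 1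
    · simp only [hV1, implies_true, forall_const]
      refine hrun.measure_not_forall_weightedNoiseBound_le hS ht hh (a := -1)
        (((h𝒱 V hV).sub (measurable_optV hS hh)).comp measurable_snd) (fun _ y => ?_)
        (scaleDiff_pos hS hP) (by positivity) _
      obtain ⟨V_nonneg, V_le⟩ := hV1 y
      obtain ⟨optV_nonneg, optV_le⟩ := EpisodicMDP.optV_mem_Icc hS.sparse hh y
      constructor <;> linarith
    · simp only [hV1, false_imp_iff, not_true_eq_false]
      exact (measure_empty (μ := μ)).trans_le zero_le
  · rw [hP.iota_sq, mul_div_right_comm, show (9 / 3 : ℝ) = 3 by norm_num]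
    calc _ = (𝒱.card * S.N ^ 2 * S.levels) * Real.exp
          (-(3 * Real.log ((S.N : ℝ) * S.Nb * S.logFactor / S.δth))) := by ring
      _ ≤ S.δth := hP.card_mul_exp_neg_le (m := S.levels)
          (mul_le_mul_of_nonneg_right (card_mul_N_sq_le hP hcard) (Nat.cast_nonneg _))
          (by linarith [hP.sixteen_le_logFactor]) (levels_le_logFactor hP)

lemma measure_not_concentration_le [Nonempty A] (hrun : S.IsRegressionRun μ 𝓗 R)
    (hS : S.Admissible) (hδ : S.δ < 1 / 5) (ht : t < S.T) (hh : h < S.M.H) :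
    μ {ω | ¬ S.Concentration (R ω) t h} ≤ ENNReal.ofReal (5 * S.δth) := by
  obtain ⟨ω₀⟩ : Nonempty Ω := μ.nonempty_of_neZero
  have hP := hS.numericRegime hδ (hrun.follows ω₀) ht hh
  have hN := one_le_N hS hh
  have hNb := one_le_Nb hS (hrun.follows ω₀) ht hh
  have le_sq : S.N * S.Nb ≤ S.N * S.Nb ^ 2 :=
    Nat.mul_le_mul_left _ (Nat.le_self_pow two_ne_zero _)
  have card1 := (card_class1_le hN hNb (h + 1)).trans le_sq
  exact measure_not_le_of_five
    (hrun.measure_not_overlyOpt_le hS hP ht hh (fun _ => measurable_of_mem_class2 hS)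
      (card_class2_le hN hNb (h + 1)))
    (hrun.measure_not_overlyOpt_le hS hP ht hh (fun _ => measurable_of_mem_classm2 hS)
      ((card_classm2_le hN hNb (h + 1)).trans le_sq))
    (hrun.measure_not_secondMoment_le hS hP ht hh (fun _ => measurable_of_mem_class1 hS) card1)
    (hrun.measure_not_star_le hS hP ht hh)
    (hrun.measure_not_diff_le hS hP ht hh (fun _ => measurable_of_mem_class1 hS) card1)
    fun _ => Concentration.mk

lemma measure_not_forall_concentration_le [Nonempty A] (hrun : S.IsRegressionRun μ 𝓗 R)
    (hS : S.Admissible) (hδ : S.δ < 1 / 5) :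
    μ {ω | ¬ ∀ t < S.T, ∀ h < S.M.H, S.Concentration (R ω) t h} ≤
      ENNReal.ofReal (5 * S.δ) := by
  have union_bound : μ {ω | ¬ ∀ p ∈ Finset.range S.T ×ˢ Finset.range S.M.H,
      S.Concentration (R ω) p.1 p.2} ≤ _ :=
    measure_not_forall_mem_le fun p hp => by
      rw [Finset.mem_product, Finset.mem_range, Finset.mem_range] at hp
      exact hrun.measure_not_concentration_le hS hδ hp.1 hp.2
  refine (measure_mono <| Set.ofPred_subset_ofPred.2 fun ω hω hall => hω fun t ht h hh =>
    hall (t, h) (by simp [ht, hh])).trans (union_bound.trans (ENNReal.ofReal_le_ofReal ?_))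
  have hδ0 := hS.δ_pos
  rw [Finset.card_product, Finset.card_range, Finset.card_range, δth, Nat.cast_mul]
  calc (S.T * S.M.H : ℝ) * (5 * (S.δ / ((S.T + 1) * (S.M.H + 1))))
      = (S.T * S.M.H) / ((S.T + 1) * (S.M.H + 1)) * (5 * S.δ) := by ring
    _ ≤ 1 * (5 * S.δ) := by
        gcongr
        rw [div_le_one (by positivity)]
        gcongr <;> linarith
    _ = 5 * S.δ := one_mul _

end IsRegressionRun

end Setup

end VOQL

namespace VOQL

open MeasureTheory ProbabilityTheory

lemma abs_sub_le_eluderD_mul {Z : Type*} {F : Finset (Z → ℝ)} {lam : ℝ} (hlam : 0 < lam) {n : ℕ}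
    (σ : Fin n → ℝ) (zs : Fin n → Z) {f g : Z → ℝ} (hf : f ∈ F) (hg : g ∈ F) (z : Z) :
    |f z - g z| ≤
      eluderD F lam σ zs z * √(∑ i, (f (zs i) - g (zs i)) ^ 2 / σ i ^ 2 + lam) := by
  have distance_pos : 0 < ∑ i, (f (zs i) - g (zs i)) ^ 2 / σ i ^ 2 + lam := by positivity
  have ratio_le : (f z - g z) ^ 2 / (∑ i, (f (zs i) - g (zs i)) ^ 2 / σ i ^ 2 + lam) ≤
      ⨆ p : F × F, (p.1.1 z - p.2.1 z) ^ 2 /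
        (∑ i, (p.1.1 (zs i) - p.2.1 (zs i)) ^ 2 / σ i ^ 2 + lam) :=
    le_ciSup (f := fun p : F × F => (p.1.1 z - p.2.1 z) ^ 2 /
        (∑ i, (p.1.1 (zs i) - p.2.1 (zs i)) ^ 2 / σ i ^ 2 + lam))
      (Set.finite_range _).bddAbove (⟨f, hf⟩, ⟨g, hg⟩)
  rw [eluderD, ← Real.sqrt_mul ((by positivity : (0 : ℝ) ≤ _).trans ratio_le),
    ← Real.sqrt_sq_eq_abs]
  exact Real.sqrt_le_sqrt ((div_le_iff₀ distance_pos).1 ratio_le)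

lemma abs_sub_le_of_mem_confSet {Z : Type*} {F : Finset (Z → ℝ)} {lam : ℝ} (hlam : 0 < lam) {n : ℕ}
    {σ : Fin n → ℝ} {zs : Fin n → Z} {f g : Z → ℝ} {β : ℝ} (hg : g ∈ F)
    (hf : f ∈ confSet F σ zs g β) (z : Z) :
    |f z - g z| ≤ eluderD F lam σ zs z * √(β ^ 2 + lam) :=
  (abs_sub_le_eluderD_mul hlam σ zs hf.1 hg z).trans
    (mul_le_mul_of_nonneg_left (Real.sqrt_le_sqrt (by linarith [hf.2])) (Real.sqrt_nonneg _))

lemma variance_le_integral_of_mem_Icc {Ω : Type*} [MeasurableSpace Ω] {μ : Measure Ω}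
    [IsProbabilityMeasure μ] {Y : Ω → ℝ} (hYm : Measurable Y)
    (hY : ∀ ω, Y ω ∈ Set.Icc (0 : ℝ) 1) : Var[Y; μ] ≤ ∫ ω, Y ω ∂μ := by
  have bhatia_davis := variance_le_sub_mul_sub (μ := μ) (.of_forall hY) hYm.aemeasurable
  nlinarith [sq_nonneg (∫ ω, Y ω ∂μ)]

lemma mem_Icc_zero_two_of_mem_Icc_zero_one {X : Type*} {V : X → ℝ}
    (hV : ∀ x, V x ∈ Set.Icc (0 : ℝ) 1) (x : X) : V x ∈ Set.Icc (0 : ℝ) 2 :=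
  Set.Icc_subset_Icc_right one_le_two (hV x)

namespace Setup

variable {X A : Type*} [MeasurableSpace X] [MeasurableSpace A] {S : Setup X A} {R : RunData X A}
  {s t h : ℕ}

/-! ### Optimism and pessimism -/

lemma le_beta2_sq (hS : S.Admissible) (t : ℕ) :
    2 * 3 ^ 2 * (3 / 2 * S.iotaDot ^ 2) + 4 * (t * S.L * S.eps) ≤ S.beta2 t ^ 2 := by
  have hL := hS.one_le_L
  have heps := hS.eps_nonneg
  rw [beta2, Real.sq_sqrt (by positivity)]
  nlinarith [mul_nonneg (sub_nonneg.2 hL) (sq_nonneg S.iotaDot), sq_nonneg S.iotaDot,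
    (by positivity : 0 ≤ S.L * S.eps), (by positivity : 0 ≤ t * (S.L * S.eps))]

lemma le_betaBar_sq (hS : S.Admissible) (t : ℕ) :
    2 * 4 ^ 2 * (3 / 2 * S.iotaPrime ^ 2) + 4 * (t * S.L * S.eps) ≤ S.betaBar t ^ 2 := by
  have hL := hS.one_le_L
  have heps := hS.eps_nonneg
  rw [betaBar, Real.sq_sqrt (by positivity)]
  nlinarith [mul_nonneg (sub_nonneg.2 hL) (sq_nonneg S.iotaPrime), sq_nonneg S.iotaPrime,
    (by positivity : 0 ≤ S.L * S.eps), (by positivity : 0 ≤ t * (S.L * S.eps))]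

lemma approximants_subset_conf2 [Nonempty A] (hS : S.Admissible) (hR : S.FollowsRegressions R)
    (ht : t < S.T) (hh : h < S.M.H) (hconc : S.Concentration R t h) :
    S.approximants h (S.M.bellman h (maxA (S.f2 R t (h + 1)))) ⊆ S.conf2 R t h := fun _ hf =>
  ⟨hf.1, ((hR.fhat2_ls t ht h hh).sum_sq_sub_le_of_noiseBound (κ := S.M.P h)
    (q := fun z y => S.M.r h z y + maxA (S.f2 R t (h + 1)) y) (x' := fun s => R.x s (h + 1))
    (hS.complete.range h hh) hf.1 hf.2
    (hconc.overlyOpt _ (maxA_f2_mem_class2 hS hR ht _) (maxA_f2_mem_Icc hS hR ht _))).trans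
    (le_beta2_sq hS t)⟩

lemma approximants_subset_confG [Nonempty A] (hS : S.Admissible) (hR : S.FollowsRegressions R)
    (ht : t < S.T) (hh : h < S.M.H) (hconc : S.Concentration R t h) :
    S.approximants h (S.M.bellman₂ h (maxA (S.f1 R t (h + 1)))) ⊆ S.confG R t h := fun _ hf =>
  ⟨hf.1, ((hR.ghat_ls t ht h hh).sum_sq_sub_le_of_noiseBound (κ := S.M.P h)
    (q := fun z y => (S.M.r h z y + maxA (S.f1 R t (h + 1)) y) ^ 2) (x' := fun s => R.x s (h + 1))
    (hS.complete.range h hh) hf.1 hf.2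
    (hconc.secondMoment _ (maxA_f1_mem_class1 hS hR ht _) (maxA_f1_mem_Icc hS hR ht _))).trans
    (le_betaBar_sq hS t)⟩

lemma approximants_subset_confm2 (hS : S.Admissible) (hR : S.FollowsRegressions R) (ht : t < S.T)
    (hh : h < S.M.H) (hconc : S.Concentration R t h)
    (hb : ∀ x, maxA (S.fm2 R t (h + 1)) x ∈ Set.Icc (0 : ℝ) 2) :
    S.approximants h (S.M.bellman h (maxA (S.fm2 R t (h + 1)))) ⊆ S.confm2 R t h := fun _ hf =>
  ⟨hf.1, ((hR.fhatm2_ls t ht h hh).sum_sq_sub_le_of_noiseBound (κ := S.M.P h)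
    (q := fun z y => S.M.r h z y + maxA (S.fm2 R t (h + 1)) y) (x' := fun s => R.x s (h + 1))
    (hS.complete.range h hh) hf.1 hf.2
    (hconc.overlyPess _ (maxA_fm2_mem_classm2 hS hR ht _) hb)).trans (le_beta2_sq hS t)⟩

lemma approximants_nonempty (hS : S.Admissible) (hh : h < S.M.H) {V : X → ℝ} (hVm : Measurable V)
    (hV : ∀ x, V x ∈ Set.Icc (0 : ℝ) 2) : (S.approximants h (S.M.bellman h V)).Nonempty :=
  hS.complete.first h hh V hVm hV

lemma approximants_nonempty₂ (hS : S.Admissible) (hh : h < S.M.H) {V : X → ℝ} (hVm : Measurable V)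
    (hV : ∀ x, V x ∈ Set.Icc (0 : ℝ) 1) : (S.approximants h (S.M.bellman₂ h V)).Nonempty :=
  hS.complete.second h hh V hVm hV

lemma fm2_le_bellman (hS : S.Admissible) (hR : S.FollowsRegressions R) (ht : t < S.T)
    (hh : h < S.M.H) (hconc : S.Concentration R t h)
    (hb : ∀ x, maxA (S.fm2 R t (h + 1)) x ∈ Set.Icc (0 : ℝ) 2) (z : X × A) :
    S.fm2 R t h z ≤ S.M.bellman h (maxA (S.fm2 R t (h + 1))) z := by
  have hm := measurable_maxA_fm2 hS hR ht (h + 1)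
  obtain ⟨f, hf⟩ := approximants_nonempty hS hh hm hb
  have near_fhatm2 := abs_le.1 (abs_sub_le_b2_of_mem_confm2 hS hR ht hh
    (approximants_subset_confm2 hS hR ht hh hconc hb hf) z)
  have near_bellman := abs_le.1 (hf.2 z)
  rw [fm2, if_pos hh]
  refine max_le ?_ (EpisodicMDP.bellman_mem_Icc hh hm hb z).1
  linarith

lemma maxA_fm2_mem_Icc_of_le_optQ [Nonempty A] (hS : S.Admissible) (hh : h ≤ S.M.H)
    (hle : ∀ z, S.fm2 R t h z ≤ S.M.optQ h z) (x : X) :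
    maxA (S.fm2 R t h) x ∈ Set.Icc (0 : ℝ) 1 :=
  maxA_mem_Icc (fun z =>
    ⟨fm2_nonneg t _ z, (hle z).trans (EpisodicMDP.optQ_mem_Icc hS.sparse hh z).2⟩) x

lemma bellman_fm2_le_optQ_of_succ [Nonempty A] (hS : S.Admissible) (hR : S.FollowsRegressions R)
    (ht : t < S.T) (hh : h < S.M.H) (hle : ∀ z, S.fm2 R t (h + 1) z ≤ S.M.optQ (h + 1) z)
    (z : X × A) : S.M.bellman h (maxA (S.fm2 R t (h + 1))) z ≤ S.M.optQ h z := by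
  rw [EpisodicMDP.optQ_eq_bellman hh]
  exact EpisodicMDP.bellman_mono hh (measurable_maxA_fm2 hS hR ht _) (measurable_optV hS hh)
    (maxA_fm2_mem_Icc_of_le_optQ hS hh hle) (EpisodicMDP.optV_mem_Icc hS.sparse hh)
    (maxA_mono hle fun z => (EpisodicMDP.optQ_mem_Icc hS.sparse hh z).2) z

lemma fm2_le_optQ [Nonempty A] (hS : S.Admissible) (hR : S.FollowsRegressions R) (ht : t < S.T)
    (hconc : ∀ h < S.M.H, S.Concentration R t h) (hh : h ≤ S.M.H) (z : X × A) :
    S.fm2 R t h z ≤ S.M.optQ h z := by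
  induction hh using Nat.decreasingInduction generalizing z with
  | self => simp [fm2, EpisodicMDP.optQ_terminal]
  | of_succ h hh ih =>
    have hb := mem_Icc_zero_two_of_mem_Icc_zero_one (maxA_fm2_mem_Icc_of_le_optQ hS hh ih)
    exact (fm2_le_bellman hS hR ht hh (hconc h hh) hb z).trans
      (bellman_fm2_le_optQ_of_succ hS hR ht hh ih z)

lemma maxA_fm2_mem_Icc [Nonempty A] (hS : S.Admissible) (hR : S.FollowsRegressions R) (ht : t < S.T)
    (hconc : ∀ h < S.M.H, S.Concentration R t h) (hh : h ≤ S.M.H) (x : X) :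
    maxA (S.fm2 R t h) x ∈ Set.Icc (0 : ℝ) 1 :=
  maxA_fm2_mem_Icc_of_le_optQ hS hh (fm2_le_optQ hS hR ht hconc hh) x

lemma min_bellman_f2_add_le_f2 [Nonempty A] (hS : S.Admissible) (hR : S.FollowsRegressions R)
    (ht : t < S.T) (hh : h < S.M.H) (hconc : S.Concentration R t h) (z : X × A) :
    min (S.M.bellman h (maxA (S.f2 R t (h + 1))) z + 2 * S.b1 R t h z + 2 * S.eps) 2 ≤
      S.f2 R t h z := by
  obtain ⟨f, hf⟩ := approximants_nonempty hS hh (measurable_maxA_f2 hS hR ht (h + 1))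
    (maxA_f2_mem_Icc hS hR ht (h + 1))
  have near_fhat2 := abs_le.1 (abs_sub_le_b2 hS hR ht hh
    (approximants_subset_conf2 hS hR ht hh hconc hf) z)
  have near_bellman := abs_le.1 (hf.2 z)
  have f2_eq : S.f2 R t h z =
      min (R.fhat2 t h z + 2 * S.b1 R t h z + S.b2 R t h z + 3 * S.eps) 2 := by
    rw [f2, if_pos hh, overlyOptimistic]
  rw [f2_eq]
  refine min_le_min ?_ le_rfl
  linarith

lemma optQ_le_bellman_f1 [Nonempty A] (hS : S.Admissible) (hR : S.FollowsRegressions R)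
    (ht : t < S.T) (hh : h < S.M.H) (hopt : ∀ z, S.M.optQ (h + 1) z ≤ S.f1 R t (h + 1) z)
    (z : X × A) : S.M.optQ h z ≤ S.M.bellman h (maxA (S.f1 R t (h + 1))) z := by
  rw [EpisodicMDP.optQ_eq_bellman hh]
  exact EpisodicMDP.bellman_mono hh (measurable_optV hS hh) (measurable_maxA_f1 hS hR ht _)
    (EpisodicMDP.optV_mem_Icc hS.sparse hh) (maxA_f1_mem_Icc hS hR ht _)
    (maxA_mono hopt fun z => (f1_mem_Icc hS hR ht _ z).2) z

lemma bellman_f1_le_bellman_f2 [Nonempty A] (hS : S.Admissible) (hR : S.FollowsRegressions R)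
    (hs : s < S.T) (ht : t < S.T) (hh : h < S.M.H)
    (hle : ∀ z, S.f1 R t (h + 1) z ≤ S.f2 R s (h + 1) z) (z : X × A) :
    S.M.bellman h (maxA (S.f1 R t (h + 1))) z ≤ S.M.bellman h (maxA (S.f2 R s (h + 1))) z :=
  EpisodicMDP.bellman_mono hh (measurable_maxA_f1 hS hR ht _) (measurable_maxA_f2 hS hR hs _)
    (maxA_f1_mem_Icc hS hR ht _) (maxA_f2_mem_Icc hS hR hs _)
    (maxA_mono hle fun z => (f2_mem_Icc hS hR hs _ z).2) z

lemma abs_bellman_f1_sub_fhat1_le [Nonempty A] (hS : S.Admissible) (hR : S.FollowsRegressions R)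
    (ht : t < S.T) (hh : h < S.M.H)
    (hsub : S.approximants h (S.M.bellman h (maxA (S.f1 R t (h + 1)))) ⊆ S.conf1 R t h)
    (z : X × A) :
    |S.M.bellman h (maxA (S.f1 R t (h + 1))) z - R.fhat1 t h z| ≤ S.b1 R t h z + S.eps := by
  obtain ⟨f, hf⟩ := approximants_nonempty hS hh (measurable_maxA_f1 hS hR ht (h + 1))
    (mem_Icc_zero_two_of_mem_Icc_zero_one (maxA_f1_mem_Icc hS hR ht (h + 1)))
  have near_fhat1 := abs_sub_le_b1 hS hR ht hh (hsub hf) z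
  have near_bellman := hf.2 z
  rw [abs_sub_comm] at near_bellman
  linarith [abs_sub_le (S.M.bellman h (maxA (S.f1 R t (h + 1))) z) (f z) (R.fhat1 t h z)]

lemma optQ_le_f1_of_succ [Nonempty A] (hS : S.Admissible) (hR : S.FollowsRegressions R)
    (ht : t < S.T) (hh : h < S.M.H)
    (hsub : S.approximants h (S.M.bellman h (maxA (S.f1 R t (h + 1)))) ⊆ S.conf1 R t h)
    (hopt : ∀ z, S.M.optQ (h + 1) z ≤ S.f1 R t (h + 1) z) (z : X × A) :
    S.M.optQ h z ≤ S.f1 R t h z := by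
  have near_fhat1 := abs_le.1 (abs_bellman_f1_sub_fhat1_le hS hR ht hh hsub z)
  have optQ_le := optQ_le_bellman_f1 hS hR ht hh hopt z
  rw [f1, if_pos hh]
  refine le_min ?_ (EpisodicMDP.optQ_mem_Icc hS.sparse hh.le z).2
  linarith

lemma f1_le_f2_of_succ [Nonempty A] (hS : S.Admissible) (hR : S.FollowsRegressions R) (hst : s ≤ t)
    (ht : t < S.T) (hh : h < S.M.H) (hconc : S.Concentration R s h)
    (hsub : S.approximants h (S.M.bellman h (maxA (S.f1 R t (h + 1)))) ⊆ S.conf1 R t h)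
    (hle : ∀ z, S.f1 R t (h + 1) z ≤ S.f2 R s (h + 1) z) (z : X × A) :
    S.f1 R t h z ≤ S.f2 R s h z := by
  have hs := hst.trans_lt ht
  have near_fhat1 := abs_le.1 (abs_bellman_f1_sub_fhat1_le hS hR ht hh hsub z)
  have bellman_le := bellman_f1_le_bellman_f2 hS hR hs ht hh hle z
  have b1_le := b1_antitone hS hR hst ht hh z
  refine le_trans ?_ (min_bellman_f2_add_le_f2 hS hR hs hh hconc z)
  rw [f1, if_pos hh]
  refine min_le_min ?_ one_le_two
  linarith

/-! ### The weights control the conditional variances -/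

lemma sqrt_sigmaSq_le_sigBar (hR : S.FollowsRegressions R) (hs : s < S.T) (hh : h < S.M.H) :
    √(S.sigmaSq R s h) ≤ R.sigBar s h := by
  rw [hR.sigBar_eq s hs h hh]
  exact (le_max_left _ _).trans (le_max_left _ _)

lemma iota_nonneg : 0 ≤ S.iota :=
  mul_nonneg zero_le_three (Real.sqrt_nonneg _)

lemma two_mul_iota_sq_mul_gap_le_sigBar_sq (hR : S.FollowsRegressions R) (hs : s < S.T)
    (hh : h < S.M.H) :
    2 * S.iota ^ 2 * (S.f2 R s h (z R s h) - S.fm2 R s h (z R s h)) ≤ R.sigBar s h ^ 2 := by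
  rcases le_total (S.f2 R s h (z R s h) - S.fm2 R s h (z R s h)) 0 with gap_nonpos | gap_nonneg
  · exact (mul_nonpos_of_nonneg_of_nonpos (by positivity) gap_nonpos).trans (sq_nonneg _)
  · have le_sigBar :
        √2 * S.iota * √(S.f2 R s h (z R s h) - S.fm2 R s h (z R s h)) ≤ R.sigBar s h := by
      rw [hR.sigBar_eq s hs h hh]
      exact (le_max_left _ _).trans (le_max_right _ _)
    have iota_nonneg := iota_nonneg (S := S)
    have squared := pow_le_pow_left₀ (by positivity) le_sigBar 2
    rwa [mul_pow, mul_pow, Real.sq_sqrt gap_nonneg, Real.sq_sqrt zero_le_two] at squared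

lemma four_mul_eluderD_le_sigBar_sq (hR : S.FollowsRegressions R) (hs : s < S.T) (hh : h < S.M.H) :
    4 * (S.ups + S.iota ^ 2) * eluderD (S.F h) S.lam (sigs R s h) (zs R s h) (z R s h) ≤
      R.sigBar s h ^ 2 := by
  set D := eluderD (S.F h) S.lam (sigs R s h) (zs R s h) (z R s h)
  have D_nonneg : 0 ≤ D := Real.sqrt_nonneg _
  have ups_nonneg : 0 ≤ S.ups := Real.sqrt_nonneg _
  have iota_nonneg := iota_nonneg (S := S)
  have le_sigBar : 2 * (√S.ups + S.iota) * √D ≤ R.sigBar s h := by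
    rw [hR.sigBar_eq s hs h hh]
    exact (le_max_right _ _).trans (le_max_right _ _)
  calc 4 * (S.ups + S.iota ^ 2) * D ≤ (2 * (√S.ups + S.iota)) ^ 2 * D := by
        gcongr
        nlinarith [Real.sq_sqrt ups_nonneg, mul_nonneg (Real.sqrt_nonneg S.ups) iota_nonneg]
    _ = (2 * (√S.ups + S.iota) * √D) ^ 2 := by rw [mul_pow _ (√D), Real.sq_sqrt D_nonneg]
    _ ≤ R.sigBar s h ^ 2 := pow_le_pow_left₀ (by positivity) le_sigBar 2

lemma bellman₂_optV_le [Nonempty A] (hS : S.Admissible) (hR : S.FollowsRegressions R)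
    (hs : s < S.T) (hh : h < S.M.H) (hconc : S.Concentration R s h)
    (hopt : ∀ z, S.M.optQ (h + 1) z ≤ S.f1 R s (h + 1) z) (z : X × A) :
    S.M.bellman₂ h (S.M.optV (h + 1)) z ≤ R.ghat s h z +
      eluderD (S.F h) S.lam (fun _ => 1) (zs R s h) z * √(S.betaBar s ^ 2 + S.lam) + S.eps := by
  have hm := measurable_maxA_f1 hS hR hs (h + 1)
  have hb := maxA_f1_mem_Icc hS hR hs (h + 1)
  obtain ⟨ψ, hψ⟩ := approximants_nonempty₂ hS hh hm hb
  have bellman₂_le : S.M.bellman₂ h (S.M.optV (h + 1)) z ≤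
      S.M.bellman₂ h (maxA (S.f1 R s (h + 1))) z :=
    EpisodicMDP.bellman₂_mono hh (measurable_optV hS hh) hm
      (EpisodicMDP.optV_mem_Icc hS.sparse hh) hb
      (maxA_mono hopt fun z => (f1_mem_Icc hS hR hs _ z).2) z
  have near_ghat := abs_le.1 (abs_sub_le_of_mem_confSet hS.lam_pos (hR.ghat_ls s hs h hh).1
    (approximants_subset_confG hS hR hs hh hconc hψ) z)
  have near_bellman₂ := abs_le.1 (hψ.2 z)
  linarith

lemma fhatm2_sub_optQ_le [Nonempty A] (hS : S.Admissible) (hR : S.FollowsRegressions R)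
    (hs : s < S.T) (hh : h < S.M.H) (hconc : ∀ h < S.M.H, S.Concentration R s h) (z : X × A) :
    R.fhatm2 s h z - S.M.optQ h z ≤
      eluderD (S.F h) S.lam (fun _ => 1) (zs R s h) z * √(S.beta2 s ^ 2 + S.lam) + S.eps := by
  have hb := mem_Icc_zero_two_of_mem_Icc_zero_one
    (maxA_fm2_mem_Icc hS hR hs hconc (h := h + 1) hh)
  obtain ⟨f, hf⟩ := approximants_nonempty hS hh (measurable_maxA_fm2 hS hR hs (h + 1)) hb
  have near_fhatm2 := abs_le.1 (abs_sub_le_of_mem_confSet hS.lam_pos (hR.fhatm2_ls s hs h hh).1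
    (approximants_subset_confm2 hS hR hs hh (hconc h hh) hb hf) z)
  have near_bellman := abs_le.1 (hf.2 z)
  have bellman_le := bellman_fm2_le_optQ_of_succ hS hR hs hh
    (fm2_le_optQ hS hR hs hconc hh) z
  linarith

lemma fhatm2_sq_sub_optQ_sq_le [Nonempty A] (hS : S.Admissible) (hR : S.FollowsRegressions R)
    (hs : s < S.T) (hh : h < S.M.H) (hconc : ∀ h < S.M.H, S.Concentration R s h) (z : X × A) :
    R.fhatm2 s h z ^ 2 - S.M.optQ h z ^ 2 ≤ 2 * S.L *
      (eluderD (S.F h) S.lam (fun _ => 1) (zs R s h) z * √(S.beta2 s ^ 2 + S.lam) + S.eps) := by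
  obtain ⟨fhatm2_nonneg, fhatm2_le⟩ := hS.complete.range h hh _ (hR.fhatm2_ls s hs h hh).1 z
  obtain ⟨optQ_nonneg, optQ_le⟩ := EpisodicMDP.optQ_mem_Icc hS.sparse hh.le z
  have sub_le := fhatm2_sub_optQ_le hS hR hs hh hconc z
  set E := eluderD (S.F h) S.lam (fun _ => 1) (zs R s h) z * √(S.beta2 s ^ 2 + S.lam) + S.eps
  have E_nonneg : 0 ≤ E :=
    add_nonneg (mul_nonneg (Real.sqrt_nonneg _) (Real.sqrt_nonneg _)) hS.eps_nonneg
  calc R.fhatm2 s h z ^ 2 - S.M.optQ h z ^ 2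
      = (R.fhatm2 s h z + S.M.optQ h z) * (R.fhatm2 s h z - S.M.optQ h z) := sq_sub_sq _ _
    _ ≤ (R.fhatm2 s h z + S.M.optQ h z) * E := by gcongr
    _ ≤ 2 * S.L * E := by
        gcongr
        linarith [hS.one_le_L]

lemma variance_optV_le_sigmaSq [Nonempty A] (hS : S.Admissible) (hR : S.FollowsRegressions R)
    (hs : s < S.T) (hh : h < S.M.H) (hconc : ∀ h < S.M.H, S.Concentration R s h)
    (hopt : ∀ z, S.M.optQ (h + 1) z ≤ S.f1 R s (h + 1) z) :
    Var[fun y => S.M.r h (z R s h) y + S.M.optV (h + 1) y; S.M.P h (z R s h)] ≤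
      S.sigmaSq R s h := by
  have hVm := measurable_optV hS (h := h + 1) hh
  have hVb := EpisodicMDP.optV_mem_Icc hS.sparse (h := h + 1) hh
  rw [EpisodicMDP.variance_return hh hVm hVb, ← EpisodicMDP.optQ_eq_bellman hh]
  have le_four : S.M.bellman₂ h (S.M.optV (h + 1)) (z R s h) - S.M.optQ h (z R s h) ^ 2 ≤ 4 := by
    linarith [(EpisodicMDP.bellman₂_mem_Icc hh hVm hVb (z R s h)).2,
      sq_nonneg (S.M.optQ h (z R s h))]
  rw [sigmaSq]
  split_ifs with hs0
  · exact le_four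
  refine le_min le_four ?_
  have second_moment_le := bellman₂_optV_le hS hR hs hh (hconc h hh) hopt (z R s h)
  have squares_le := fhatm2_sq_sub_optQ_sq_le hS hR hs hh hconc (z R s h)
  linarith [hS.eps_nonneg]

lemma variance_optV_le_sigBar_sq [Nonempty A] (hS : S.Admissible) (hR : S.FollowsRegressions R)
    (hs : s < S.T) (hh : h < S.M.H) (hconc : ∀ h < S.M.H, S.Concentration R s h)
    (hopt : ∀ z, S.M.optQ (h + 1) z ≤ S.f1 R s (h + 1) z) :
    Var[fun y => S.M.r h (z R s h) y + S.M.optV (h + 1) y; S.M.P h (z R s h)] ≤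
      R.sigBar s h ^ 2 := by
  have variance_le := variance_optV_le_sigmaSq hS hR hs hh hconc hopt
  calc _ ≤ S.sigmaSq R s h := variance_le
    _ = √(S.sigmaSq R s h) ^ 2 := (Real.sq_sqrt ((variance_nonneg _ _).trans variance_le)).symm
    _ ≤ R.sigBar s h ^ 2 :=
        pow_le_pow_left₀ (Real.sqrt_nonneg _) (sqrt_sigmaSq_le_sigBar hR hs hh) 2

lemma integral_f1_sub_optV_le_gap [Nonempty A] (hS : S.Admissible) (hR : S.FollowsRegressions R)
    (hs : s < S.T) (ht : t < S.T) (hh : h < S.M.H) (hconc : ∀ h < S.M.H, S.Concentration R s h)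
    (hle : ∀ z, S.f1 R t (h + 1) z ≤ S.f2 R s (h + 1) z) (z : X × A) :
    ∫ y, (maxA (S.f1 R t (h + 1)) y - S.M.optV (h + 1) y) ∂(S.M.P h z) ≤
      S.f2 R s h z - S.fm2 R s h z := by
  have hVm := measurable_optV hS (h := h + 1) hh
  have hVb := EpisodicMDP.optV_mem_Icc hS.sparse (h := h + 1) hh
  have hm := measurable_maxA_f1 hS hR ht (h + 1)
  have hb := maxA_f1_mem_Icc hS hR ht (h + 1)
  have integral_eq : ∫ y, (maxA (S.f1 R t (h + 1)) y - S.M.optV (h + 1) y) ∂(S.M.P h z) =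
      S.M.bellman h (maxA (S.f1 R t (h + 1))) z - S.M.optQ h z := by
    rw [EpisodicMDP.optQ_eq_bellman hh, EpisodicMDP.bellman, EpisodicMDP.bellman,
      ← integral_sub (EpisodicMDP.integrable_return hh hm hb z)
        (EpisodicMDP.integrable_return hh hVm hVb z)]
    simp only [add_sub_add_left_eq_sub]
  have sub_mem : ∀ y, maxA (S.f1 R t (h + 1)) y - S.M.optV (h + 1) y ∈ Set.Icc (-1 : ℝ) 1 :=
    fun y => ⟨by linarith [(hb y).1, (hVb y).2], by linarith [(hb y).2, (hVb y).1]⟩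
  have integral_le_one := (integral_mem_Icc (ν := S.M.P h z) (hm.sub hVm) sub_mem).2
  simp only [Pi.sub_apply] at integral_le_one
  have fm2_le := fm2_le_optQ hS hR hs hconc hh.le z
  have optQ_le_one := (EpisodicMDP.optQ_mem_Icc hS.sparse hh.le z).2
  have bellman_le := bellman_f1_le_bellman_f2 hS hR hs ht hh hle z
  rcases min_le_iff.1 (min_bellman_f2_add_le_f2 hS hR hs hh (hconc h hh) z) with
    untruncated | truncated
  · linarith [hS.eps_nonneg, b1_nonneg hS hR hs hh z]
  · linarith

lemma variance_f1_sub_optV_le_sigBar_sq [Nonempty A] (hS : S.Admissible)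
    (hR : S.FollowsRegressions R) (hι : 0 < S.iota) (hs : s < S.T) (ht : t < S.T) (hh : h < S.M.H)
    (hconc : ∀ h < S.M.H, S.Concentration R s h)
    (hopt : ∀ z, S.M.optQ (h + 1) z ≤ S.f1 R t (h + 1) z)
    (hle : ∀ z, S.f1 R t (h + 1) z ≤ S.f2 R s (h + 1) z) :
    Var[fun y => maxA (S.f1 R t (h + 1)) y - S.M.optV (h + 1) y; S.M.P h (z R s h)] ≤
      1 / (2 * S.iota ^ 2) * R.sigBar s h ^ 2 := by
  have hb := maxA_f1_mem_Icc hS hR ht (h + 1)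
  have hVb := EpisodicMDP.optV_mem_Icc hS.sparse (h := h + 1) hh
  have optV_le : ∀ y, S.M.optV (h + 1) y ≤ maxA (S.f1 R t (h + 1)) y :=
    maxA_mono hopt fun z => (f1_mem_Icc hS hR ht _ z).2
  have sub_mem : ∀ y, maxA (S.f1 R t (h + 1)) y - S.M.optV (h + 1) y ∈ Set.Icc (0 : ℝ) 1 :=
    fun y => ⟨sub_nonneg.2 (optV_le y), by linarith [(hb y).2, (hVb y).1]⟩
  have variance_le := variance_le_integral_of_mem_Icc (μ := S.M.P h (z R s h))
    ((measurable_maxA_f1 hS hR ht (h + 1)).sub (measurable_optV hS (h := h + 1) hh)) sub_mem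
  have gap_le := two_mul_iota_sq_mul_gap_le_sigBar_sq hR hs hh
  rw [one_div, inv_mul_eq_div, le_div_iff₀' (by positivity)]
  exact (mul_le_mul_of_nonneg_left
    (variance_le.trans (integral_f1_sub_optV_le_gap hS hR hs ht hh hconc hle _))
    (by positivity)).trans gap_le

end Setup

end VOQL

namespace VOQL

open MeasureTheory ProbabilityTheory

/-! ### The confidence sets of the weighted regression -/

lemma scale_mul_add_div_scale_le {c τ Y ρ D : ℝ} (hc : 0 < c) (hτ : 0 ≤ τ) (hρ : 0 < ρ)
    (hD : D ≤ ρ ^ 2) : c / ρ * τ * D + Y / (c / ρ) ≤ (c * τ + Y / c) * ρ := by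
  calc c / ρ * τ * D + Y / (c / ρ) ≤ c / ρ * τ * ρ ^ 2 + Y / (c / ρ) := by gcongr
    _ = (c * τ + Y / c) * ρ := by field_simp

lemma le_radius_sq_of_self_bound {Q υ lam E : ℝ} (hυ : 2 ≤ υ) (hlam : 0 ≤ lam) (hE : 0 ≤ E)
    (hself : 1 ≤ Q → Q ≤ 5 * υ * √(2 * Q + lam) + 2 * E) :
    Q ≤ (√(6 * √lam + 156) * υ + √(8 * E)) ^ 2 := by
  by_contra! radius_sq_lt
  set l := √lam
  set K := 6 * l + 156 with hK
  have l_nonneg : 0 ≤ l := Real.sqrt_nonneg _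
  have l_sq : l ^ 2 = lam := Real.sq_sqrt hlam
  have υ_sq : 4 ≤ υ ^ 2 := by nlinarith
  have sum_sq_lt : K * υ ^ 2 + 8 * E < Q := by
    have cross_nonneg : 0 ≤ √K * υ * √(8 * E) := by positivity
    rw [add_sq, mul_pow, Real.sq_sqrt (by positivity), Real.sq_sqrt (by positivity)]
      at radius_sq_lt
    linarith
  have K_mul_lt : K * υ ^ 2 < Q := by linarith
  have four_K_le : 4 * K ≤ Q := by nlinarith
  have main_part_le : 3 / 4 * Q ≤ 5 * υ * √(2 * Q + lam) := by
    have K_mul_nonneg : 0 ≤ K * υ ^ 2 := by positivity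
    linarith [hself (by linarith)]
  have squared : (3 / 4 * Q) ^ 2 ≤ υ ^ 2 * (25 * (2 * Q + l ^ 2)) := by
    calc (3 / 4 * Q) ^ 2 ≤ (5 * υ * √(2 * Q + lam)) ^ 2 :=
          pow_le_pow_left₀ (by linarith) main_part_le 2
      _ = υ ^ 2 * (25 * (2 * Q + l ^ 2)) := by
          rw [mul_pow, Real.sq_sqrt (by linarith), l_sq]
          ring
  have without_υ : 9 / 16 * K * Q ≤ 25 * (2 * Q + l ^ 2) := by
    refine le_of_mul_le_mul_left ?_ (by linarith : 0 < υ ^ 2)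
    nlinarith [mul_le_mul_of_nonneg_right K_mul_lt.le (by linarith : 0 ≤ Q)]
  nlinarith [mul_le_mul_of_nonneg_left four_K_le (by linarith : 0 ≤ 9 / 16 * K - 50)]

namespace Setup

variable {X A : Type*} {R : RunData X A} {s t h k : ℕ} {f g : X × A → ℝ}

/-- The squared distance of `f` and `g` on the data of the episodes before `t`, weighted as in the
regression for `f_{t,1}^h`. -/
noncomputable def weightedSqDist (R : RunData X A) (t h : ℕ) (f g : X × A → ℝ) : ℝ :=
  ∑ i, (f (zs R t h i) - g (zs R t h i)) ^ 2 / sigs R t h i ^ 2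

lemma weightedSqDist_eq_sum_range : weightedSqDist R t h f g =
    ∑ s ∈ Finset.range t, (f (z R s h) - g (z R s h)) ^ 2 / R.sigBar s h ^ 2 := by
  rw [Finset.sum_range]
  rfl

lemma weightedSqDist_mono (hst : s ≤ t) : weightedSqDist R s h f g ≤ weightedSqDist R t h f g := by
  rw [weightedSqDist_eq_sum_range, weightedSqDist_eq_sum_range]
  exact Finset.sum_le_sum_of_subset_of_nonneg (Finset.range_subset_range.2 hst)
    fun _ _ _ => by positivity

lemma weightedSqDist_comm : weightedSqDist R t h f g = weightedSqDist R t h g f :=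
  Finset.sum_congr rfl fun _ _ => by rw [sub_sq_comm]

variable [MeasurableSpace X] [MeasurableSpace A] {S : Setup X A}

lemma weightedSqDist_le (hS : S.Admissible) (hR : S.FollowsRegressions R) (ht : t < S.T)
    (hh : h < S.M.H) (hf : f ∈ S.F h) (hg : g ∈ S.F h) :
    weightedSqDist R t h f g ≤ S.T * (S.L ^ 2 / S.α ^ 2) := by
  have hα := hS.α_pos
  have term_le : ∀ i, (f (zs R t h i) - g (zs R t h i)) ^ 2 / sigs R t h i ^ 2 ≤
      S.L ^ 2 / S.α ^ 2 := fun i => by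
    have hσ := α_le_sigs hR ht hh i
    have dist_le := (Real.dist_le_of_mem_Icc (hS.complete.range h hh f hf (zs R t h i))
      (hS.complete.range h hh g hg (zs R t h i))).trans_eq (sub_zero _)
    rw [← sq_abs]
    gcongr
    exact dist_le
  calc weightedSqDist R t h f g ≤ ∑ _i : Fin t, S.L ^ 2 / S.α ^ 2 :=
        Finset.sum_le_sum fun i _ => term_le i
    _ = t * (S.L ^ 2 / S.α ^ 2) := by
        rw [Finset.sum_const, Finset.card_fin, nsmul_eq_mul]
    _ ≤ S.T * (S.L ^ 2 / S.α ^ 2) := by gcongr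

lemma exists_lt_levels_le_two_pow (hP : S.NumericRegime) {Q : ℝ} (one_le_Q : 1 ≤ Q)
    (hQ : Q ≤ S.T * (S.L ^ 2 / S.α ^ 2)) :
    ∃ k < S.levels, Q ≤ 2 ^ k ∧ (2 : ℝ) ^ k ≤ 2 * Q := by
  obtain ⟨n, two_pow_le, lt_two_pow⟩ := exists_nat_pow_near one_le_Q (one_lt_two : (1 : ℝ) < 2)
  refine ⟨n + 1, ?_, lt_two_pow.le, by rw [pow_succ]; linarith⟩
  have four_le_ratio := hP.four_le_ratio
  have levels_ge := hP.log_ratio_le_logFactor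
  set ρ := 4 * S.L * S.T / S.α with hρ
  have Q_le_sq : Q ≤ ρ ^ 2 := by
    calc Q ≤ S.T * (S.L ^ 2 / S.α ^ 2) := hQ
      _ ≤ 16 * (S.T : ℝ) ^ 2 * (S.L ^ 2 / S.α ^ 2) := by
          gcongr
          nlinarith [hP.one_le_T]
      _ = ρ ^ 2 := by
          rw [hρ]
          ring
  have mul_log_two_le : n * Real.log 2 ≤ 2 * Real.log ρ := by
    have log_le := Real.log_le_log (by positivity) (two_pow_le.trans Q_le_sq)
    rw [Real.log_pow, Real.log_pow] at log_le
    exact_mod_cast log_le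
  have log_ρ_nonneg : 0 ≤ Real.log ρ := Real.log_nonneg (by linarith)
  have le_levels : n + 2 ≤ S.levels := by
    refine Nat.le_floor ?_
    push_cast
    nlinarith [Real.log_two_gt_d9, n.cast_nonneg (α := ℝ)]
  omega

lemma four_mul_abs_sub_le (hS : S.Admissible) (hR : S.FollowsRegressions R) (hst : s < t)
    (ht : t < S.T) (hh : h < S.M.H) (hf : f ∈ S.F h) (hg : g ∈ S.F h) {B : ℝ}
    (hB : weightedSqDist R t h f g ≤ B) :
    4 * (S.ups + S.iota ^ 2) * |f (z R s h) - g (z R s h)| ≤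
      √(B + S.lam) * R.sigBar s h ^ 2 := by
  have ups_nonneg : 0 ≤ S.ups := Real.sqrt_nonneg _
  have sub_le := abs_sub_le_eluderD_mul hS.lam_pos (sigs R s h) (zs R s h) hf hg (z R s h)
  have past_le : weightedSqDist R s h f g ≤ B := (weightedSqDist_mono hst.le).trans hB
  have eluderD_le := four_mul_eluderD_le_sigBar_sq hR (hst.trans ht) hh
  set D := eluderD (S.F h) S.lam (sigs R s h) (zs R s h) (z R s h)
  have D_nonneg : 0 ≤ D := Real.sqrt_nonneg _
  calc 4 * (S.ups + S.iota ^ 2) * |f (z R s h) - g (z R s h)|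
      ≤ 4 * (S.ups + S.iota ^ 2) * (D * √(weightedSqDist R s h f g + S.lam)) :=
        mul_le_mul_of_nonneg_left sub_le (by positivity)
    _ ≤ 4 * (S.ups + S.iota ^ 2) * (D * √(B + S.lam)) := by gcongr
    _ = √(B + S.lam) * (4 * (S.ups + S.iota ^ 2) * D) := by ring
    _ ≤ √(B + S.lam) * R.sigBar s h ^ 2 := by gcongr

lemma noise_sum_le_of_weightedNoiseBound (hS : S.Admissible) (hR : S.FollowsRegressions R)
    (ht : t < S.T) (hh : h < S.M.H) {q : X × A → X → ℝ} {c τ Y : ℝ}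
    (hnoise : WeightedNoiseBound (S.M.P h) (S.F h) q 2 (c / √(2 ^ k + S.lam)) τ Y (sigs R t h)
      (zs R t h) fun s => R.x s (h + 1))
    (hc : 0 < c) (hc_le : c ≤ S.ups + S.iota ^ 2) (hτ : 0 ≤ τ) (hf : f ∈ S.F h) (hg : g ∈ S.F h)
    (hdist : weightedSqDist R t h f g ≤ 2 ^ k)
    (hvar : ∀ s < t, Var[q (z R s h); S.M.P h (z R s h)] ≤ τ * R.sigBar s h ^ 2) :
    ∑ i, (f (zs R t h i) - g (zs R t h i)) / sigs R t h i ^ 2 *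
        noise (S.M.P h) q (zs R t h i) (R.x i (h + 1)) ≤
      (c * τ + Y / c) * √(2 ^ k + S.lam) := by
  have sum_pos : 0 < 2 ^ k + S.lam := add_pos (by positivity) hS.lam_pos
  have increment_le : ∀ s < t,
      2 * (c / √(2 ^ k + S.lam)) * |f (z R s h) - g (z R s h)| ≤ R.sigBar s h ^ 2 :=
    fun s hs => by
      rw [mul_div_assoc', div_mul_eq_mul_div, div_le_iff₀' (Real.sqrt_pos.2 sum_pos)]
      refine le_trans ?_ (four_mul_abs_sub_le hS hR hs ht hh hf hg hdist)
      gcongr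
      linarith
  refine (hnoise f hf g hg fun i => ⟨increment_le i i.2, hvar i i.2⟩).trans
    (scale_mul_add_div_scale_le hc hτ (Real.sqrt_pos.2 sum_pos) ?_)
  rw [Real.sq_sqrt sum_pos.le]
  exact hdist.trans (by linarith [hS.lam_pos])

lemma star_noise_sum_le [Nonempty A] (hS : S.Admissible) (hP : S.NumericRegime)
    (hR : S.FollowsRegressions R) (ht : t < S.T) (hh : h < S.M.H)
    (hconc : ∀ s ≤ t, ∀ h < S.M.H, S.Concentration R s h)
    (hopt : ∀ s ≤ t, ∀ z, S.M.optQ (h + 1) z ≤ S.f1 R s (h + 1) z) (hf : f ∈ S.F h)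
    (hg : g ∈ S.F h) (hk : k < S.levels) (hdist : weightedSqDist R t h f g ≤ 2 ^ k) :
    ∑ i, (f (zs R t h i) - g (zs R t h i)) / sigs R t h i ^ 2 *
        noise (S.M.P h) (fun z y => S.M.r h z y + S.M.optV (h + 1) y) (zs R t h i)
          (R.x i (h + 1)) ≤
      2 * S.ups * √(2 ^ k + S.lam) := by
  have ups_pos : 0 < S.ups := by linarith [hP.two_le_ups]
  refine (noise_sum_le_of_weightedNoiseBound hS hR ht hh
    ((hconc t le_rfl h hh).star k (Finset.mem_range.2 hk)) ups_pos
    (le_add_of_nonneg_right (sq_nonneg _)) zero_le_one hf hg hdist fun s hs => ?_).trans_eq ?_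
  · rw [one_mul]
    exact variance_optV_le_sigBar_sq hS hR (hs.trans ht) hh (hconc s hs.le) (hopt s hs.le)
  · field_simp
    ring

lemma diff_noise_sum_le [Nonempty A] (hS : S.Admissible) (hP : S.NumericRegime)
    (hR : S.FollowsRegressions R) (ht : t < S.T) (hh : h < S.M.H)
    (hconc : ∀ s ≤ t, ∀ h < S.M.H, S.Concentration R s h)
    (hopt : ∀ z, S.M.optQ (h + 1) z ≤ S.f1 R t (h + 1) z)
    (hle : ∀ s ≤ t, ∀ z, S.f1 R t (h + 1) z ≤ S.f2 R s (h + 1) z) (hf : f ∈ S.F h)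
    (hg : g ∈ S.F h) (hk : k < S.levels) (hdist : weightedSqDist R t h f g ≤ 2 ^ k) :
    ∑ i, (f (zs R t h i) - g (zs R t h i)) / sigs R t h i ^ 2 *
        noise (S.M.P h) (fun _ y => maxA (S.f1 R t (h + 1)) y - S.M.optV (h + 1) y) (zs R t h i)
          (R.x i (h + 1)) ≤
      √(2 ^ k + S.lam) := by
  have iota_pos := hP.iota_pos
  refine (noise_sum_le_of_weightedNoiseBound hS hR ht hh
    ((hconc t le_rfl h hh).diff _ (maxA_f1_mem_class1 hS hR ht _) (maxA_f1_mem_Icc hS hR ht _) k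
      (Finset.mem_range.2 hk)) (by positivity)
    (le_add_of_nonneg_left (Real.sqrt_nonneg _)) (by positivity) hf hg hdist fun s hs =>
      variance_f1_sub_optV_le_sigBar_sq hS hR iota_pos (hs.trans ht) ht hh (hconc s hs.le) hopt
        (hle s hs.le)).trans (mul_le_of_le_one_left (Real.sqrt_nonneg _) ?_)
  field_simp
  norm_num

lemma noise_f1_eq_add [Nonempty A] (hS : S.Admissible) (hR : S.FollowsRegressions R)
    (ht : t < S.T) (hh : h < S.M.H) (z : X × A) (y : X) :
    noise (S.M.P h) (fun z y => S.M.r h z y + maxA (S.f1 R t (h + 1)) y) z y =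
      noise (S.M.P h) (fun z y => S.M.r h z y + S.M.optV (h + 1) y) z y +
        noise (S.M.P h) (fun _ y => maxA (S.f1 R t (h + 1)) y - S.M.optV (h + 1) y) z y := by
  have integrable_star := EpisodicMDP.integrable_return hh (measurable_optV hS (h := h + 1) hh)
    (EpisodicMDP.optV_mem_Icc hS.sparse hh) z
  have integrable_f1 := EpisodicMDP.integrable_return hh (measurable_maxA_f1 hS hR ht (h + 1))
    (maxA_f1_mem_Icc hS hR ht (h + 1)) z
  rw [← noise_add integrable_star]
  · simp only [add_add_sub_cancel]
  · convert integrable_f1.sub integrable_star using 1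
    exact funext fun y => (add_sub_add_left_eq_sub _ _ _).symm

lemma weightedSqDist_le_noise_radius [Nonempty A] (hS : S.Admissible) (hP : S.NumericRegime)
    (hR : S.FollowsRegressions R) (ht : t < S.T) (hh : h < S.M.H)
    (hconc : ∀ s ≤ t, ∀ h < S.M.H, S.Concentration R s h)
    (hopt : ∀ s ≤ t, ∀ z, S.M.optQ (h + 1) z ≤ S.f1 R s (h + 1) z)
    (hle : ∀ s ≤ t, ∀ z, S.f1 R t (h + 1) z ≤ S.f2 R s (h + 1) z)
    (hf : f ∈ S.approximants h (S.M.bellman h (maxA (S.f1 R t (h + 1))))) (hk : k < S.levels)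
    (hdist : weightedSqDist R t h (R.fhat1 t h) f ≤ 2 ^ k) :
    weightedSqDist R t h (R.fhat1 t h) f ≤
      5 * S.ups * √(2 ^ k + S.lam) + 2 * (t * S.L * S.eps / S.α ^ 2) := by
  have hg := (hR.fhat1_ls t ht h hh).1
  have basic := IsLeastSquares.sum_sq_sub_le_noise (κ := S.M.P h) (x' := fun s => R.x s (h + 1))
    (q := fun z y => S.M.r h z y + maxA (S.f1 R t (h + 1)) y) hS.α_pos (α_le_sigs hR ht hh)
    (hS.complete.range h hh) (hR.fhat1_ls t ht h hh) hf.1 hf.2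
  simp only [noise_f1_eq_add hS hR ht hh, mul_add, Finset.sum_add_distrib] at basic
  have star_le := star_noise_sum_le hS hP hR ht hh hconc hopt hg hf.1 hk hdist
  have diff_le := diff_noise_sum_le hS hP hR ht hh hconc (hopt t le_rfl) hle hg hf.1 hk hdist
  have absorb_diff : 2 * √(2 ^ k + S.lam) ≤ S.ups * √(2 ^ k + S.lam) :=
    mul_le_mul_of_nonneg_right hP.two_le_ups (Real.sqrt_nonneg _)
  rw [weightedSqDist]
  linarith

lemma beta1_eq (hS : S.Admissible) (t : ℕ) :
    S.beta1 t = √(6 * √S.lam + 156) * S.ups + √(8 * ((t + 1) * S.L * S.eps / S.α ^ 2)) := by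
  have hδ := hS.δ_pos
  have log_arg_eq : (S.N : ℝ) ^ 2 * (S.T + 1) * (S.M.H + 1) * S.logFactor / S.δ =
      (S.N : ℝ) ^ 2 * S.logFactor / S.δth := by
    rw [δth]
    field_simp
  have bias_eq : 8 * ((t : ℝ) + 1) * S.L / S.α ^ 2 * S.eps =
      8 * ((t + 1) * S.L * S.eps / S.α ^ 2) := by ring
  rw [beta1, ups, log_arg_eq, bias_eq]

lemma approximants_subset_conf1 [Nonempty A] (hS : S.Admissible) (hδ : S.δ < 1 / 5)
    (hR : S.FollowsRegressions R) (ht : t < S.T) (hh : h < S.M.H)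
    (hconc : ∀ s ≤ t, ∀ h < S.M.H, S.Concentration R s h)
    (hopt : ∀ s ≤ t, ∀ z, S.M.optQ (h + 1) z ≤ S.f1 R s (h + 1) z)
    (hle : ∀ s ≤ t, ∀ z, S.f1 R t (h + 1) z ≤ S.f2 R s (h + 1) z) :
    S.approximants h (S.M.bellman h (maxA (S.f1 R t (h + 1)))) ⊆ S.conf1 R t h := by
  intro f hf
  refine ⟨hf.1, ?_⟩
  change weightedSqDist R t h f (R.fhat1 t h) ≤ S.beta1 t ^ 2
  have hP := hS.numericRegime hδ hR ht hh
  have hL := hS.one_le_L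
  have heps := hS.eps_nonneg
  rw [weightedSqDist_comm, beta1_eq hS]
  refine le_radius_sq_of_self_bound hP.two_le_ups hS.lam_pos.le (by positivity) fun one_le => ?_
  obtain ⟨k, hk, dist_le, two_pow_le⟩ := exists_lt_levels_le_two_pow hP one_le
    (weightedSqDist_le hS hR ht hh (hR.fhat1_ls t ht h hh).1 hf.1)
  have ups_nonneg : 0 ≤ S.ups := Real.sqrt_nonneg _
  calc weightedSqDist R t h (R.fhat1 t h) f
      ≤ 5 * S.ups * √(2 ^ k + S.lam) + 2 * (t * S.L * S.eps / S.α ^ 2) :=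
        weightedSqDist_le_noise_radius hS hP hR ht hh hconc hopt hle hf hk dist_le
    _ ≤ 5 * S.ups * √(2 * weightedSqDist R t h (R.fhat1 t h) f + S.lam) +
        2 * ((t + 1) * S.L * S.eps / S.α ^ 2) := by
        gcongr
        linarith

/-! ### The good event -/

lemma optimism_of_concentration [Nonempty A] (hS : S.Admissible) (hδ : S.δ < 1 / 5)
    (hR : S.FollowsRegressions R) (hconc : ∀ t < S.T, ∀ h < S.M.H, S.Concentration R t h)
    (ht : t < S.T) (hh : h ≤ S.M.H) :
    (∀ z, S.M.optQ h z ≤ S.f1 R t h z) ∧ (∀ s ≤ t, ∀ z, S.f1 R t h z ≤ S.f2 R s h z) ∧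
    (h < S.M.H →
      S.approximants h (S.M.bellman h (maxA (S.f1 R t (h + 1)))) ⊆ S.conf1 R t h) := by
  induction t using Nat.strong_induction_on generalizing h with
  | _ t earlier =>
  induction hh using Nat.decreasingInduction with
  | self => simp [f1, f2, EpisodicMDP.optQ_terminal]
  | of_succ h hh later =>
    have hopt : ∀ s ≤ t, ∀ z, S.M.optQ (h + 1) z ≤ S.f1 R s (h + 1) z := fun s hs => by
      rcases hs.lt_or_eq with hlt | rfl
      · exact (earlier s hlt (hlt.trans ht) hh).1
      · exact later.1
    have hsub := approximants_subset_conf1 hS hδ hR ht hh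
      (fun s hs => hconc s (hs.trans_lt ht)) hopt later.2.1
    exact ⟨optQ_le_f1_of_succ hS hR ht hh hsub later.1, fun s hs =>
      f1_le_f2_of_succ hS hR hs ht hh (hconc s (hs.trans_lt ht) h hh) hsub (later.2.1 s hs),
      fun _ => hsub⟩

lemma goodEvent_of_concentration [Nonempty A] (hS : S.Admissible) (hδ : S.δ < 1 / 5)
    (hR : S.FollowsRegressions R) (hconc : ∀ t < S.T, ∀ h < S.M.H, S.Concentration R t h) :
    S.GoodEvent R := by
  intro t ht h hh
  have hm := measurable_maxA_f1 hS hR ht (h + 1)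
  have hb := maxA_f1_mem_Icc hS hR ht (h + 1)
  have hbm := mem_Icc_zero_two_of_mem_Icc_zero_one
    (maxA_fm2_mem_Icc hS hR ht (hconc t ht) (h := h + 1) hh)
  exact ⟨⟨approximants_nonempty hS hh hm (mem_Icc_zero_two_of_mem_Icc_zero_one hb),
      (optimism_of_concentration hS hδ hR hconc ht hh.le).2.2 hh⟩,
    ⟨approximants_nonempty hS hh (measurable_maxA_f2 hS hR ht _) (maxA_f2_mem_Icc hS hR ht _),
      approximants_subset_conf2 hS hR ht hh (hconc t ht h hh)⟩,
    ⟨approximants_nonempty hS hh (measurable_maxA_fm2 hS hR ht _) hbm,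
      approximants_subset_confm2 hS hR ht hh (hconc t ht h hh) hbm⟩,
    ⟨approximants_nonempty₂ hS hh hm hb,
      approximants_subset_confG hS hR ht hh (hconc t ht h hh)⟩⟩

end Setup

end VOQL

theorem mainTheorem5_general {X A Ω : Type*} [MeasurableSpace X] [MeasurableSpace A]
    [MeasurableSpace Ω] (μ : MeasureTheory.Measure Ω) [MeasureTheory.IsProbabilityMeasure μ]
    (S : VOQL.Setup X A) (hS : S.Admissible) (𝓗 : ℕ → ℕ → MeasurableSpace Ω)
    (R : Ω → VOQL.RunData X A) (hrun : S.IsRegressionRun μ 𝓗 R) :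
    μ {ω | ¬ S.GoodEvent (R ω)} ≤ ENNReal.ofReal (5 * S.δ) := by
  rcases lt_or_ge S.δ (1 / 5) with hδ | hδ
  · obtain ⟨ω₀⟩ : Nonempty Ω := μ.nonempty_of_neZero
    have : Nonempty A := ⟨(R ω₀).a 0 0⟩
    have bad_subset : {ω | ¬ S.GoodEvent (R ω)} ⊆
        {ω | ¬ ∀ t < S.T, ∀ h < S.M.H, S.Concentration (R ω) t h} := fun ω bad hconc =>
      bad (VOQL.Setup.goodEvent_of_concentration hS hδ (hrun.follows ω) hconc)
    exact (MeasureTheory.measure_mono bad_subset).trans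
      (hrun.measure_not_forall_concentration_le hS hδ)
  · refine MeasureTheory.prob_le_one.trans ?_
    rw [ENNReal.one_le_ofReal]
    linarith

theorem mainTheorem5 {X A Ω : Type*} [MeasurableSpace X] [MeasurableSpace A] [MeasurableSpace Ω]
    (μ : MeasureTheory.Measure Ω) [MeasureTheory.IsProbabilityMeasure μ]
    (S : VOQL.Setup X A)
    (hsparse : S.M.SparseReward) (hcomplete : S.EpsComplete)
    (hmeas : S.MeasurabilityConventions)
    (hL : 1 ≤ S.L) (heps : 0 ≤ S.eps) (heps1 : S.eps ≤ 1) (hepsb : 0 ≤ S.epsb)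
    (hα : 0 < S.α) (hα1 : S.α ≤ 1) (hlam : 0 < S.lam) (hδ : 0 < S.δ)
    (horacle1 : S.IsBonusOracle S.beta1) (horacle2 : S.IsBonusOracle S.beta2)
    (hconsistent1 : S.IsConsistent S.beta1) (hconsistent2 : S.IsConsistent S.beta2)
    (𝓗 : ℕ → ℕ → MeasurableSpace Ω) (R : Ω → VOQL.RunData X A)
    (hrun : S.IsRandomRun μ 𝓗 R) :
    μ {ω | ¬ S.GoodEvent (R ω)} ≤ ENNReal.ofReal (5 * S.δ) :=
  mainTheorem5_general μ S ⟨hsparse, hcomplete, hmeas, hL, heps, hα, hα1, hlam, hδ,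
    horacle1.isCoveringOracle, horacle2.isCoveringOracle, hconsistent1, hconsistent2⟩ 𝓗 R
    hrun.isRegressionRun
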